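/- Let $\Sigma=\{u\in H^1(\mathbb R;\mathbb C): xu\in L^2(\mathbb R)\}$ with norm $\|u\|_\Sigma=(\|u\|_{2}^2+\|u'\|_{2}^2+\|xu\|_{2}^2)^{1/2}$, let $L^2_r$ be the space of even functions in $L^2(\mathbb R;\mathbb C)$, regarded as a real Hilbert space with inner product $\mathrm{Re}\int u\bar h\,dx$, and let $\Sigma_r=\Sigma\cap L^2_r$. For $\lambda,\eta\in\mathbb R$ consider $$2iu_t=-u_{xx}+\lambda x^2u+\eta\,(|x|^2*|u|^2)\,u,\qquad (t,x)\in\mathbb R^{1+1},\tag{H}$$ whose solutions are functions $u\in C(\mathbb R;\Sigma)$ satisfying (H) in the dual $\Sigma^{-1}$ of $\Sigma$. Set $$E(u)=\tfrac12\|u'\|_2^2+\tfrac{\lambda}{2}\|xu\|_2^2+\tfrac{\eta}{4}\iint|x-y|^2|u(x)|^2|u(y)|^2\,dx\,dy,\qquad Q(u)=\tfrac12\|u\|_2^2,\qquad S_\omega=E-\omega Q .$$ A solution of (H) of the form $e^{-i\omega t/2}\phi$ with $\phi\in\Sigma_r$ is called stable (under even perturbations) if for every $\varepsilon>0$ there is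 $\delta>0$ such that for every $u_0\in\Sigma_r$ with $\|u_0-\phi\|_\Sigma<\delta$ there is exactly one global solution $u\in C(\mathbb R;\Sigma_r)$ of (H) with $u(0)=u_0$, and it satisfies $\inf_{s\in\mathbb R}\|\phi-e^{is}u(t)\|_\Sigma<\varepsilon$ for all $t>0$. A frequency-to-standing-wave map near $\omega$ is a $C^1$ map $\sigma\mapsto\phi_\sigma\in\Sigma_r$ from an open interval around $\omega$ to $\Sigma$ such that for all $\sigma$ in the interval $S_\sigma'(\phi_\sigma)=0$ and the kernel of $S_\sigma''(\phi_\sigma)|_{L^2_r}$ is $\mathbb R\,i\phi_\sigma$; along it put $d(\sigma)=S_\sigma(\phi_\sigma)$. Finally, $n(S_\omega''(\phi_\omega)|_{L^2_r})$ denotes the number of negative eigenvalues of $S_\omega''(\phi_\omega)$ on $L^2_r$, counted with real multiplicity (the Morse index). (i) Let $\lambda=0$ and $\eta=1$. For every $m\in\mathbb N=\{0,1,2,\dots\}$ there are $\omega\in\mathbb R$ and a frequency-to-standing-wave map $\sigma\mapsto\phi_\sigma\in\Sigma_r$ near $\omega$ such that $e^{-i\omega t/2}\phi_\omega$ is a stable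 standing wave, $d''(\omega)<0$ and $n(S_\omega''(\phi_\omega)|_{L^2_r})=2m$. (ii) Let $\lambda=2$ and $\eta=-1$. For every $m\in\mathbb N$ there are $\omega\in\mathbb R$ and a frequency-to-standing-wave map $\sigma\mapsto\phi_\sigma\in\Sigma_r$ near $\omega$ such that $e^{-i\omega t/2}\phi_\omega$ is a stable standing wave, $d''(\omega)>0$ and $n(S_\omega''(\phi_\omega)|_{L^2_r})=2m+1$. In both cases, if $m\ge1$ then $\phi_\omega$ can be chosen so that, in addition, it is an excited state, i.e. there is $v\in\Sigma$ with $Q(v)=Q(\phi_\omega)$ and $E(v)<E(\phi_\omega)$. So there exist stable excited states with arbitrarily high Morse index. -/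

import Mathlib

open MeasureTheory Set

noncomputable section

/-- The complex Hilbert space `L²(ℝ)`. -/
abbrev L2 : Type := Lp ℂ 2 (volume : Measure ℝ)

/-- `g` is the weak (distributional) derivative of `f` on `ℝ`. -/
def HasWeakDeriv (f g : ℝ → ℂ) : Prop :=
  ∀ ψ : ℝ → ℂ, ContDiff ℝ (⊤ : ℕ∞) ψ → HasCompactSupport ψ →
    ∫ x, f x * deriv ψ x = -∫ x, g x * ψ x

theorem integrable_L2_mul (f : L2) {ψ : ℝ → ℂ} (hc : Continuous ψ) (hs : HasCompactSupport ψ) :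
    Integrable (fun x => f x * ψ x) (volume : Measure ℝ) :=
  (Lp.memLp f).integrable_mul (q := 2) (hc.memLp_of_hasCompactSupport hs)

/-- The space `Σ = {u ∈ H¹(ℝ) : x u ∈ L²(ℝ)}`.  An element is stored as the triple `(u, u', x u)`
of elements of `L²(ℝ)`; the second and third entries are determined by the first one.  The inherited
norm is `‖u‖_Σ = (‖u‖² + ‖u'‖² + ‖x u‖²)^(1/2)` with `L²` norms on the right. -/
def SigmaSubmodule : Submodule ℂ (PiLp 2 (fun _ : Fin 3 => L2)) where
  carrier := {w | HasWeakDeriv (w 0) (w 1) ∧ (w 2 : ℝ → ℂ) =ᵐ[volume] fun x => (x : ℂ) * w 0 x}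
  zero_mem' := by
    refine ⟨fun ψ _ _ => by simp, ?_⟩
    filter_upwards [Lp.coeFn_zero ℂ 2 (volume : Measure ℝ)] with x hx
    simp
  add_mem' := by
    rintro v w ⟨hv1, hv2⟩ ⟨hw1, hw2⟩
    refine ⟨fun ψ hψ hs => ?_, ?_⟩
    · have hd : Continuous (deriv ψ) := hψ.continuous_deriv (by simp)
      have e1 : ∫ x, ((v 0 + w 0 : L2) : ℝ → ℂ) x * deriv ψ x
          = (∫ x, v 0 x * deriv ψ x) + ∫ x, w 0 x * deriv ψ x := by
        rw [← integral_add (integrable_L2_mul _ hd hs.deriv) (integrable_L2_mul _ hd hs.deriv)]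
        refine integral_congr_ae ?_
        filter_upwards [Lp.coeFn_add (v 0) (w 0)] with x hx
        rw [hx, Pi.add_apply, add_mul]
      have e2 : ∫ x, ((v 1 + w 1 : L2) : ℝ → ℂ) x * ψ x
          = (∫ x, v 1 x * ψ x) + ∫ x, w 1 x * ψ x := by
        rw [← integral_add (integrable_L2_mul _ hψ.continuous hs)
          (integrable_L2_mul _ hψ.continuous hs)]
        refine integral_congr_ae ?_
        filter_upwards [Lp.coeFn_add (v 1) (w 1)] with x hx
        rw [hx, Pi.add_apply, add_mul]
      simp only [PiLp.add_apply]
      rw [e1, e2, hv1 ψ hψ hs, hw1 ψ hψ hs, neg_add]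
    · simp only [PiLp.add_apply]
      filter_upwards [hv2, hw2, Lp.coeFn_add (v 0) (w 0), Lp.coeFn_add (v 2) (w 2)]
        with x h1 h2 h3 h4
      rw [h4, h3, Pi.add_apply, Pi.add_apply, h1, h2, mul_add]
  smul_mem' := by
    rintro c w ⟨hw1, hw2⟩
    refine ⟨fun ψ hψ hs => ?_, ?_⟩
    · have e1 : ∫ x, ((c • w 0 : L2) : ℝ → ℂ) x * deriv ψ x = c * ∫ x, w 0 x * deriv ψ x := by
        rw [← integral_const_mul]
        refine integral_congr_ae ?_
        filter_upwards [Lp.coeFn_smul c (w 0)] with x hx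
        rw [hx, Pi.smul_apply, smul_eq_mul, mul_assoc]
      have e2 : ∫ x, ((c • w 1 : L2) : ℝ → ℂ) x * ψ x = c * ∫ x, w 1 x * ψ x := by
        rw [← integral_const_mul]
        refine integral_congr_ae ?_
        filter_upwards [Lp.coeFn_smul c (w 1)] with x hx
        rw [hx, Pi.smul_apply, smul_eq_mul, mul_assoc]
      simp only [PiLp.smul_apply]
      rw [e1, e2, hw1 ψ hψ hs, mul_neg]
    · simp only [PiLp.smul_apply]
      filter_upwards [hw2, Lp.coeFn_smul c (w 0), Lp.coeFn_smul c (w 2)] with x h1 h2 h3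
      rw [h3, h2, Pi.smul_apply, Pi.smul_apply, h1, smul_eq_mul, smul_eq_mul]
      ring

/-- `Σ` as a normed space. -/
abbrev SigmaSpace : Type := ↥SigmaSubmodule

namespace SigmaSpace

/-- The underlying `L²` function of an element of `Σ`. -/
def fn (u : SigmaSpace) : L2 := u.1 0

/-- The weak derivative `u'`. -/
def der (u : SigmaSpace) : L2 := u.1 1

/-- The function `x ↦ x u(x)`. -/
def mulX (u : SigmaSpace) : L2 := u.1 2

end SigmaSpace

/-- The subspace `Σ_r` of the even functions in `Σ`. -/
def EvenSigma : Submodule ℂ SigmaSpace where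
  carrier := {u | (fun x : ℝ => u.fn (-x)) =ᵐ[volume] fun x : ℝ => u.fn x}
  zero_mem' := by
    have h0 := Lp.coeFn_zero ℂ 2 (volume : Measure ℝ)
    have h1 := (Measure.measurePreserving_neg (volume : Measure ℝ)).quasiMeasurePreserving.ae h0
    change (fun x : ℝ => ((0 : L2) : ℝ → ℂ) (-x)) =ᵐ[volume] fun x : ℝ => ((0 : L2) : ℝ → ℂ) x
    filter_upwards [h0, h1] with x hx hx'
    rw [hx, hx']
    rfl
  add_mem' := by
    intro v w hv hw
    have h0 := Lp.coeFn_add v.fn w.fn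
    have h1 := (Measure.measurePreserving_neg (volume : Measure ℝ)).quasiMeasurePreserving.ae h0
    change (fun x : ℝ => ((v.fn + w.fn : L2) : ℝ → ℂ) (-x))
      =ᵐ[volume] fun x : ℝ => ((v.fn + w.fn : L2) : ℝ → ℂ) x
    filter_upwards [h0, h1, hv, hw] with x hx hx' hvx hwx
    rw [hx, hx', Pi.add_apply, Pi.add_apply, hvx, hwx]
  smul_mem' := by
    intro c w hw
    have h0 := Lp.coeFn_smul c w.fn
    have h1 := (Measure.measurePreserving_neg (volume : Measure ℝ)).quasiMeasurePreserving.ae h0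
    change (fun x : ℝ => ((c • w.fn : L2) : ℝ → ℂ) (-x))
      =ᵐ[volume] fun x : ℝ => ((c • w.fn : L2) : ℝ → ℂ) x
    filter_upwards [h0, h1, hw] with x hx hx' hwx
    rw [hx, hx', Pi.smul_apply, Pi.smul_apply, hwx]

/-- The nonlocal potential `(|x|² * |u|²)(x) = ∫ |x - y|² |u(y)|² dy`. -/
def potential (u : SigmaSpace) (x : ℝ) : ℝ := ∫ y, (x - y) ^ 2 * ‖u.fn y‖ ^ 2

/-- `u ∈ C(ℝ; Σ)` is a global solution of
`2 i u_t = -u'' + lam x² u + eta (|x|² * |u|²) u` in the dual `Σ⁻¹` of `Σ`,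
that is, after pairing with an arbitrary `h ∈ Σ`. -/
def IsSolution (lam eta : ℝ) (u : ℝ → SigmaSpace) : Prop :=
  Continuous u ∧ ∀ (h : SigmaSpace) (t : ℝ),
    HasDerivAt (fun τ : ℝ => 2 * Complex.I * inner ℂ h.fn (u τ).fn)
      (inner ℂ h.der (u t).der + (lam : ℂ) * inner ℂ h.mulX (u t).mulX
        + (eta : ℂ) * ∫ x, (potential (u t) x : ℂ) * (u t).fn x * starRingEnd ℂ (h.fn x)) t

/-- The function `t ↦ e^{-i ω t / 2} φ`. -/
def standingWave (ω : ℝ) (φ : SigmaSpace) (t : ℝ) : SigmaSpace :=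
  Complex.exp (-(Complex.I * ω * t / 2)) • φ

/-- Stability of the standing wave `e^{-i ω t / 2} φ` in `Σ_r`, i.e. under even perturbations.
It includes that the standing wave solves the equation and that the Cauchy problem with data near
`φ` has one and only one global solution in `Σ_r`.  A translate of a nonzero even function in `L²`
is even only for the trivial translation, so the distance in `Σ_r` to the orbit of `φ` involves
phases only.  Since `ε` is arbitrary, `inf < ε` for all `t > 0` may replace `sup inf < ε`. -/
def IsStable (lam eta ω : ℝ) (φ : SigmaSpace) : Prop :=
  φ ∈ EvenSigma ∧ IsSolution lam eta (standingWave ω φ) ∧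
  ∀ ε : ℝ, 0 < ε → ∃ δ : ℝ, 0 < δ ∧ ∀ u₀ ∈ EvenSigma, ‖u₀ - φ‖ < δ →
    ∃ u : ℝ → SigmaSpace,
      (IsSolution lam eta u ∧ (∀ t, u t ∈ EvenSigma) ∧ u 0 = u₀) ∧
      (∀ v : ℝ → SigmaSpace, IsSolution lam eta v → (∀ t, v t ∈ EvenSigma) → v 0 = u₀ → v = u) ∧
      ∀ t : ℝ, 0 < t → ∃ s : ℝ, ‖φ - Complex.exp (Complex.I * s) • u t‖ < ε

/-- The energy
`E(u) = ½ ‖u'‖² + (lam / 2) ‖x u‖² + (eta / 4) ∬ |x - y|² |u(x)|² |u(y)|² dx dy`. -/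
def energy (lam eta : ℝ) (u : SigmaSpace) : ℝ :=
  1 / 2 * ‖u.der‖ ^ 2 + lam / 2 * ‖u.mulX‖ ^ 2
    + eta / 4 * ∫ x : ℝ, ∫ y : ℝ, (x - y) ^ 2 * ‖u.fn x‖ ^ 2 * ‖u.fn y‖ ^ 2

/-- The charge `Q(u) = ½ ‖u‖²`. -/
def charge (u : SigmaSpace) : ℝ := 1 / 2 * ‖u.fn‖ ^ 2

/-- The action `S_ω = E - ω Q`. -/
def action (lam eta ω : ℝ) (u : SigmaSpace) : ℝ := energy lam eta u - ω * charge u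

/-- The second derivative `S_ω''(φ)` on the real normed space `Σ`, as a bilinear form. -/
def actionHess (lam eta ω : ℝ) (φ : SigmaSpace) : SigmaSpace →L[ℝ] SigmaSpace →L[ℝ] ℝ :=
  fderiv ℝ (fderiv ℝ (action lam eta ω)) φ

/-- The eigenspace of `S_ω''(φ)` restricted to `L²_r` for the eigenvalue `μ`: the `w ∈ Σ_r` with
`S_ω''(φ) w = μ w`, where `S_ω''(φ)` is the operator on the real Hilbert space `L²_r`, with inner
product `Re (w, h)`, that is given by the quadratic form. -/
def hessEigenspace (lam eta ω : ℝ) (φ : SigmaSpace) (μ : ℝ) : Submodule ℝ SigmaSpace where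
  carrier := {w | w ∈ EvenSigma ∧ ∀ h ∈ EvenSigma,
    actionHess lam eta ω φ w h = μ * (inner ℂ w.fn h.fn).re}
  zero_mem' := by
    refine ⟨EvenSigma.zero_mem, fun h _ => ?_⟩
    have : SigmaSpace.fn 0 = 0 := rfl
    simp [this]
  add_mem' := by
    rintro v w ⟨hv, hv'⟩ ⟨hw, hw'⟩
    refine ⟨EvenSigma.add_mem hv hw, fun h hh => ?_⟩
    have : SigmaSpace.fn (v + w) = v.fn + w.fn := rfl
    simp [this, hv' h hh, hw' h hh, inner_add_left]
    ring
  smul_mem' := by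
    rintro c w ⟨hw, hw'⟩
    have hc : c • w = (c : ℂ) • w := (Complex.coe_smul c w).symm
    refine ⟨by rw [hc]; exact EvenSigma.smul_mem _ hw, fun h hh => ?_⟩
    have : SigmaSpace.fn (c • w) = (c : ℂ) • w.fn := by rw [hc]; rfl
    simp only [this, map_smul, smul_apply, hw' h hh, inner_smul_left,
      smul_eq_mul, Complex.conj_ofReal, Complex.re_ofReal_mul]
    ring

/-- `n(S_ω''(φ)|_{L²_r}) = k`: there are exactly `k` negative eigenvalues, counted with (real)
multiplicity.  Eigenspaces of distinct eigenvalues are independent, so the sum of the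
multiplicities is the dimension of the sum of the eigenspaces. -/
def HasMorseIndex (lam eta ω : ℝ) (φ : SigmaSpace) (k : ℕ) : Prop :=
  Module.rank ℝ ↥(⨆ μ : Iio (0 : ℝ), hessEigenspace lam eta ω φ μ) = k

/-- A frequency-to-standing-wave map near `ω`: a `C¹` map `σ ↦ φ_σ` from an open interval around
`ω` to `Σ` with values in `Σ_r` such that `S_σ'(φ_σ) = 0` and such that the kernel of
`S_σ''(φ_σ)` on even functions is spanned over `ℝ` by `i φ_σ`. -/
def IsStandingWaveMap (lam eta ω : ℝ) (φ : ℝ → SigmaSpace) : Prop :=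
  ∃ ε : ℝ, 0 < ε ∧ ContDiffOn ℝ 1 φ (Ioo (ω - ε) (ω + ε)) ∧
    ∀ σ ∈ Ioo (ω - ε) (ω + ε),
      φ σ ∈ EvenSigma ∧
      HasFDerivAt (action lam eta σ) (0 : SigmaSpace →L[ℝ] ℝ) (φ σ) ∧
      hessEigenspace lam eta σ (φ σ) 0 = Submodule.span ℝ {Complex.I • φ σ}

/-- `φ` is an excited state: it does not minimize the energy among the functions of the same
charge. -/
def IsExcited (lam eta : ℝ) (φ : SigmaSpace) : Prop :=
  ∃ v : SigmaSpace, charge v = charge φ ∧ energy lam eta v < energy lam eta φ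

end

/-! For even `u` the first moment of `|u|²` vanishes, so the nonlocal potential collapses to `‖u‖²
x² + ‖x u‖²`. Along an even solution `‖u‖` is conserved. With `a² = lam + eta ‖u‖²` the equation is
therefore the linear harmonic oscillator of frequency `a`, up to a time-dependent phase produced by
`eta ‖x u‖²`. Even solutions are thus explicit (`isSolution_evenSolution`, `eq_evenSolution`), and
`φ = c h`, with `h` the Hermite function of index `2 k` and frequency `a`, is a bound state as soon
as `a² = lam + eta c²`.

Stability holds for every `k` without any spectral condition (`isStable_of_continuousAt`). A datum
near `φ` has its own oscillator frequency `b` near `a`. The Hermite profile of frequency `b` is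
close to `φ` and evolves by a phase only, while the difference between datum and profile is moved by
the oscillator group, which is bounded uniformly in time.

For the Morse index, the second derivative at `φ` is the oscillator minus its `2 k`-th level plus a
rank-two term coupling `φ` with `x² φ`. Eigenvectors with eigenvalue `≤ 0` lie in the span of the
Hermite functions of index `0, 2, …, 2 k + 2` (`hessEigenspace_eq_map`), which leaves a finite
matrix. Its imaginary block is diagonal with entries `4 a (j - k)`, hence `k` negative directions
and the kernel direction `i φ`. In the real block, eliminating the neighbours of the middle
coordinate leaves for it the coefficient `(4 k + 1) κ (4 a² - κ) / (2 a³)` with `κ = eta c² = a² -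
lam`. As `κ < 4 a²`, its sign is that of `eta`: the index is `2 k` for `eta = 1`
(`hessOp_morse_self`) and `2 k + 1` for `eta = -1` (`hessOp_morse_neg`), and the kernel contains
nothing besides the phase direction.

Finally `d' = -Q = -(eta / 2) (a² - lam)` and `a` increases with the frequency, so `d''` has the
sign of `-eta`. The energy of the bound state is `a c² (4 k + 1) / 2`, so for `k ≥ 1` the Gaussian
of the same charge lies lower. -/

noncomputable section

open Filter Topology

/-! ### Moments in `Σ` and the potential of an even function -/

namespace SigmaSpace

@[ext] theorem ext_components {u v : SigmaSpace} (h0 : u.fn = v.fn) (h1 : u.der = v.der)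
    (h2 : u.mulX = v.mulX) : u = v := by
  apply Subtype.ext
  ext i : 1
  fin_cases i
  · exact h0
  · exact h1
  · exact h2

theorem hasWeakDeriv (u : SigmaSpace) : HasWeakDeriv u.fn u.der := u.2.1

theorem mulX_ae (u : SigmaSpace) : (u.mulX : ℝ → ℂ) =ᵐ[volume] fun x => (x : ℂ) * u.fn x := u.2.2

theorem fn_add (u v : SigmaSpace) : (u + v).fn = u.fn + v.fn := rfl
theorem der_add (u v : SigmaSpace) : (u + v).der = u.der + v.der := rfl
theorem mulX_add (u v : SigmaSpace) : (u + v).mulX = u.mulX + v.mulX := rfl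
theorem fn_smul (c : ℂ) (u : SigmaSpace) : (c • u).fn = c • u.fn := rfl
theorem der_smul (c : ℂ) (u : SigmaSpace) : (c • u).der = c • u.der := rfl
theorem mulX_smul (c : ℂ) (u : SigmaSpace) : (c • u).mulX = c • u.mulX := rfl

theorem norm_sq_eq (u : SigmaSpace) : ‖u‖ ^ 2 = ‖u.fn‖ ^ 2 + ‖u.der‖ ^ 2 + ‖u.mulX‖ ^ 2 := by
  have h : ‖u‖ ^ 2 = ‖u.1‖ ^ 2 := rfl
  rw [h, PiLp.norm_sq_eq_of_L2, Fin.sum_univ_three]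
  rfl

/-- `u ↦ u` as a continuous linear map `Σ → L²`. -/
def fnL : SigmaSpace →L[ℂ] L2 :=
  (PiLp.proj 2 (fun _ : Fin 3 => L2) 0).comp SigmaSubmodule.subtypeL

/-- `u ↦ u'` as a continuous linear map `Σ → L²`. -/
def derL : SigmaSpace →L[ℂ] L2 :=
  (PiLp.proj 2 (fun _ : Fin 3 => L2) 1).comp SigmaSubmodule.subtypeL

/-- `u ↦ x u` as a continuous linear map `Σ → L²`. -/
def mulXL : SigmaSpace →L[ℂ] L2 :=
  (PiLp.proj 2 (fun _ : Fin 3 => L2) 2).comp SigmaSubmodule.subtypeL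

@[simp] theorem fnL_apply (u : SigmaSpace) : fnL u = u.fn := rfl

theorem continuous_fn : Continuous fn := fnL.continuous
theorem continuous_der : Continuous der := derL.continuous
theorem continuous_mulX : Continuous mulX := mulXL.continuous

/-- Weak derivatives are unique because test functions separate locally integrable functions.
Identities in `Σ` can therefore be checked on Hermite coefficients in `L²`. -/
theorem ext_fn {u v : SigmaSpace} (h0 : u.fn = v.fn) : u = v := by
  refine ext_components h0 ?_ ?_
  · apply Lp.ext
    refine ae_eq_of_integral_contDiff_smul_eq
      ((Lp.memLp u.der).locallyIntegrable (by norm_num))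
      ((Lp.memLp v.der).locallyIntegrable (by norm_num)) fun g hg hs => ?_
    have hg' : ContDiff ℝ (⊤ : ℕ∞) (fun x => (g x : ℂ)) :=
      Complex.ofRealCLM.contDiff.comp hg
    have hs' : HasCompactSupport (fun x => (g x : ℂ)) := hs.comp_left (g := Complex.ofReal) rfl
    have e1 := u.hasWeakDeriv _ hg' hs'
    have e2 := v.hasWeakDeriv _ hg' hs'
    rw [h0, e2] at e1
    simpa [mul_comm, Complex.real_smul] using (neg_injective e1).symm
  · apply Lp.ext
    filter_upwards [u.mulX_ae, v.mulX_ae] with x h1 h2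
    rw [h1, h2, h0]

theorem inner_mulX_comm (u v : SigmaSpace) : inner ℂ u.mulX v.fn = inner ℂ u.fn v.mulX := by
  rw [L2.inner_def, L2.inner_def]
  refine integral_congr_ae ?_
  filter_upwards [u.mulX_ae, v.mulX_ae] with x h1 h2
  simp only [h1, h2, RCLike.inner_apply, map_mul, Complex.conj_ofReal]
  ring

/-- The integrand is odd. This cancellation removes the linear term from the potential and the
moment terms from the second derivative of the action. -/
theorem inner_fn_mulX_even {u v : SigmaSpace} (hu : u ∈ EvenSigma) (hv : v ∈ EvenSigma) :
    inner ℂ u.fn v.mulX = 0 := by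
  have hu' : (fun x : ℝ => u.fn (-x)) =ᵐ[volume] fun x : ℝ => u.fn x := hu
  have hv' : (fun x : ℝ => v.fn (-x)) =ᵐ[volume] fun x : ℝ => v.fn x := hv
  have e : inner ℂ u.fn v.mulX = ∫ x : ℝ, (x : ℂ) * (v.fn x * starRingEnd ℂ (u.fn x)) := by
    rw [L2.inner_def]
    refine integral_congr_ae ?_
    filter_upwards [v.mulX_ae] with x h
    simp only [h, RCLike.inner_apply]
    ring
  have e2 : ∫ x : ℝ, (x : ℂ) * (v.fn x * starRingEnd ℂ (u.fn x)) =
      -∫ x : ℝ, (x : ℂ) * (v.fn x * starRingEnd ℂ (u.fn x)) := by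
    conv_lhs => rw [← integral_neg_eq_self]
    rw [← integral_neg]
    refine integral_congr_ae ?_
    filter_upwards [hu', hv'] with x h1 h2
    simp only [h1, h2]
    push_cast
    ring
  rw [e]
  exact self_eq_neg.mp e2

theorem integrable_fn_sq (u : SigmaSpace) : Integrable (fun x => ‖u.fn x‖ ^ 2) :=
  (Lp.memLp u.fn).norm.integrable_sq

theorem integrable_mulX_sq (u : SigmaSpace) : Integrable (fun x => x ^ 2 * ‖u.fn x‖ ^ 2) := by
  refine (Lp.memLp u.mulX).norm.integrable_sq.congr ?_
  filter_upwards [u.mulX_ae] with x h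
  simp [h, mul_pow]

theorem integral_fn_sq (u : SigmaSpace) : ∫ x, ‖u.fn x‖ ^ 2 = ‖u.fn‖ ^ 2 := by
  have h := L2.inner_def (𝕜 := ℂ) u.fn u.fn
  have h2 : ∫ x, inner ℂ (u.fn x) (u.fn x) = ((∫ x, ‖u.fn x‖ ^ 2 : ℝ) : ℂ) := by
    rw [← integral_complex_ofReal]
    congr 1
    ext x
    rw [inner_self_eq_norm_sq_to_K]
    norm_cast
  rw [← inner_self_eq_norm_sq (𝕜 := ℂ), h, h2]
  rfl

theorem integral_mulX_sq (u : SigmaSpace) : ∫ x, x ^ 2 * ‖u.fn x‖ ^ 2 = ‖u.mulX‖ ^ 2 := by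
  have h := L2.inner_def (𝕜 := ℂ) u.mulX u.mulX
  have h2 : ∫ x, inner ℂ (u.mulX x) (u.mulX x) = ((∫ x, x ^ 2 * ‖u.fn x‖ ^ 2 : ℝ) : ℂ) := by
    rw [← integral_complex_ofReal]
    refine integral_congr_ae ?_
    filter_upwards [u.mulX_ae] with x hx
    rw [inner_self_eq_norm_sq_to_K, hx]
    simp [mul_pow, ← Complex.ofReal_pow]
  rw [← inner_self_eq_norm_sq (𝕜 := ℂ), h, h2]
  rfl

/-- The first moment `∫ x |u|² dx`. -/
def moment (u : SigmaSpace) : ℝ := (inner ℂ u.fn u.mulX).re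

theorem moment_even {u : SigmaSpace} (hu : u ∈ EvenSigma) : u.moment = 0 := by
  rw [moment, inner_fn_mulX_even hu hu, Complex.zero_re]

theorem integrable_moment (u : SigmaSpace) : Integrable (fun x => x * ‖u.fn x‖ ^ 2) := by
  refine ((u.integrable_fn_sq.add u.integrable_mulX_sq)).mono'
    ((measurable_id.aestronglyMeasurable).mul
      (Lp.memLp u.fn).norm.integrable_sq.aestronglyMeasurable) (Filter.Eventually.of_forall fun x => ?_)
  have := sq_nonneg (‖u.fn x‖)
  simp only [Pi.add_apply, norm_mul, Real.norm_eq_abs, abs_of_nonneg this]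
  have h : |x| ≤ 1 + x ^ 2 := by
    rw [abs_le]; constructor <;> nlinarith [sq_nonneg (x - 1), sq_nonneg (x + 1)]
  nlinarith

theorem integral_moment (u : SigmaSpace) : ∫ x, x * ‖u.fn x‖ ^ 2 = u.moment := by
  have h := L2.inner_def (𝕜 := ℂ) u.fn u.mulX
  have h2 : ∫ x, inner ℂ (u.fn x) (u.mulX x) = ((∫ x, x * ‖u.fn x‖ ^ 2 : ℝ) : ℂ) := by
    rw [← integral_complex_ofReal]
    refine integral_congr_ae ?_
    filter_upwards [u.mulX_ae] with x hx
    rw [hx, RCLike.inner_apply, mul_assoc, Complex.mul_conj']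
    push_cast; rfl
  rw [h2] at h
  rw [moment, h, Complex.ofReal_re]

theorem integral_sub_add {f g h : ℝ → ℝ} (hf : Integrable f) (hg : Integrable g)
    (hh : Integrable h) (a b c : ℝ) :
    ∫ x, (a * f x - b * g x + c * h x) = a * (∫ x, f x) - b * (∫ x, g x) + c * ∫ x, h x := by
  have h1 : Integrable fun x => a * f x - b * g x := (hf.const_mul _).sub (hg.const_mul _)
  rw [integral_add h1 (hh.const_mul _), integral_sub (hf.const_mul _) (hg.const_mul _),
    integral_const_mul, integral_const_mul, integral_const_mul]

theorem potential_eq (u : SigmaSpace) (x : ℝ) :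
    potential u x = x ^ 2 * ‖u.fn‖ ^ 2 - 2 * x * u.moment + ‖u.mulX‖ ^ 2 := by
  have e : ∀ y : ℝ, (x - y) ^ 2 * ‖u.fn y‖ ^ 2
      = x ^ 2 * ‖u.fn y‖ ^ 2 - (2 * x) * (y * ‖u.fn y‖ ^ 2) + 1 * (y ^ 2 * ‖u.fn y‖ ^ 2) := fun y => by ring
  rw [potential]
  simp_rw [e]
  rw [integral_sub_add u.integrable_fn_sq u.integrable_moment u.integrable_mulX_sq,
    integral_fn_sq, integral_moment, integral_mulX_sq, one_mul]

/-- Expanding `(x - y)²` leaves only moments of `|u|²`. The first moment is kept because derivatives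
of the action are taken on all of `Σ`, not only on even functions. -/
theorem energy_eq (lam eta : ℝ) (u : SigmaSpace) :
    energy lam eta u = 1 / 2 * ‖u.der‖ ^ 2 + lam / 2 * ‖u.mulX‖ ^ 2
      + eta / 2 * (‖u.fn‖ ^ 2 * ‖u.mulX‖ ^ 2 - u.moment ^ 2) := by
  have e : ∀ x : ℝ, ∫ y : ℝ, (x - y) ^ 2 * ‖u.fn x‖ ^ 2 * ‖u.fn y‖ ^ 2
      = ‖u.fn‖ ^ 2 * (x ^ 2 * ‖u.fn x‖ ^ 2) - (2 * u.moment) * (x * ‖u.fn x‖ ^ 2)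
        + ‖u.mulX‖ ^ 2 * ‖u.fn x‖ ^ 2 := fun x => by
    have : ∀ y : ℝ, (x - y) ^ 2 * ‖u.fn x‖ ^ 2 * ‖u.fn y‖ ^ 2
      = ‖u.fn x‖ ^ 2 * ((x - y) ^ 2 * ‖u.fn y‖ ^ 2) := fun y => by ring
    simp_rw [this]
    rw [integral_const_mul]
    have := potential_eq u x
    rw [potential] at this
    rw [this]
    ring
  rw [energy]
  simp_rw [e]
  rw [integral_sub_add u.integrable_mulX_sq u.integrable_moment u.integrable_fn_sq,
    integral_fn_sq, integral_moment, integral_mulX_sq]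
  ring

theorem integral_potential {u : SigmaSpace} (hu : u ∈ EvenSigma) (h : SigmaSpace) :
    ∫ x, (potential u x : ℂ) * u.fn x * starRingEnd ℂ (h.fn x)
      = (‖u.fn‖ : ℂ) ^ 2 * inner ℂ h.mulX u.mulX + (‖u.mulX‖ : ℂ) ^ 2 * inner ℂ h.fn u.fn := by
  rw [L2.inner_def, L2.inner_def, ← integral_const_mul, ← integral_const_mul,
    ← integral_add ((L2.integrable_inner _ _).const_mul _) ((L2.integrable_inner _ _).const_mul _)]
  refine integral_congr_ae ?_
  filter_upwards [u.mulX_ae, h.mulX_ae] with x h1 h2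
  rw [potential_eq, moment_even hu, h1, h2]
  simp only [RCLike.inner_apply, map_mul, Complex.conj_ofReal]
  push_cast
  ring

end SigmaSpace

/-! ### Completeness of `Σ` -/

theorem isClosed_sigmaSubmodule :
    IsClosed (SigmaSubmodule : Set (PiLp 2 (fun _ : Fin 3 => L2))) := by
  have key : ∀ (ψ : ℝ → ℂ) (hc : Continuous ψ) (hs : HasCompactSupport ψ) (i : Fin 3),
      Continuous fun w : PiLp 2 (fun _ : Fin 3 => L2) => ∫ x, w i x * ψ x := by
    intro ψ hc hs i
    have hm : MemLp (fun x => starRingEnd ℂ (ψ x)) 2 (volume : Measure ℝ) :=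
      (hc.star).memLp_of_hasCompactSupport (hs.comp_left (g := star) (star_zero _))
    have e : ∀ w : PiLp 2 (fun _ : Fin 3 => L2), ∫ x, w i x * ψ x = inner ℂ (hm.toLp _) (w i) := by
      intro w
      rw [L2.inner_def]
      refine integral_congr_ae ?_
      filter_upwards [hm.coeFn_toLp] with x hx
      rw [hx, RCLike.inner_apply, RCLike.conj_conj]
    simp_rw [e]
    exact continuous_const.inner (PiLp.continuous_apply 2 _ i)
  -- The almost everywhere condition on `x u` is rewritten as equality of pairings with test
  -- functions. Such pairings are continuous in `L²`, so both conditions become closed.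
  have hset : (SigmaSubmodule : Set (PiLp 2 (fun _ : Fin 3 => L2))) =
      {w | HasWeakDeriv (w 0) (w 1)} ∩ {w | ∀ ψ : ℝ → ℝ, ContDiff ℝ (⊤ : ℕ∞) ψ →
        HasCompactSupport ψ → ∫ x, w 2 x * (ψ x : ℂ) = ∫ x : ℝ, w 0 x * ((x : ℂ) * ψ x)} := by
    ext w
    refine and_congr_right fun _ => ⟨fun h ψ _ _ => integral_congr_ae ?_, fun h => ?_⟩
    · have h : (w 2 : ℝ → ℂ) =ᵐ[volume] fun x => (x : ℂ) * w 0 x := h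
      filter_upwards [h] with x hx
      rw [hx]; ring
    · have hloc : LocallyIntegrable (fun x : ℝ => (x : ℂ) * w 0 x) :=
        (((Lp.memLp (w 0)).locallyIntegrable (by norm_num)).locallyIntegrableOn univ |>.continuousOn_mul
          Complex.continuous_ofReal.continuousOn isOpen_univ.isLocallyClosed
          |> locallyIntegrableOn_univ.mp)
      refine ae_eq_of_integral_contDiff_smul_eq
        ((Lp.memLp (w 2)).locallyIntegrable (by norm_num)) hloc fun g hg hs => ?_
      have := h g hg hs
      simp only [Complex.real_smul]
      calc _ = ∫ x, w 2 x * (g x : ℂ) := by simp_rw [mul_comm]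
        _ = _ := this
        _ = _ := by congr 1; ext x; ring
  rw [hset]
  refine IsClosed.inter ?_ ?_
  · simp only [HasWeakDeriv, ofPred_forall]
    refine isClosed_iInter fun ψ => isClosed_iInter fun hψ => isClosed_iInter fun hs => ?_
    exact isClosed_eq (key _ (hψ.continuous_deriv (by simp)) hs.deriv 0)
      (key _ hψ.continuous hs 1).neg
  · simp only [ofPred_forall]
    refine isClosed_iInter fun ψ => isClosed_iInter fun hψ => isClosed_iInter fun hs => ?_
    have hc : Continuous fun x => (ψ x : ℂ) := Complex.continuous_ofReal.comp hψ.continuous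
    have hs' : HasCompactSupport fun x => (ψ x : ℂ) := hs.comp_left (g := Complex.ofReal) rfl
    exact isClosed_eq (key _ hc hs' 2)
      (key _ (Complex.continuous_ofReal.mul hc) hs'.mul_left 0)

/-- Completeness gives `weightedEmbedding` a closed range, from which the Hermite coordinates of `Σ`
are built. -/
instance : CompleteSpace SigmaSpace := isClosed_sigmaSubmodule.completeSpace_coe

/-! ### Polynomials times Gaussians as elements of `Σ`, and their dependence on the frequency -/

section

open Polynomial

/-- The product of a polynomial with the Gaussian `exp (-a x² / 2)`. -/
def gaussFun (a : ℝ) (p : ℝ[X]) (x : ℝ) : ℝ := p.eval x * Real.exp (-(a * x ^ 2) / 2)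

theorem gaussFun_add (a : ℝ) (p q : ℝ[X]) (x : ℝ) :
    gaussFun a (p + q) x = gaussFun a p x + gaussFun a q x := by
  simp [gaussFun, add_mul]

theorem gaussFun_smul (a c : ℝ) (p : ℝ[X]) (x : ℝ) :
    gaussFun a (c • p) x = c * gaussFun a p x := by
  simp [gaussFun, mul_assoc]

theorem gaussFun_X_mul (a : ℝ) (p : ℝ[X]) (x : ℝ) : gaussFun a (X * p) x = x * gaussFun a p x := by
  simp [gaussFun, mul_assoc]

theorem contDiff_gaussFun (a : ℝ) (p : ℝ[X]) : ContDiff ℝ (⊤ : ℕ∞) (gaussFun a p) := by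
  have h : ContDiff ℝ (⊤ : ℕ∞) fun x => p.eval x := by simpa using p.contDiff_aeval (𝕜 := ℝ) _
  unfold gaussFun
  fun_prop

theorem hasDerivAt_gaussFun (a : ℝ) (p : ℝ[X]) (x : ℝ) :
    HasDerivAt (gaussFun a p) (gaussFun a (derivative p - C a * X * p) x) x := by
  have h1 := p.hasDerivAt x
  have h2 : HasDerivAt (fun x : ℝ => -(a * x ^ 2) / 2) (-(a * x)) x := by
    have := (((hasDerivAt_pow 2 x).const_mul a).neg).div_const 2
    refine this.congr_deriv ?_
    simp; ring
  refine (h1.mul h2.exp).congr_deriv ?_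
  simp [gaussFun]
  ring

theorem integrable_polynomial_gauss {b : ℝ} (hb : 0 < b) (p : ℝ[X]) :
    Integrable fun x : ℝ => p.eval x * Real.exp (-b * x ^ 2) := by
  induction p using Polynomial.induction_on' with
  | add p q hp hq =>
    simp only [eval_add, add_mul]
    exact hp.add hq
  | monomial n c =>
    have h := (integrable_rpow_mul_exp_neg_mul_sq hb (s := n)
      (lt_of_lt_of_le (by norm_num) n.cast_nonneg)).const_mul c
    simpa [mul_assoc] using h

theorem memLp_gaussFun {a : ℝ} (ha : 0 < a) (p : ℝ[X]) :
    MemLp (fun x => (gaussFun a p x : ℂ)) 2 (volume : Measure ℝ) := by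
  suffices h : MemLp (gaussFun a p) 2 (volume : Measure ℝ) from h.ofReal
  rw [memLp_two_iff_integrable_sq (contDiff_gaussFun a p).continuous.aestronglyMeasurable]
  refine (integrable_polynomial_gauss ha (p ^ 2)).congr (Eventually.of_forall fun x => ?_)
  simp only [gaussFun, eval_pow, mul_pow, ← Real.exp_nat_mul]
  congr 2
  push_cast; ring

/-- The class of `gaussFun a p` in `L²`; it is `0` by convention if `a ≤ 0`. -/
def gaussL2 (a : ℝ) : ℝ[X] →ₗ[ℝ] L2 where
  toFun p := if h : 0 < a then (memLp_gaussFun h p).toLp else 0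
  map_add' p q := by
    split_ifs with h
    · rw [← MemLp.toLp_add]
      congr 1
      ext x; simp [gaussFun_add]
    · simp
  map_smul' c p := by
    split_ifs with h
    · rw [RingHom.id_apply, ← MemLp.toLp_const_smul]
      congr 1
      ext x; simp [gaussFun_smul]
    · simp

theorem gaussL2_ae {a : ℝ} (ha : 0 < a) (p : ℝ[X]) :
    (gaussL2 a p : ℝ → ℂ) =ᵐ[volume] fun x => (gaussFun a p x : ℂ) := by
  have : gaussL2 a p = (memLp_gaussFun ha p).toLp := dif_pos ha
  rw [this]
  exact MemLp.coeFn_toLp _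

theorem gaussL2_of_nonpos {a : ℝ} (ha : ¬ 0 < a) (p : ℝ[X]) : gaussL2 a p = 0 := dif_neg ha

theorem hasWeakDeriv_of_hasDerivAt {f f' : ℝ → ℂ} (h : ∀ x, HasDerivAt f (f' x) x)
    (hf' : Continuous f') : HasWeakDeriv f f' := by
  intro ψ hψ hs
  have hf : Continuous f := continuous_iff_continuousAt.2 fun x => (h x).continuousAt
  have hd : Continuous (deriv ψ) := hψ.continuous_deriv (by simp)
  exact integral_mul_deriv_eq_deriv_mul_of_integrable (fun x _ => h x)
    (fun x _ => (hψ.differentiable (by simp) x).hasDerivAt)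
    ((hf.mul hd).integrable_of_hasCompactSupport hs.deriv.mul_left)
    ((hf'.mul hψ.continuous).integrable_of_hasCompactSupport hs.mul_left)
    ((hf.mul hψ.continuous).integrable_of_hasCompactSupport hs.mul_left)

/-- The element of `Σ` given by `gaussFun a p`. -/
def gaussSigma (a : ℝ) : ℝ[X] →ₗ[ℝ] SigmaSpace where
  toFun p := ⟨WithLp.toLp 2 ![gaussL2 a p, gaussL2 a (derivative p - C a * X * p),
    gaussL2 a (X * p)], by
      by_cases ha : 0 < a
      · constructor
        · intro ψ hψ hs
          have key := hasWeakDeriv_of_hasDerivAt (fun x => (hasDerivAt_gaussFun a p x).ofReal_comp)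
            (Complex.continuous_ofReal.comp (contDiff_gaussFun a _).continuous) ψ hψ hs
          simp only [Matrix.cons_val_zero, Matrix.cons_val_one]
          convert key using 1
          · refine integral_congr_ae ?_
            filter_upwards [gaussL2_ae ha p] with x hx using by rw [hx]
          · congr 1
            refine integral_congr_ae ?_
            filter_upwards [gaussL2_ae ha (derivative p - C a * X * p)] with x hx using by rw [hx]
        · change (gaussL2 a (X * p) : ℝ → ℂ) =ᵐ[volume] fun x => (x : ℂ) * gaussL2 a p x
          filter_upwards [gaussL2_ae ha p, gaussL2_ae ha (X * p)] with x h1 h2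
          rw [h1, h2, gaussFun_X_mul, Complex.ofReal_mul]
      · have h0 : WithLp.toLp 2 ![gaussL2 a p, gaussL2 a (derivative p - C a * X * p),
            gaussL2 a (X * p)] = 0 := by
          ext i : 1
          fin_cases i <;> simp [gaussL2_of_nonpos ha]
        rw [h0]
        exact SigmaSubmodule.zero_mem⟩
  map_add' p q := by
    refine SigmaSpace.ext_fn ?_
    exact (gaussL2 a).map_add p q
  map_smul' c p := by
    refine SigmaSpace.ext_fn ?_
    exact (gaussL2 a).map_smul c p

theorem gaussSigma_fn (a : ℝ) (p : ℝ[X]) : (gaussSigma a p).fn = gaussL2 a p := rfl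
theorem gaussSigma_der (a : ℝ) (p : ℝ[X]) :
    (gaussSigma a p).der = gaussL2 a (derivative p - C a * X * p) := rfl
theorem gaussSigma_mulX (a : ℝ) (p : ℝ[X]) : (gaussSigma a p).mulX = gaussL2 a (X * p) := rfl

theorem gaussSigma_mem_even (a : ℝ) {p : ℝ[X]} (hp : p.comp (-X) = p) :
    gaussSigma a p ∈ EvenSigma := by
  change (fun x : ℝ => gaussL2 a p (-x)) =ᵐ[volume] fun x : ℝ => gaussL2 a p x
  by_cases ha : 0 < a
  · have h0 := gaussL2_ae ha p
    have h1 := (Measure.measurePreserving_neg (volume : Measure ℝ)).quasiMeasurePreserving.ae h0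
    filter_upwards [h0, h1] with x h2 h3
    rw [h2, h3, gaussFun, gaussFun]
    have : p.eval (-x) = p.eval x := by
      conv_rhs => rw [← hp]
      simp
    rw [this, neg_sq]
  · rw [gaussL2_of_nonpos ha]
    exact EvenSigma.zero_mem

theorem inner_gaussL2 {a : ℝ} (ha : 0 < a) (p : ℝ[X]) (f : L2) :
    inner ℂ (gaussL2 a p) f = ∫ x, (gaussFun a p x : ℂ) * f x := by
  rw [L2.inner_def]
  refine integral_congr_ae ?_
  filter_upwards [gaussL2_ae ha p] with x hx
  rw [hx, RCLike.inner_apply, Complex.conj_ofReal, mul_comm]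

theorem inner_gaussL2_gaussL2 {a : ℝ} (ha : 0 < a) (p q : ℝ[X]) :
    inner ℂ (gaussL2 a p) (gaussL2 a q)
      = ((∫ x : ℝ, (p * q).eval x * Real.exp (-a * x ^ 2) : ℝ) : ℂ) := by
  rw [inner_gaussL2 ha, ← integral_complex_ofReal]
  refine integral_congr_ae ?_
  filter_upwards [gaussL2_ae ha q] with x hx
  rw [hx, ← Complex.ofReal_mul, gaussFun, gaussFun, mul_mul_mul_comm, ← Real.exp_add, eval_mul]
  congr 3
  ring

theorem integrable_gaussFun_mul {a : ℝ} (ha : 0 < a) (p : ℝ[X]) (f : L2) :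
    Integrable fun x => (gaussFun a p x : ℂ) * f x :=
  (memLp_gaussFun ha p).integrable_mul (q := 2) (Lp.memLp f)

/-- Integration by parts against a polynomial times a Gaussian, which has no compact support. It is
cut off by `χ (x / (n + 1))`, and dominated convergence removes the cutoff: the term with the
derivative of `χ` carries a factor `1 / (n + 1)`. -/
theorem inner_gaussSigma_der {a : ℝ} (ha : 0 < a) (p : ℝ[X]) (v : SigmaSpace) :
    inner ℂ (gaussSigma a p).der v.fn = -inner ℂ (gaussSigma a p).fn v.der := by
  let χ : ContDiffBump (0 : ℝ) := ⟨1, 2, one_pos, one_lt_two⟩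
  have hχ : ContDiff ℝ (⊤ : ℕ∞) χ := χ.contDiff
  obtain ⟨D, hD⟩ := χ.hasCompactSupport.deriv.exists_bound_of_continuous
    (hχ.continuous_deriv (by simp))
  set g := gaussFun a p with hg
  set g' := gaussFun a (derivative p - C a * X * p) with hg'
  have hgd : ∀ x, HasDerivAt g (g' x) x := hasDerivAt_gaussFun a p
  have hs : ∀ n : ℕ, (0 : ℝ) < n + 1 := fun n => by positivity
  let ψ : ℕ → ℝ → ℂ := fun n x => ((χ (x / (n + 1)) * g x : ℝ) : ℂ)
  have hψ : ∀ n, ContDiff ℝ (⊤ : ℕ∞) (ψ n) := fun n =>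
    Complex.ofRealCLM.contDiff.comp
      ((hχ.comp (contDiff_id.div_const _)).mul (contDiff_gaussFun a p))
  have hc : ∀ n, HasCompactSupport (ψ n) := fun n => by
    have h1 : HasCompactSupport fun x : ℝ => χ (x / (n + 1)) := by
      have := χ.hasCompactSupport.comp_homeomorph
        (Homeomorph.mulRight₀ ((n + 1 : ℝ)⁻¹) (inv_ne_zero (hs n).ne'))
      simpa [Function.comp_def, div_eq_mul_inv] using this
    exact (h1.mul_right (f' := g)).comp_left (g := Complex.ofReal) rfl
  have hψd : ∀ n x, deriv (ψ n) x
      = ((deriv χ (x / (n + 1)) / (n + 1) * g x + χ (x / (n + 1)) * g' x : ℝ) : ℂ) := by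
    intro n x
    have h0 : HasDerivAt (fun x : ℝ => x / (n + 1)) (1 / (n + 1)) x := (hasDerivAt_id x).div_const _
    have hx : HasDerivAt χ (deriv χ (x / (n + 1))) (x / (n + 1)) :=
      (hχ.differentiable (by simp) _).hasDerivAt
    have h1 : HasDerivAt (fun x : ℝ => χ (x / (n + 1))) (deriv χ (x / (n + 1)) * (1 / (n + 1))) x :=
      HasDerivAt.comp (h₂ := (χ : ℝ → ℝ)) (h := fun x : ℝ => x / (n + 1)) x hx h0
    have := ((h1.mul (hgd x)).ofReal_comp).deriv
    rw [mul_one_div] at this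
    exact this
  have hlim : ∀ x : ℝ, Tendsto (fun n : ℕ => x / (n + 1 : ℝ)) atTop (𝓝 0) := fun x => by
    have := (tendsto_const_div_atTop_nhds_zero_nat x).comp (tendsto_add_atTop_nat 1)
    simpa [Function.comp_def] using this
  have hχlim : ∀ x : ℝ, Tendsto (fun n : ℕ => χ (x / (n + 1 : ℝ))) atTop (𝓝 1) := fun x => by
    have h := (hχ.continuous.tendsto 0).comp (hlim x)
    rwa [χ.one_of_mem_closedBall (by simp [χ])] at h
  have hχ1 : ∀ y, |χ y| ≤ 1 := fun y => by rw [abs_of_nonneg χ.nonneg]; exact χ.le_one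
  have L1 : Tendsto (fun n => ∫ x, v.fn x * deriv (ψ n) x) atTop
      (𝓝 (∫ x, v.fn x * (g' x : ℂ))) := by
    refine tendsto_integral_of_dominated_convergence
      (fun x => D * ‖(g x : ℂ) * v.fn x‖ + ‖(g' x : ℂ) * v.fn x‖) ?_ ?_ ?_ ?_
    · exact fun n => (Lp.aestronglyMeasurable v.fn).mul
        ((hψ n).continuous_deriv (by simp)).aestronglyMeasurable
    · exact ((integrable_gaussFun_mul ha _ _).norm.const_mul _).add
        (integrable_gaussFun_mul ha _ _).norm
    · intro n
      refine Eventually.of_forall fun x => ?_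
      rw [hψd, norm_mul, norm_mul, norm_mul, Complex.norm_real, Complex.norm_real,
        Complex.norm_real]
      have h1 : ‖deriv χ (x / (n + 1)) / (n + 1) * g x + χ (x / (n + 1)) * g' x‖
          ≤ D * ‖g x‖ + ‖g' x‖ := by
        refine (norm_add_le _ _).trans (add_le_add ?_ ?_)
        · rw [norm_mul]
          gcongr
          rw [norm_div]
          refine (div_le_self (norm_nonneg _) ?_).trans (hD _)
          rw [Real.norm_of_nonneg (hs n).le]
          linarith [n.cast_nonneg (α := ℝ)]
        · rw [norm_mul]
          exact mul_le_of_le_one_left (norm_nonneg _) (hχ1 _)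
      calc _ ≤ ‖v.fn x‖ * (D * ‖g x‖ + ‖g' x‖) := by gcongr
        _ = _ := by ring
    · refine Eventually.of_forall fun x => Tendsto.const_mul _ ?_
      simp_rw [hψd]
      refine (Complex.continuous_ofReal.tendsto _).comp ?_
      have h1 : Tendsto (fun n : ℕ => deriv χ (x / (n + 1)) / (n + 1 : ℝ) * g x) atTop (𝓝 0) := by
        suffices h : Tendsto (fun n : ℕ => deriv χ (x / (n + 1)) / (n + 1 : ℝ)) atTop (𝓝 0) by
          simpa using h.mul_const (g x)
        refine squeeze_zero_norm (a := fun n : ℕ => D / (n + 1 : ℝ)) (fun n => ?_) (hlim D)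
        rw [norm_div, Real.norm_of_nonneg (hs n).le]
        gcongr
        exact hD _
      simpa using h1.add ((hχlim x).mul_const (g' x))
  have L2' : Tendsto (fun n => -∫ x, v.der x * ψ n x) atTop
      (𝓝 (-∫ x, v.der x * (g x : ℂ))) := by
    refine Tendsto.neg ?_
    refine tendsto_integral_of_dominated_convergence
      (fun x => ‖(g x : ℂ) * v.der x‖) ?_ ?_ ?_ ?_
    · exact fun n => (Lp.aestronglyMeasurable v.der).mul (hψ n).continuous.aestronglyMeasurable
    · exact (integrable_gaussFun_mul ha _ _).norm
    · intro n
      refine Eventually.of_forall fun x => ?_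
      rw [norm_mul, norm_mul, Complex.norm_real, Complex.norm_real, mul_comm, norm_mul]
      gcongr
      exact mul_le_of_le_one_left (norm_nonneg _) (hχ1 _)
    · refine Eventually.of_forall fun x => Tendsto.const_mul _ ?_
      refine (Complex.continuous_ofReal.tendsto _).comp ?_
      simpa using (hχlim x).mul_const (g x)
  have heq : ∀ n, ∫ x, v.fn x * deriv (ψ n) x = -∫ x, v.der x * ψ n x := fun n =>
    v.hasWeakDeriv _ (hψ n) (hc n)
  simp_rw [heq] at L1
  have := tendsto_nhds_unique L1 L2'
  rw [gaussSigma_der, gaussSigma_fn, inner_gaussL2 ha, inner_gaussL2 ha]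
  simp_rw [mul_comm (Complex.ofReal _)]
  exact this

/-- Second-order Taylor bound for `exp (-·)`. The lower bound `c` of both exponents lets one fixed
function control the remainder for all nearby parameters. -/
theorem abs_exp_neg_sub_le {y z c : ℝ} (hy : c ≤ y) (hz : c ≤ z) :
    |Real.exp (-y) - Real.exp (-z) + (y - z) * Real.exp (-z)|
      ≤ (y - z) ^ 2 * Real.exp (-c) := by
  have e : Real.exp (-y) = Real.exp (-z) * Real.exp (z - y) := by rw [← Real.exp_add]; ring_nf
  have h1 := Real.add_one_le_exp (z - y)
  have h2 := Real.add_one_le_exp (-(z - y))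
  have hpz := Real.exp_pos (-z)
  have hps := Real.exp_pos (z - y)
  have h3 : Real.exp (z - y) - 1 ≤ (z - y) * Real.exp (z - y) := by
    have : Real.exp (z - y) * Real.exp (-(z - y)) = 1 := by rw [← Real.exp_add]; simp
    nlinarith
  have hyc : Real.exp (-y) ≤ Real.exp (-c) := Real.exp_le_exp.2 (by linarith)
  have hzc : Real.exp (-z) ≤ Real.exp (-c) := Real.exp_le_exp.2 (by linarith)
  rw [abs_of_nonneg (by rw [e]; nlinarith)]
  rcases le_total 0 (z - y) with hs | hs
  · calc _ = Real.exp (-z) * (Real.exp (z - y) - 1 - (z - y)) := by rw [e]; ring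
      _ ≤ Real.exp (-z) * ((z - y) ^ 2 * Real.exp (z - y)) := by
        gcongr
        nlinarith
      _ = (y - z) ^ 2 * Real.exp (-y) := by rw [e]; ring
      _ ≤ _ := by gcongr
  · calc _ = Real.exp (-z) * (Real.exp (z - y) - 1 - (z - y)) := by rw [e]; ring
      _ ≤ Real.exp (-z) * (y - z) ^ 2 := by
        gcongr
        nlinarith
      _ ≤ _ := by rw [mul_comm]; gcongr

/-- Differentiating the Gaussian in its parameter brings down `-x² / 2`. For `b > a / 2` the
remainder is at most `(b - a)² / 4` times `x⁴ |p|` times the Gaussian of parameter `a / 2`, an `L²`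
function not depending on `b`. -/
theorem hasDerivAt_gaussL2 {a : ℝ} (ha : 0 < a) (p : ℝ[X]) :
    HasDerivAt (fun b => gaussL2 b p) (-(1 / 2 : ℝ) • gaussL2 a (X ^ 2 * p)) a := by
  rw [hasDerivAt_iff_isLittleO]
  refine Asymptotics.IsBigO.trans_isLittleO ?_ (Asymptotics.isLittleO_pow_sub_sub a one_lt_two)
  refine Asymptotics.IsBigO.of_bound (1 / 4 * ‖gaussL2 (a / 2) (X ^ 4 * p)‖) ?_
  filter_upwards [lt_mem_nhds (half_lt_self ha)] with b hb
  have hb0 : 0 < b := (half_pos ha).trans hb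
  have hn : ‖‖b - a‖ ^ 2‖ = (b - a) ^ 2 := by simp
  have key : ‖gaussL2 b p - gaussL2 a p - (b - a) • -(1 / 2 : ℝ) • gaussL2 a (X ^ 2 * p)‖
      ≤ ‖((b - a) ^ 2 / 4) • gaussL2 (a / 2) (X ^ 4 * p)‖ := by
    refine Lp.norm_le_norm_of_ae_le ?_
    rw [smul_smul]
    filter_upwards [gaussL2_ae hb0 p, gaussL2_ae ha p, gaussL2_ae ha (X ^ 2 * p),
      gaussL2_ae (half_pos ha) (X ^ 4 * p),
      Lp.coeFn_sub (gaussL2 b p - gaussL2 a p) (((b - a) * -(1 / 2 : ℝ)) • gaussL2 a (X ^ 2 * p)),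
      Lp.coeFn_sub (gaussL2 b p) (gaussL2 a p),
      Lp.coeFn_smul ((b - a) * -(1 / 2 : ℝ)) (gaussL2 a (X ^ 2 * p)),
      Lp.coeFn_smul ((b - a) ^ 2 / 4) (gaussL2 (a / 2) (X ^ 4 * p))] with x h1 h2 h3 h4 h5 h6 h7 h8
    rw [h5, h8, Pi.sub_apply, h6, h7, Pi.sub_apply, Pi.smul_apply, Pi.smul_apply, h1, h2, h3, h4,
      Complex.real_smul, Complex.real_smul, ← Complex.ofReal_mul, ← Complex.ofReal_mul,
      ← Complex.ofReal_sub, ← Complex.ofReal_sub, Complex.norm_real, Complex.norm_real]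
    simp only [gaussFun, eval_mul, eval_pow, eval_X, Real.norm_eq_abs]
    have hx := sq_nonneg x
    have hE := abs_exp_neg_sub_le (y := b * x ^ 2 / 2) (z := a * x ^ 2 / 2) (c := a / 2 * x ^ 2 / 2)
      (by nlinarith) (by nlinarith)
    rw [show -(b * x ^ 2) / 2 = -(b * x ^ 2 / 2) by ring,
      show -(a * x ^ 2) / 2 = -(a * x ^ 2 / 2) by ring,
      show -(a / 2 * x ^ 2) / 2 = -(a / 2 * x ^ 2 / 2) by ring]
    calc _ = |p.eval x| * |Real.exp (-(b * x ^ 2 / 2)) - Real.exp (-(a * x ^ 2 / 2))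
            + (b * x ^ 2 / 2 - a * x ^ 2 / 2) * Real.exp (-(a * x ^ 2 / 2))| := by
          rw [← abs_mul]; congr 1; ring
      _ ≤ |p.eval x| * ((b * x ^ 2 / 2 - a * x ^ 2 / 2) ^ 2 * Real.exp (-(a / 2 * x ^ 2 / 2))) := by
          gcongr
      _ = |(b - a) ^ 2 / 4 * (x ^ 4 * p.eval x * Real.exp (-(a / 2 * x ^ 2 / 2)))| := by
          rw [abs_mul, abs_mul, abs_mul, Real.abs_exp, abs_of_nonneg (by positivity : 0 ≤ x ^ 4),
            abs_of_nonneg (by positivity : 0 ≤ (b - a) ^ 2 / 4)]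
          ring
  refine key.trans (le_of_eq ?_)
  rw [hn, norm_smul, Real.norm_of_nonneg (by positivity)]
  ring

theorem SigmaSpace.hasDerivAt_of_components {f : ℝ → SigmaSpace} {f' : SigmaSpace} {a : ℝ}
    (h0 : HasDerivAt (fun t => (f t).fn) f'.fn a) (h1 : HasDerivAt (fun t => (f t).der) f'.der a)
    (h2 : HasDerivAt (fun t => (f t).mulX) f'.mulX a) : HasDerivAt f f' a := by
  rw [hasDerivAt_iff_isLittleO] at *
  rw [← Asymptotics.isLittleO_norm_left] at *
  have h := (h0.add h1).add h2
  refine Asymptotics.IsBigO.trans_isLittleO (Asymptotics.IsBigO.of_bound 1 ?_) h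
  refine Eventually.of_forall fun t => ?_
  set w := f t - f a - (t - a) • f' with hw
  have e0 : (f t).fn - (f a).fn - (t - a) • f'.fn = w.fn := rfl
  have e1 : (f t).der - (f a).der - (t - a) • f'.der = w.der := rfl
  have e2 : (f t).mulX - (f a).mulX - (t - a) • f'.mulX = w.mulX := rfl
  rw [e0, e1, e2, norm_norm, one_mul, Real.norm_of_nonneg (by positivity)]
  refine le_of_sq_le_sq ?_ (by positivity)
  rw [w.norm_sq_eq]
  nlinarith [norm_nonneg w.fn, norm_nonneg w.der, norm_nonneg w.mulX,
    mul_nonneg (norm_nonneg w.fn) (norm_nonneg w.der),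
    mul_nonneg (norm_nonneg w.fn) (norm_nonneg w.mulX),
    mul_nonneg (norm_nonneg w.mulX) (norm_nonneg w.der)]

theorem hasDerivAt_gaussSigma {a : ℝ} (ha : 0 < a) (p : ℝ[X]) :
    HasDerivAt (fun b => gaussSigma b p) (-(1 / 2 : ℝ) • gaussSigma a (X ^ 2 * p)) a := by
  refine SigmaSpace.hasDerivAt_of_components ?_ ?_ ?_
  · exact hasDerivAt_gaussL2 ha p
  -- The polynomial factor of the weak derivative contains the parameter itself, so the product rule
  -- contributes a further term.
  · have e : ∀ b : ℝ, (gaussSigma b p).der = gaussL2 b (derivative p) - b • gaussL2 b (X * p) := by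
      intro b
      rw [gaussSigma_der, mul_assoc, ← smul_eq_C_mul, map_sub, map_smul]
    have h := (hasDerivAt_gaussL2 ha (derivative p)).sub
      ((hasDerivAt_id a).smul (hasDerivAt_gaussL2 ha (X * p)))
    refine (h.congr_deriv ?_).congr_of_eventuallyEq (Eventually.of_forall e)
    have e' : (-(1 / 2 : ℝ) • gaussSigma a (X ^ 2 * p)).der
        = -(1 / 2 : ℝ) • gaussL2 a (derivative (X ^ 2 * p) - C a * X * (X ^ 2 * p)) := rfl
    rw [e', id, ← map_smul, ← map_smul, ← map_smul, ← map_smul, ← map_smul, ← map_add, ← map_sub]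
    congr 1
    simp only [smul_eq_C_mul, derivative_mul, derivative_X_pow]
    simp
    have c2 : (C (2 : ℝ)) = 2 := rfl
    have : (C (2⁻¹ : ℝ)) * 2 = 1 := by rw [← c2, ← C_mul]; norm_num
    linear_combination (X * p) * this + C 2⁻¹ * X * p * c2
  · have h := hasDerivAt_gaussL2 ha (X * p)
    refine h.congr_deriv ?_
    have e' : (-(1 / 2 : ℝ) • gaussSigma a (X ^ 2 * p)).mulX
        = -(1 / 2 : ℝ) • gaussL2 a (X * (X ^ 2 * p)) := rfl
    rw [e']
    congr 2
    ring

end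

/-! ### Hermite functions: orthonormality, totality, action of `x` and of the oscillator, parity -/

section

open Polynomial

-- Every test function is the Fourier transform of a Schwartz function. Moving the transform onto
-- `F` shows that `F` pairs to zero with all test functions.
open scoped FourierTransform in
theorem ae_eq_zero_of_fourier_eq_zero {F : ℝ → ℂ} (hF : Integrable F) (h : ∀ ξ, 𝓕 F ξ = 0) :
    F =ᵐ[volume] 0 := by
  refine ae_eq_zero_of_integral_contDiff_smul_eq_zero hF.locallyIntegrable fun g hg hs => ?_
  have hg' : ContDiff ℝ (⊤ : ℕ∞) (fun x => (g x : ℂ)) :=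
    Complex.ofRealCLM.contDiff.comp hg
  have hs' : HasCompactSupport (fun x => (g x : ℂ)) := hs.comp_left (g := Complex.ofReal) rfl
  let φ : SchwartzMap ℝ ℂ := hs'.toSchwartzMap hg'
  have hφ : ∀ x, φ x = (g x : ℂ) := fun x => rfl
  let θ : SchwartzMap ℝ ℂ := 𝓕⁻ φ
  have e : ∀ x, (g x : ℂ) = 𝓕 (⇑θ) x := fun x => by
    rw [← hφ, ← SchwartzMap.fourier_coe, FourierTransform.fourier_fourierInv_eq]
  have key := VectorFourier.integral_fourierIntegral_smul_eq_flip (L := innerₗ ℝ)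
    Real.continuous_fourierChar continuous_inner hF θ.integrable (μ := volume) (ν := volume)
  have h1 : ∀ ξ, VectorFourier.fourierIntegral Real.fourierChar volume (innerₗ ℝ) F ξ = 0 := h
  simp only [h1, zero_smul, integral_zero, flip_innerₗ] at key
  rw [key]
  refine integral_congr_ae (Eventually.of_forall fun x => ?_)
  change g x • F x = F x • 𝓕 (⇑θ) x
  rw [← e, Complex.real_smul, smul_eq_mul, mul_comm]

open scoped FourierTransform in
/-- Polynomials times a Gaussian are total in `L²`. -/
theorem eq_zero_of_inner_gaussL2_pow_eq_zero {a : ℝ} (ha : 0 < a) (f : L2)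
    (h : ∀ j : ℕ, inner ℂ (gaussL2 a (X ^ j)) f = 0) : f = 0 := by
  -- The Fourier transform of `f` times the Gaussian is expanded in powers of `x`; every term is one
  -- of the moments assumed to vanish.
  set F : ℝ → ℂ := fun x => (gaussFun a 1 x : ℂ) * f x with hFdef
  have hF : Integrable F := integrable_gaussFun_mul ha 1 f
  suffices hz : F =ᵐ[volume] 0 by
    refine (Lp.eq_zero_iff_ae_eq_zero).2 ?_
    filter_upwards [hz] with x hx
    rcases mul_eq_zero.1 hx with h1 | h1
    · simp [gaussFun] at h1
    · exact h1
  refine ae_eq_zero_of_fourier_eq_zero hF fun ξ => ?_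
  rw [Real.fourier_real_eq_integral_exp_smul]
  obtain ⟨c, hc⟩ : ∃ c : ℝ, c = -2 * Real.pi * ξ := ⟨_, rfl⟩
  have hsum : ∀ x : ℝ, HasSum (fun j : ℕ => ((c * x : ℝ) * Complex.I) ^ j / (j.factorial : ℂ) * F x)
      (Complex.exp ((c * x : ℝ) * Complex.I) * F x) := fun x =>
    (by simpa [Complex.exp_eq_exp_ℂ] using
      NormedSpace.expSeries_div_hasSum_exp (𝔸 := ℂ) ((c * x : ℝ) * Complex.I) :
      HasSum _ _).mul_right _
  have hbsum : ∀ x : ℝ, HasSum (fun j : ℕ => |c * x| ^ j / (j.factorial : ℝ) * ‖F x‖)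
      (Real.exp |c * x| * ‖F x‖) := fun x =>
    (by simpa [Real.exp_eq_exp_ℝ] using
      NormedSpace.expSeries_div_hasSum_exp (𝔸 := ℝ) |c * x| : HasSum _ _).mul_right _
  -- Completing the square gives `|c x| ≤ a x² / 4 + c² / a`, so half of the Gaussian exponent
  -- absorbs the exponential and the other half stays.
  have hbi : Integrable fun x : ℝ => Real.exp |c * x| * ‖F x‖ := by
    refine ((integrable_gaussFun_mul (half_pos ha) 1 f).norm.const_mul
      (Real.exp (c ^ 2 / a))).mono' ?_ (Eventually.of_forall fun x => ?_)
    · exact (by fun_prop : Continuous fun x : ℝ => Real.exp |c * x|).aestronglyMeasurable.mul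
        hF.norm.aestronglyMeasurable
    · rw [Real.norm_of_nonneg (by positivity)]
      simp only [hFdef, gaussFun, norm_mul, Complex.norm_real, eval_one, one_mul,
        Real.norm_eq_abs, Real.abs_exp]
      rw [← mul_assoc, ← mul_assoc, ← Real.exp_add, ← Real.exp_add]
      refine mul_le_mul_of_nonneg_right (Real.exp_le_exp.2 ?_) (norm_nonneg _)
      have h2 : 0 ≤ (|x| * a / 2 - |c|) ^ 2 / a := by positivity
      have h3 : (|x| * a / 2 - |c|) ^ 2 / a = a * x ^ 2 / 4 + c ^ 2 / a - |c * x| := by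
        rw [abs_mul, ← sq_abs x, ← sq_abs c]
        field_simp
        ring
      linarith
  have key := hasSum_integral_of_dominated_convergence
    (F := fun (j : ℕ) (x : ℝ) => ((c * x : ℝ) * Complex.I) ^ j / (j.factorial : ℂ) * F x)
    (f := fun x : ℝ => Complex.exp ((c * x : ℝ) * Complex.I) * F x) (μ := volume)
    (fun j x => |c * x| ^ j / (j.factorial : ℝ) * ‖F x‖)
    (fun j => ((by fun_prop : Continuous fun x : ℝ =>
      ((c * x : ℝ) * Complex.I) ^ j / (j.factorial : ℂ)).aestronglyMeasurable).mul
        hF.aestronglyMeasurable)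
    (fun j => Eventually.of_forall fun x => by simp)
    (Eventually.of_forall fun x => (hbsum x).summable)
    (by simpa only [(hbsum _).tsum_eq] using hbi)
    (Eventually.of_forall hsum)
  have hz : ∀ j : ℕ, ∫ x : ℝ, ((c * x : ℝ) * Complex.I) ^ j / (j.factorial : ℂ) * F x = 0 := by
    intro j
    have e : ∀ x : ℝ, ((c * x : ℝ) * Complex.I) ^ j / (j.factorial : ℂ) * F x
        = (c * Complex.I) ^ j / (j.factorial : ℂ) * ((gaussFun a (X ^ j) x : ℂ) * f x) := by
      intro x
      simp only [hFdef, gaussFun, eval_one, eval_pow, eval_X]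
      push_cast
      ring
    simp_rw [e]
    rw [integral_const_mul, ← inner_gaussL2 ha, h j, mul_zero]
  simp_rw [hz] at key
  have := key.unique hasSum_zero
  rw [← this]
  refine integral_congr_ae (Eventually.of_forall fun x => ?_)
  simp only [smul_eq_mul, hc]
  congr 3
  push_cast
  ring

/-- The Hermite polynomials of the harmonic oscillator `-d²/dx² + a² x²`. -/
def hermitePoly (a : ℝ) : ℕ → ℝ[X]
  | 0 => 1
  | n + 1 => C (2 * a) * X * hermitePoly a n - derivative (hermitePoly a n)

theorem hermitePoly_succ (a : ℝ) (n : ℕ) : hermitePoly a (n + 1)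
    = C (2 * a) * X * hermitePoly a n - derivative (hermitePoly a n) := rfl

theorem derivative_hermitePoly_succ (a : ℝ) (n : ℕ) :
    derivative (hermitePoly a (n + 1)) = C (2 * a * (n + 1)) * hermitePoly a n := by
  induction n with
  | zero => simp [hermitePoly]
  | succ n ih =>
    rw [hermitePoly_succ a (n + 1), derivative_sub, ih, derivative_mul, derivative_mul, ih]
    have := hermitePoly_succ a n
    simp only [derivative_C, derivative_X, derivative_mul, zero_mul, zero_add, mul_one]
    rw [this]
    push_cast
    simp only [C_mul, C_add, C_1]
    ring

theorem hermitePoly_comp_neg (a : ℝ) (n : ℕ) :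
    (hermitePoly a n).comp (-X) = (-1) ^ n * hermitePoly a n := by
  have key : ∀ n, (hermitePoly a n).comp (-X) = (-1) ^ n * hermitePoly a n ∧
      (hermitePoly a (n + 1)).comp (-X) = (-1) ^ (n + 1) * hermitePoly a (n + 1) := by
    intro n
    induction n with
    | zero => simp [hermitePoly]
    | succ n ih =>
      refine ⟨ih.2, ?_⟩
      rw [hermitePoly_succ a (n + 1), derivative_hermitePoly_succ]
      simp only [sub_comp, mul_comp, C_comp, X_comp, ih.1, ih.2]
      ring
  exact (key n).1

/-- Creation and annihilation operators are adjoint: on a polynomial times the Gaussian, `a x -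
d/dx` acts as the Hermite recursion and `a x + d/dx` as the derivative of the polynomial. -/
theorem inner_hermitePoly_succ {a : ℝ} (ha : 0 < a) (n : ℕ) (q : ℝ[X]) :
    inner ℂ (gaussL2 a (hermitePoly a (n + 1))) (gaussL2 a q)
      = inner ℂ (gaussL2 a (hermitePoly a n)) (gaussL2 a (derivative q)) := by
  set P := hermitePoly a n
  have h1 := inner_gaussSigma_der ha P (gaussSigma a q)
  have h2 := SigmaSpace.inner_mulX_comm (gaussSigma a P) (gaussSigma a q)
  simp only [gaussSigma_der, gaussSigma_fn, gaussSigma_mulX] at h1 h2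
  have e1 : hermitePoly a (n + 1) = a • (X * P) - (derivative P - C a * X * P) := by
    rw [hermitePoly_succ, smul_eq_C_mul, C_mul]
    change C 2 * C a * X * P - derivative P = _
    have c2 : (C (2 : ℝ)) = 2 := rfl
    rw [c2]; ring
  have e2 : derivative q = a • (X * q) + (derivative q - C a * X * q) := by
    rw [smul_eq_C_mul]; ring
  rw [e1, e2]
  rw [map_sub, map_add, inner_sub_left, inner_add_right, h1, map_smul, map_smul,
    inner_smul_left_eq_smul, inner_smul_right_eq_smul, h2]
  ring

/-- The square of the `L²` norm of the `n`-th Hermite function. -/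
def hermiteNormSq (a : ℝ) (n : ℕ) : ℝ := (2 * a) ^ n * n.factorial * √(Real.pi / a)

theorem hermiteNormSq_pos {a : ℝ} (ha : 0 < a) (n : ℕ) : 0 < hermiteNormSq a n := by
  have := Real.pi_pos
  unfold hermiteNormSq
  positivity

theorem hermiteNormSq_succ (a : ℝ) (n : ℕ) :
    hermiteNormSq a (n + 1) = 2 * a * (n + 1) * hermiteNormSq a n := by
  simp only [hermiteNormSq, Nat.factorial_succ]
  push_cast
  ring

theorem inner_hermitePoly {a : ℝ} (ha : 0 < a) (n m : ℕ) :
    inner ℂ (gaussL2 a (hermitePoly a n)) (gaussL2 a (hermitePoly a m))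
      = if n = m then (hermiteNormSq a n : ℂ) else 0 := by
  have h0 : ∀ n, inner ℂ (gaussL2 a (hermitePoly a (n + 1))) (gaussL2 a (hermitePoly a 0)) = 0 := by
    intro n
    rw [inner_hermitePoly_succ ha]
    simp [hermitePoly]
  induction n generalizing m with
  | zero =>
    cases m with
    | zero =>
      rw [inner_gaussL2_gaussL2 ha]
      simp only [hermitePoly, mul_one, eval_one, one_mul, if_true]
      rw [integral_gaussian]
      simp [hermiteNormSq]
    | succ m => rw [← inner_conj_symm, h0]; simp
  | succ n ih =>
    cases m with
    | zero => rw [h0]; simp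
    | succ m =>
      rw [inner_hermitePoly_succ ha, derivative_hermitePoly_succ, ← smul_eq_C_mul, map_smul,
        inner_smul_right_eq_smul, ih]
      by_cases h : n = m
      · subst h
        simp only [if_true, hermiteNormSq_succ]
        rw [Complex.real_smul, ← Complex.ofReal_mul]
      · simp [h]

/-- The normalized Hermite functions, an orthonormal basis of `L²` of eigenfunctions of the harmonic
oscillator `-d²/dx² + a² x²`. -/
def hermiteFn (a : ℝ) (n : ℕ) : SigmaSpace :=
  (√(hermiteNormSq a n))⁻¹ • gaussSigma a (hermitePoly a n)

theorem hermiteFn_fn (a : ℝ) (n : ℕ) :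
    (hermiteFn a n).fn = (√(hermiteNormSq a n))⁻¹ • gaussL2 a (hermitePoly a n) := rfl

theorem inner_hermiteFn {a : ℝ} (ha : 0 < a) (n m : ℕ) :
    inner ℂ (hermiteFn a n).fn (hermiteFn a m).fn = if n = m then 1 else 0 := by
  rw [hermiteFn_fn, hermiteFn_fn, inner_smul_left_eq_smul, inner_smul_right_eq_smul,
    inner_hermitePoly ha]
  by_cases h : n = m
  · subst h
    have := hermiteNormSq_pos ha n
    simp only [if_true, Complex.real_smul, ← Complex.ofReal_mul]
    rw [← mul_assoc, ← mul_inv, Real.mul_self_sqrt this.le, inv_mul_cancel₀ this.ne',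
      Complex.ofReal_one]
  · simp [h]

/-- The matrix elements of `x` in the Hermite basis. -/
def stepCoeff (a : ℝ) (n : ℕ) : ℝ := √(n / (2 * a))

theorem stepCoeff_zero (a : ℝ) : stepCoeff a 0 = 0 := by simp [stepCoeff]

theorem stepCoeff_sq {a : ℝ} (ha : 0 < a) (n : ℕ) : stepCoeff a n ^ 2 = n / (2 * a) :=
  Real.sq_sqrt (by positivity)

/-- This is `2 a x H_n = H_{n+1} + H_n'` after normalization. For `n = 0` the truncated index `n -
1` is harmless because `stepCoeff a 0 = 0`. -/
theorem hermiteFn_mulX {a : ℝ} (ha : 0 < a) (n : ℕ) : (hermiteFn a n).mulX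
    = stepCoeff a (n + 1) • (hermiteFn a (n + 1)).fn + stepCoeff a n • (hermiteFn a (n - 1)).fn := by
  have e : (hermiteFn a n).mulX = (√(hermiteNormSq a n))⁻¹ • gaussL2 a (X * hermitePoly a n) := rfl
  have hs : ∀ n, √(hermiteNormSq a (n + 1)) = 2 * a * stepCoeff a (n + 1) * √(hermiteNormSq a n) := by
    intro n
    have h1 : (0 : ℝ) ≤ 2 * a * stepCoeff a (n + 1) := by unfold stepCoeff; positivity
    rw [← Real.sqrt_sq h1, ← Real.sqrt_mul (sq_nonneg _), mul_pow, stepCoeff_sq ha,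
      hermiteNormSq_succ]
    congr 1
    push_cast
    field_simp
  have hsp : ∀ n : ℕ, 0 < stepCoeff a (n + 1) := fun n => Real.sqrt_pos.2 (by positivity)
  have hN : ∀ n, 0 < √(hermiteNormSq a n) := fun n => Real.sqrt_pos.2 (hermiteNormSq_pos ha n)
  rw [e, hermiteFn_fn, hermiteFn_fn, ← map_smul, ← map_smul, ← map_smul, ← map_smul, ← map_smul,
    ← map_add]
  congr 1
  rw [hs, smul_smul, smul_smul, hermitePoly_succ]
  have e1 : stepCoeff a (n + 1) * (2 * a * stepCoeff a (n + 1) * √(hermiteNormSq a n))⁻¹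
      = (√(hermiteNormSq a n))⁻¹ * (2 * a)⁻¹ := by
    have := (hsp n).ne'
    have := (hN n).ne'
    field_simp
  rw [e1]
  have e3 : C (2 * a)⁻¹ * C (2 * a) = 1 := by
    rw [← C_mul, inv_mul_cancel₀ (by positivity), C_1]
  cases n with
  | zero =>
    simp only [stepCoeff_zero, hermitePoly, zero_mul, zero_smul, smul_eq_C_mul, C_mul,
      derivative_one]
    rw [C_mul] at e3
    linear_combination (-C (√(hermiteNormSq a 0))⁻¹ * X) * e3
  | succ k =>
    rw [derivative_hermitePoly_succ, Nat.add_sub_cancel]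
    have e2 : stepCoeff a (k + 1) * (√(hermiteNormSq a k))⁻¹
        = (√(hermiteNormSq a (k + 1)))⁻¹ * (2 * a)⁻¹ * (2 * a * (k + 1)) := by
      rw [hs]
      have h1 := (hsp k).ne'
      have h2 := (hN k).ne'
      have h3 := stepCoeff_sq ha (k + 1)
      push_cast at h3
      field_simp
      rw [h3]
      field_simp
    rw [e2]
    simp only [smul_eq_C_mul]
    rw [C_mul (a := _ * _) (b := 2 * a * (k + 1)), C_mul (b := (2 * a)⁻¹)]
    linear_combination (-C (√(hermiteNormSq a (k + 1)))⁻¹ * X * hermitePoly a (k + 1)) * e3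

/-- Only the Hermite function is multiplied by `x` twice, since `x² v` need not be square
integrable. For `n ≤ 1` the truncated index `n - 2` comes with the factor `stepCoeff a 0 = 0`. -/
theorem inner_hermiteFn_mulX {a : ℝ} (ha : 0 < a) (n : ℕ) (v : SigmaSpace) :
    inner ℂ (hermiteFn a n).mulX v.mulX
      = (stepCoeff a (n + 1) * stepCoeff a (n + 2) : ℝ) * inner ℂ (hermiteFn a (n + 2)).fn v.fn
        + ((2 * n + 1) / (2 * a) : ℝ) * inner ℂ (hermiteFn a n).fn v.fn
        + (stepCoeff a n * stepCoeff a (n - 1) : ℝ) * inner ℂ (hermiteFn a (n - 2)).fn v.fn := by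
  rw [hermiteFn_mulX ha n, inner_add_left, inner_smul_left_eq_smul, inner_smul_left_eq_smul,
    ← SigmaSpace.inner_mulX_comm, ← SigmaSpace.inner_mulX_comm, hermiteFn_mulX ha,
    hermiteFn_mulX ha, inner_add_left, inner_add_left, inner_smul_left_eq_smul,
    inner_smul_left_eq_smul, inner_smul_left_eq_smul, inner_smul_left_eq_smul]
  simp only [Complex.real_smul, Nat.add_sub_cancel, Nat.sub_sub]
  have h1 := stepCoeff_sq ha n
  have h2 := stepCoeff_sq ha (n + 1)
  have h3 : ((2 * n + 1) / (2 * a) : ℝ) = stepCoeff a (n + 1) ^ 2 + stepCoeff a n ^ 2 := by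
    rw [h1, h2]; push_cast; ring
  rw [h3]
  cases n with
  | zero => simp [stepCoeff_zero]; ring
  | succ n => simp only [Nat.add_sub_cancel]; push_cast; ring

theorem hermitePoly_ode (a : ℝ) (n : ℕ) : derivative (derivative (hermitePoly a n))
    - C (2 * a) * X * derivative (hermitePoly a n) + C (2 * a * n) * hermitePoly a n = 0 := by
  cases n with
  | zero => simp [hermitePoly]
  | succ n =>
    rw [derivative_hermitePoly_succ, derivative_C_mul, hermitePoly_succ]
    push_cast
    ring

/-- The Hermite functions are weak eigenfunctions of the harmonic oscillator. -/
theorem hermiteFn_eigen {a : ℝ} (ha : 0 < a) (n : ℕ) (v : SigmaSpace) :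
    inner ℂ (hermiteFn a n).der v.der + (a : ℂ) ^ 2 * inner ℂ (hermiteFn a n).mulX v.mulX
      = (a * (2 * n + 1) : ℝ) * inner ℂ (hermiteFn a n).fn v.fn := by
  set P := hermitePoly a n with hP
  have e0 : (hermiteFn a n).fn = (√(hermiteNormSq a n))⁻¹ • gaussL2 a P := rfl
  have e1 : (hermiteFn a n).der = (√(hermiteNormSq a n))⁻¹ • gaussL2 a (derivative P - C a * X * P) :=
    rfl
  have e2 : (hermiteFn a n).mulX = (√(hermiteNormSq a n))⁻¹ • gaussL2 a (X * P) := rfl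
  have h1 := inner_gaussSigma_der ha (derivative P - C a * X * P) v
  have h2 := SigmaSpace.inner_mulX_comm (gaussSigma a (X * P)) v
  rw [gaussSigma_fn] at h1 h2
  rw [gaussSigma_der, ← neg_eq_iff_eq_neg] at h1
  rw [gaussSigma_mulX] at h2
  rw [e0, e1, e2, inner_smul_left_eq_smul, inner_smul_left_eq_smul, inner_smul_left_eq_smul, ← h1,
    ← h2]
  have e3 : (a * (2 * n + 1)) • P = a ^ 2 • (X * (X * P))
      - (derivative (derivative P - C a * X * P) - C a * X * (derivative P - C a * X * P)) := by
    have := hermitePoly_ode a n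
    rw [← hP] at this
    simp only [smul_eq_C_mul, derivative_sub, derivative_mul, derivative_C, derivative_X, C_mul,
      C_add, C_pow, C_1] at this ⊢
    have c2 : (C (2 : ℝ)) = 2 := rfl
    linear_combination this + C a * X * derivative P * c2
  have e4 : gaussL2 a ((a * (2 * n + 1)) • P) = (a * (2 * n + 1)) • gaussL2 a P := map_smul _ _ _
  rw [e3, map_sub, map_smul] at e4
  have e5 := congrArg (fun w => inner ℂ w v.fn) e4
  simp only [inner_sub_left, inner_smul_left_eq_smul, Complex.real_smul] at e5 ⊢
  rw [mul_left_comm _ _ (inner ℂ (gaussL2 a P) v.fn), ← e5]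
  push_cast
  ring

/-- The span of the Hermite polynomials is stable under multiplication by `X`, hence contains all
powers of `X`, and the totality of polynomials times a Gaussian applies. -/
theorem hermiteFn_total {a : ℝ} (ha : 0 < a) {f : L2}
    (h : ∀ n, inner ℂ (hermiteFn a n).fn f = 0) : f = 0 := by
  have hP : ∀ n, inner ℂ (gaussL2 a (hermitePoly a n)) f = 0 := fun n => by
    have := h n
    rw [hermiteFn_fn, inner_smul_left_eq_smul, smul_eq_zero] at this
    exact this.resolve_left (inv_ne_zero (Real.sqrt_pos.2 (hermiteNormSq_pos ha n)).ne')
  let S : Submodule ℝ ℝ[X] := Submodule.span ℝ (range (hermitePoly a))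
  have hS : ∀ p ∈ S, inner ℂ (gaussL2 a p) f = 0 := by
    intro p hp
    induction hp using Submodule.span_induction with
    | mem x hx => obtain ⟨n, rfl⟩ := hx; exact hP n
    | zero => simp
    | add p q _ _ hp hq => rw [map_add, inner_add_left, hp, hq, add_zero]
    | smul c p _ hp => rw [map_smul, inner_smul_left_eq_smul, hp, smul_zero]
  have hmem : ∀ n, hermitePoly a n ∈ S := fun n => Submodule.subset_span ⟨n, rfl⟩
  have hX : ∀ p ∈ S, X * p ∈ S := by
    intro p hp
    induction hp using Submodule.span_induction with
    | mem x hx =>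
      obtain ⟨n, rfl⟩ := hx
      have e : X * hermitePoly a n
          = (2 * a)⁻¹ • (hermitePoly a (n + 1) + derivative (hermitePoly a n)) := by
        rw [hermitePoly_succ, sub_add_cancel, mul_assoc, ← smul_eq_C_mul, smul_smul,
          inv_mul_cancel₀ (by positivity), one_smul]
      rw [e]
      refine S.smul_mem _ (S.add_mem (hmem _) ?_)
      cases n with
      | zero => simp [hermitePoly]
      | succ n =>
        rw [derivative_hermitePoly_succ, ← smul_eq_C_mul]
        exact S.smul_mem _ (hmem _)
    | zero => simp
    | add p q _ _ hp hq => rw [mul_add]; exact S.add_mem hp hq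
    | smul c p _ hp => rw [mul_smul_comm]; exact S.smul_mem _ hp
  refine eq_zero_of_inner_gaussL2_pow_eq_zero ha f fun j => hS _ ?_
  induction j with
  | zero => exact hmem 0
  | succ j ih => rw [pow_succ']; exact hX _ ih

theorem EvenSigma.real_smul_mem {u : SigmaSpace} (c : ℝ) (hu : u ∈ EvenSigma) :
    c • u ∈ EvenSigma := EvenSigma.smul_mem (c : ℂ) hu

theorem hermiteFn_even (a : ℝ) (n : ℕ) : hermiteFn a (2 * n) ∈ EvenSigma :=
  EvenSigma.real_smul_mem _ (gaussSigma_mem_even a (by rw [hermitePoly_comp_neg, pow_mul]; simp))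

theorem inner_hermiteFn_odd {a : ℝ} (ha : 0 < a) (n : ℕ) {v : SigmaSpace} (hv : v ∈ EvenSigma) :
    inner ℂ (hermiteFn a (2 * n + 1)).fn v.fn = 0 := by
  have hv' : (fun x : ℝ => v.fn (-x)) =ᵐ[volume] fun x : ℝ => v.fn x := hv
  rw [hermiteFn_fn, inner_smul_left_eq_smul, inner_gaussL2 ha]
  have e2 : ∫ x : ℝ, (gaussFun a (hermitePoly a (2 * n + 1)) x : ℂ) * v.fn x =
      -∫ x : ℝ, (gaussFun a (hermitePoly a (2 * n + 1)) x : ℂ) * v.fn x := by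
    conv_lhs => rw [← integral_neg_eq_self]
    rw [← integral_neg]
    refine integral_congr_ae ?_
    filter_upwards [hv'] with x h1
    have h2 : gaussFun a (hermitePoly a (2 * n + 1)) (-x)
        = -gaussFun a (hermitePoly a (2 * n + 1)) x := by
      have := congrArg (eval x) (hermitePoly_comp_neg a (2 * n + 1))
      rw [eval_comp, pow_succ, pow_mul] at this
      simp only [eval_neg, eval_X] at this
      rw [gaussFun, gaussFun, this, neg_sq]
      simp
    rw [h1, h2]
    push_cast
    ring
  rw [self_eq_neg.mp e2, smul_zero]

/-- Reflection keeps the coefficients of even index and changes the sign of those of odd index. If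
the latter vanish, `v` and its reflection have the same coefficients. -/
theorem mem_even_of_inner_odd {a : ℝ} (ha : 0 < a) {v : SigmaSpace}
    (h : ∀ n, inner ℂ (hermiteFn a (2 * n + 1)).fn v.fn = 0) : v ∈ EvenSigma := by
  have hmp := Measure.measurePreserving_neg (volume : Measure ℝ)
  let R : L2 := Lp.compMeasurePreserving (fun x : ℝ => -x) hmp v.fn
  have hR : (R : ℝ → ℂ) =ᵐ[volume] fun x => v.fn (-x) :=
    Lp.coeFn_compMeasurePreserving v.fn hmp
  have hsub : R - v.fn = 0 := by
    refine hermiteFn_total ha fun n => ?_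
    rcases Nat.even_or_odd' n with ⟨k, rfl | rfl⟩
    · rw [inner_sub_right, sub_eq_zero, hermiteFn_fn, inner_smul_left_eq_smul,
        inner_smul_left_eq_smul, inner_gaussL2 ha, inner_gaussL2 ha]
      congr 1
      rw [← integral_neg_eq_self]
      refine integral_congr_ae ?_
      filter_upwards [hmp.quasiMeasurePreserving.ae hR] with x h1
      rw [h1, neg_neg]
      congr 2
      have := congrArg (eval x) (hermitePoly_comp_neg a (2 * k))
      rw [eval_comp, pow_mul] at this
      simp only [eval_neg, eval_X] at this
      rw [gaussFun, gaussFun, this, neg_sq]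
      simp
    · rw [inner_sub_right, h k, sub_zero]
      have h' := h k
      rw [hermiteFn_fn, inner_smul_left_eq_smul, inner_gaussL2 ha] at h' ⊢
      have e : ∫ x : ℝ, (gaussFun a (hermitePoly a (2 * k + 1)) x : ℂ) * R x =
          -∫ x : ℝ, (gaussFun a (hermitePoly a (2 * k + 1)) x : ℂ) * v.fn x := by
        rw [← integral_neg_eq_self, ← integral_neg]
        refine integral_congr_ae ?_
        filter_upwards [hmp.quasiMeasurePreserving.ae hR] with x h1
        rw [h1, neg_neg]
        have := congrArg (eval x) (hermitePoly_comp_neg a (2 * k + 1))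
        rw [eval_comp, pow_succ, pow_mul] at this
        simp only [eval_neg, eval_X] at this
        rw [gaussFun, gaussFun, this, neg_sq]
        simp
      rw [e, smul_neg, h', neg_zero]
  change (fun x : ℝ => v.fn (-x)) =ᵐ[volume] fun x : ℝ => v.fn x
  rw [sub_eq_zero] at hsub
  rw [hsub] at hR
  exact hR.symm

end

/-! ### Hermite coordinates on `Σ` and the unitary group of the oscillator -/

/-- The Hermite functions form a Hilbert basis of `L²`. -/
theorem hasSum_hermite {a : ℝ} (ha : 0 < a) (f g : L2) :
    HasSum (fun n => inner ℂ f (hermiteFn a n).fn * inner ℂ (hermiteFn a n).fn g) (inner ℂ f g) := by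
  have ho : Orthonormal ℂ fun n => (hermiteFn a n).fn :=
    orthonormal_iff_ite.2 fun n m => inner_hermiteFn ha n m
  have hb : (Submodule.span ℂ (range fun n => (hermiteFn a n).fn))ᗮ = ⊥ := by
    rw [Submodule.eq_bot_iff]
    intro f hf
    refine hermiteFn_total ha fun n => ?_
    exact (Submodule.mem_orthogonal _ _).1 hf _ (Submodule.subset_span ⟨n, rfl⟩)
  have := (HilbertBasis.mkOfOrthogonalEqBot ho hb).hasSum_inner_mul_inner f g
  simpa only [HilbertBasis.coe_mkOfOrthogonalEqBot] using this

/-- The sesquilinear form `(u', v') + a² (x u, x v)` of the harmonic oscillator. -/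
def oscForm (a : ℝ) (u v : SigmaSpace) : ℂ :=
  inner ℂ u.der v.der + (a : ℂ) ^ 2 * inner ℂ u.mulX v.mulX

theorem oscForm_smul_left (a : ℝ) (z : ℂ) (u v : SigmaSpace) :
    oscForm a (z • u) v = starRingEnd ℂ z * oscForm a u v := by
  rw [oscForm, oscForm, SigmaSpace.der_smul, SigmaSpace.mulX_smul, inner_smul_left,
    inner_smul_left]
  ring

theorem oscForm_smul_right (a : ℝ) (z : ℂ) (u v : SigmaSpace) :
    oscForm a u (z • v) = z * oscForm a u v := by
  rw [oscForm, oscForm, SigmaSpace.der_smul, SigmaSpace.mulX_smul, inner_smul_right,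
    inner_smul_right]
  ring

theorem oscForm_hermiteFn {a : ℝ} (ha : 0 < a) (n : ℕ) (v : SigmaSpace) :
    oscForm a (hermiteFn a n) v = (a * (2 * n + 1) : ℝ) * inner ℂ (hermiteFn a n).fn v.fn :=
  hermiteFn_eigen ha n v

/-- The embedding of `Σ` into `L² × L² × L²` by `u ↦ (u, u', a x u)`. -/
def weightedEmbedding (a : ℝ) : SigmaSpace →L[ℂ] PiLp 2 (fun _ : Fin 3 => L2) :=
  ((PiLp.continuousLinearEquiv 2 ℂ (fun _ : Fin 3 => L2)).symm :
    (Fin 3 → L2) →L[ℂ] PiLp 2 (fun _ : Fin 3 => L2)).comp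
    (ContinuousLinearMap.pi ![SigmaSpace.fnL, SigmaSpace.derL, (a : ℂ) • SigmaSpace.mulXL])

theorem inner_weightedEmbedding (a : ℝ) (u v : SigmaSpace) :
    inner ℂ (weightedEmbedding a u) (weightedEmbedding a v)
      = inner ℂ u.fn v.fn + oscForm a u v := by
  rw [PiLp.inner_apply, Fin.sum_univ_three, oscForm, ← add_assoc]
  have e : ∀ (w : SigmaSpace) (i : Fin 3), weightedEmbedding a w i
      = (![SigmaSpace.fnL, SigmaSpace.derL, (a : ℂ) • SigmaSpace.mulXL] : Fin 3 → _ →L[ℂ] L2) i w :=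
    fun _ _ => rfl
  simp only [e]
  change inner ℂ u.fn v.fn + inner ℂ u.der v.der
    + inner ℂ ((a : ℂ) • u.mulX) ((a : ℂ) • v.mulX) = _
  rw [inner_smul_left, inner_smul_right, Complex.conj_ofReal]
  ring

theorem norm_weightedEmbedding_sq (a : ℝ) (u : SigmaSpace) :
    ‖weightedEmbedding a u‖ ^ 2 = ‖u.fn‖ ^ 2 + ‖u.der‖ ^ 2 + a ^ 2 * ‖u.mulX‖ ^ 2 := by
  have h := inner_weightedEmbedding a u u
  simp only [oscForm, inner_self_eq_norm_sq_to_K] at h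
  rw [← add_assoc] at h
  exact Complex.ofReal_injective (by simpa using h)

theorem norm_le_weightedEmbedding {a : ℝ} (ha : 0 < a) (u : SigmaSpace) :
    ‖u‖ ≤ (1 + a⁻¹) * ‖weightedEmbedding a u‖ := by
  refine le_of_sq_le_sq ?_ (by positivity)
  rw [mul_pow, norm_weightedEmbedding_sq, u.norm_sq_eq]
  have h1 : a⁻¹ * a = 1 := inv_mul_cancel₀ ha.ne'
  have h2 : 0 < a⁻¹ := inv_pos.2 ha
  have h3 : ‖u.mulX‖ ^ 2 ≤ (1 + a⁻¹) ^ 2 * (a ^ 2 * ‖u.mulX‖ ^ 2) := by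
    have e : (1 + a⁻¹) ^ 2 * (a ^ 2 * ‖u.mulX‖ ^ 2) = (a + a⁻¹ * a) ^ 2 * ‖u.mulX‖ ^ 2 := by ring
    rw [e, h1]
    nlinarith [sq_nonneg ‖u.mulX‖, mul_nonneg ha.le (sq_nonneg ‖u.mulX‖),
      mul_nonneg (sq_nonneg a) (sq_nonneg ‖u.mulX‖)]
  have h4 : (1 : ℝ) ≤ (1 + a⁻¹) ^ 2 := by nlinarith
  nlinarith [sq_nonneg ‖u.fn‖, sq_nonneg ‖u.der‖]

theorem weightedEmbedding_norm_le {a : ℝ} (ha : 0 < a) (u : SigmaSpace) :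
    ‖weightedEmbedding a u‖ ≤ (1 + a) * ‖u‖ := by
  refine le_of_sq_le_sq ?_ (by positivity)
  rw [mul_pow, norm_weightedEmbedding_sq, u.norm_sq_eq]
  nlinarith [sq_nonneg ‖u.fn‖, sq_nonneg ‖u.der‖, sq_nonneg ‖u.mulX‖,
    mul_nonneg ha.le (sq_nonneg ‖u.fn‖), mul_nonneg ha.le (sq_nonneg ‖u.der‖),
    mul_nonneg ha.le (sq_nonneg ‖u.mulX‖), mul_nonneg (sq_nonneg a) (sq_nonneg ‖u.fn‖),
    mul_nonneg (sq_nonneg a) (sq_nonneg ‖u.der‖), mul_nonneg (sq_nonneg a) (sq_nonneg ‖u.mulX‖)]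

/-- In the inner product of `weightedEmbedding` the Hermite functions stay orthogonal, with squared
length `1 + a (2 j + 1)`, because they are weak eigenfunctions. For the same reason pairing with
them is a multiple of the `L²` coefficient, so they are total in `Σ` as well. -/
theorem exists_hermiteCoords {a : ℝ} (ha : 0 < a) :
    ∃ T : SigmaSpace ≃L[ℂ] lp (fun _ : ℕ => ℂ) 2,
      (∀ u j, T u j = (√(1 + a * (2 * j + 1)) : ℝ) * inner ℂ (hermiteFn a j).fn u.fn) ∧
      ∀ u v, inner ℂ (T u) (T v) = inner ℂ u.fn v.fn + oscForm a u v := by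
  set J := weightedEmbedding a with hJ
  have hinj : Function.Injective J := by
    intro u v huv
    have := norm_le_weightedEmbedding ha (u - v)
    rw [map_sub, ← hJ, huv, sub_self, norm_zero, mul_zero] at this
    exact sub_eq_zero.1 (norm_le_zero_iff.1 this)
  have hanti : AntilipschitzWith (Real.toNNReal (1 + a⁻¹)) J := by
    refine AddMonoidHomClass.antilipschitz_of_bound J fun u => ?_
    rw [Real.coe_toNNReal _ (by positivity)]
    exact norm_le_weightedEmbedding ha u
  have hcl : IsClosed (range J) := hanti.isClosed_range J.uniformContinuous
  let K := J.range
  have hK : IsClosed (K : Set (PiLp 2 (fun _ : Fin 3 => L2))) := hcl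
  have : CompleteSpace K := hK.completeSpace_coe
  let S : SigmaSpace ≃L[ℂ] K := J.equivRange hinj hcl
  have hS : ∀ u, ((S u : K) : PiLp 2 (fun _ : Fin 3 => L2)) = J u := fun u => rfl
  have hin : ∀ u v, inner ℂ (S u) (S v) = inner ℂ u.fn v.fn + oscForm a u v := fun u v => by
    rw [Submodule.coe_inner, hS, hS, inner_weightedEmbedding]
  set κ : ℕ → ℝ := fun j => 1 + a * (2 * j + 1) with hκdef
  have hκ : ∀ j, 0 < κ j := fun j => by simp only [hκdef]; positivity
  have hsq : ∀ j, ((√(κ j) : ℝ) : ℂ) * (√(κ j) : ℝ) = (κ j : ℝ) := fun j => by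
    rw [← Complex.ofReal_mul, Real.mul_self_sqrt (hκ j).le]
  have hsq0 : ∀ j, ((√(κ j) : ℝ) : ℂ) ≠ 0 := fun j =>
    Complex.ofReal_ne_zero.2 (Real.sqrt_pos.2 (hκ j)).ne'
  let v : ℕ → K := fun j => S (((√(κ j) : ℝ) : ℂ)⁻¹ • hermiteFn a j)
  have hv : ∀ j u, inner ℂ (v j) (S u) = (√(κ j) : ℝ) * inner ℂ (hermiteFn a j).fn u.fn := by
    intro j u
    rw [hin, SigmaSpace.fn_smul, inner_smul_left, oscForm_smul_left, oscForm_hermiteFn ha,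
      ← mul_add, ← one_add_mul, map_inv₀, Complex.conj_ofReal]
    have : (1 : ℂ) + (a * (2 * j + 1) : ℝ) = (κ j : ℝ) := by push_cast [hκdef]; ring
    rw [this, ← hsq j, ← mul_assoc, ← mul_assoc, inv_mul_cancel₀ (hsq0 j), one_mul]
  have ho : Orthonormal ℂ v := by
    rw [orthonormal_iff_ite]
    intro i j
    rw [hv, SigmaSpace.fn_smul, inner_smul_right, inner_hermiteFn ha]
    by_cases h : i = j
    · subst h; simp [mul_inv_cancel₀ (hsq0 i)]
    · simp [h]
  have hb : (Submodule.span ℂ (range v))ᗮ = ⊥ := by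
    rw [Submodule.eq_bot_iff]
    intro w hw
    obtain ⟨u, rfl⟩ := S.surjective w
    have : u.fn = 0 := hermiteFn_total ha fun n => by
      have := (Submodule.mem_orthogonal _ _).1 hw _ (Submodule.subset_span ⟨n, rfl⟩)
      rw [hv] at this
      exact (mul_eq_zero.1 this).resolve_left (hsq0 n)
    rw [SigmaSpace.ext_fn (v := 0) this, map_zero]
  let b := HilbertBasis.mkOfOrthogonalEqBot ho hb
  refine ⟨S.trans b.repr.toContinuousLinearEquiv, fun u j => ?_, fun u w => ?_⟩
  · change b.repr (S u) j = _
    rw [b.repr_apply_apply, HilbertBasis.coe_mkOfOrthogonalEqBot, hv]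
  · change inner ℂ (b.repr (S u)) (b.repr (S w)) = _
    rw [b.repr.inner_map_map, hin]

/-- The coordinates of an element of `Σ` in the Hermite basis, normalized to be isometric for the
norm `(‖u‖² + ‖u'‖² + a² ‖x u‖²)^(1/2)`. -/
def hermiteCoords {a : ℝ} (ha : 0 < a) : SigmaSpace ≃L[ℂ] lp (fun _ : ℕ => ℂ) 2 :=
  (exists_hermiteCoords ha).choose

theorem hermiteCoords_apply {a : ℝ} (ha : 0 < a) (u : SigmaSpace) (j : ℕ) : hermiteCoords ha u j
    = (√(1 + a * (2 * j + 1)) : ℝ) * inner ℂ (hermiteFn a j).fn u.fn :=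
  (exists_hermiteCoords ha).choose_spec.1 u j

theorem inner_hermiteCoords {a : ℝ} (ha : 0 < a) (u v : SigmaSpace) :
    inner ℂ (hermiteCoords ha u) (hermiteCoords ha v) = inner ℂ u.fn v.fn + oscForm a u v :=
  (exists_hermiteCoords ha).choose_spec.2 u v

theorem norm_hermiteCoords {a : ℝ} (ha : 0 < a) (u : SigmaSpace) :
    ‖hermiteCoords ha u‖ = ‖weightedEmbedding a u‖ := by
  rw [← sq_eq_sq₀ (norm_nonneg _) (norm_nonneg _), ← inner_self_eq_norm_sq (𝕜 := ℂ),
    ← inner_self_eq_norm_sq (𝕜 := ℂ), inner_hermiteCoords, inner_weightedEmbedding]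

theorem hermiteCoords_mul_conj {a : ℝ} (ha : 0 < a) (u v : SigmaSpace) (j : ℕ) :
    inner ℂ (hermiteCoords ha u j) (hermiteCoords ha v j) = (1 + a * (2 * j + 1) : ℝ)
      * (inner ℂ u.fn (hermiteFn a j).fn * inner ℂ (hermiteFn a j).fn v.fn) := by
  have h : (0 : ℝ) ≤ 1 + a * (2 * j + 1) := by positivity
  rw [RCLike.inner_apply, hermiteCoords_apply, hermiteCoords_apply, map_mul, inner_conj_symm,
    Complex.conj_ofReal]
  nth_rewrite 3 [← Real.mul_self_sqrt h]
  push_cast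
  ring

/-- The expansion of the form of the harmonic oscillator in the Hermite basis. -/
theorem hasSum_oscForm {a : ℝ} (ha : 0 < a) (u v : SigmaSpace) :
    HasSum (fun j : ℕ => ((a * (2 * j + 1) : ℝ) : ℂ)
      * (inner ℂ u.fn (hermiteFn a j).fn * inner ℂ (hermiteFn a j).fn v.fn)) (oscForm a u v) := by
  have h1 := lp.hasSum_inner (𝕜 := ℂ) (hermiteCoords ha u) (hermiteCoords ha v)
  rw [inner_hermiteCoords] at h1
  have h := h1.sub (hasSum_hermite ha u.fn v.fn)
  rw [add_sub_cancel_left] at h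
  refine h.congr_fun fun j => ?_
  rw [hermiteCoords_mul_conj]
  push_cast
  ring

/-- The multiplication of the `j`-th coordinate by `exp (i θ j)`. -/
def phaseMap (θ : ℕ → ℝ) : lp (fun _ : ℕ => ℂ) 2 →ₗᵢ[ℂ] lp (fun _ : ℕ => ℂ) 2 where
  toFun b := ⟨fun j => Complex.exp (θ j * Complex.I) * b j,
    (lp.memℓp b).mono' fun j => by rw [norm_mul, Complex.norm_exp_ofReal_mul_I, one_mul]⟩
  map_add' b c := by ext j; exact mul_add _ _ _
  map_smul' z b := by ext j; exact mul_left_comm _ _ _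
  norm_map' b := by
    rw [lp.norm_eq_tsum_rpow (by norm_num), lp.norm_eq_tsum_rpow (by norm_num)]
    congr 2
    ext j
    change ‖Complex.exp (θ j * Complex.I) * b j‖ ^ _ = _
    rw [norm_mul, Complex.norm_exp_ofReal_mul_I, one_mul]

theorem phaseMap_apply (θ : ℕ → ℝ) (b : lp (fun _ : ℕ => ℂ) 2) (j : ℕ) :
    phaseMap θ b j = Complex.exp (θ j * Complex.I) * b j := rfl

/-- The phases need not be equicontinuous in `j`, so continuity is only strong. The series is
dominated termwise by `4 ‖b j‖²`. -/
theorem continuous_phaseMap {θ : ℝ → ℕ → ℝ} (hθ : ∀ j, Continuous fun t => θ t j)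
    (b : lp (fun _ : ℕ => ℂ) 2) : Continuous fun t => phaseMap (θ t) b := by
  rw [continuous_iff_continuousAt]
  intro t₀
  rw [ContinuousAt, tendsto_iff_norm_sub_tendsto_zero]
  have hsum : Summable fun j => ‖b j‖ ^ 2 := by
    simpa using (lp.memℓp b).summable (by norm_num)
  have e : ∀ t, ‖phaseMap (θ t) b - phaseMap (θ t₀) b‖ = √(∑' j,
      ‖Complex.exp (θ t j * Complex.I) - Complex.exp (θ t₀ j * Complex.I)‖ ^ 2 * ‖b j‖ ^ 2) := by
    intro t
    rw [lp.norm_eq_tsum_rpow (by norm_num), Real.sqrt_eq_rpow]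
    simp only [ENNReal.toReal_ofNat, Real.rpow_ofNat]
    congr 2
    ext j
    rw [← mul_pow, ← norm_mul, sub_mul]
    rfl
  simp_rw [e]
  rw [← Real.sqrt_zero]
  refine (Real.continuous_sqrt.tendsto _).comp ?_
  suffices h : Tendsto (fun t => ∑' j, ‖Complex.exp (θ t j * Complex.I)
      - Complex.exp (θ t₀ j * Complex.I)‖ ^ 2 * ‖b j‖ ^ 2) (𝓝 t₀) (𝓝 (∑' _ : ℕ, 0)) by
    rwa [tsum_zero] at h
  refine tendsto_tsum_of_dominated_convergence (bound := fun j => 4 * ‖b j‖ ^ 2)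
    (hsum.mul_left 4) (fun j => ?_) (Eventually.of_forall fun t j => ?_)
  · have hc : Continuous fun t =>
        ‖Complex.exp (θ t j * Complex.I) - Complex.exp (θ t₀ j * Complex.I)‖ ^ 2 * ‖b j‖ ^ 2 := by
      have := hθ j
      fun_prop
    simpa using hc.tendsto t₀
  · rw [Real.norm_of_nonneg (by positivity)]
    gcongr
    have h := norm_sub_le (Complex.exp (θ t j * Complex.I)) (Complex.exp (θ t₀ j * Complex.I))
    rw [Complex.norm_exp_ofReal_mul_I, Complex.norm_exp_ofReal_mul_I] at h
    nlinarith [norm_nonneg (Complex.exp (θ t j * Complex.I) - Complex.exp (θ t₀ j * Complex.I))]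

/-- The unitary group of `2 i u_t = -u'' + a² x² u` on `Σ`. -/
def oscFlow {a : ℝ} (ha : 0 < a) (t : ℝ) (u : SigmaSpace) : SigmaSpace :=
  (hermiteCoords ha).symm (phaseMap (fun j => -(a * (2 * j + 1)) * t / 2) (hermiteCoords ha u))

theorem hermiteCoords_oscFlow {a : ℝ} (ha : 0 < a) (t : ℝ) (u : SigmaSpace) :
    hermiteCoords ha (oscFlow ha t u)
      = phaseMap (fun j => -(a * (2 * j + 1)) * t / 2) (hermiteCoords ha u) :=
  (hermiteCoords ha).apply_symm_apply _

theorem oscFlow_sub {a : ℝ} (ha : 0 < a) (t : ℝ) (u v : SigmaSpace) :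
    oscFlow ha t (u - v) = oscFlow ha t u - oscFlow ha t v := by
  simp [oscFlow]

theorem continuous_oscFlow {a : ℝ} (ha : 0 < a) (u : SigmaSpace) :
    Continuous fun t => oscFlow ha t u :=
  (hermiteCoords ha).symm.continuous.comp
    (continuous_phaseMap (fun j => by fun_prop) _)

theorem inner_hermiteFn_oscFlow {a : ℝ} (ha : 0 < a) (t : ℝ) (u : SigmaSpace) (j : ℕ) :
    inner ℂ (hermiteFn a j).fn (oscFlow ha t u).fn
      = Complex.exp ((-(a * (2 * j + 1)) * t / 2 : ℝ) * Complex.I)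
        * inner ℂ (hermiteFn a j).fn u.fn := by
  have h := congrArg (fun b : lp (fun _ : ℕ => ℂ) 2 => b j) (hermiteCoords_oscFlow ha t u)
  simp only [phaseMap_apply] at h
  rw [hermiteCoords_apply, hermiteCoords_apply, mul_left_comm] at h
  refine mul_left_cancel₀ (Complex.ofReal_ne_zero.2 (Real.sqrt_pos.2 ?_).ne') h
  positivity

theorem oscFlow_zero {a : ℝ} (ha : 0 < a) (u : SigmaSpace) : oscFlow ha 0 u = u := by
  rw [oscFlow, ContinuousLinearEquiv.symm_apply_eq]
  ext j
  simp [phaseMap_apply]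

theorem oscFlow_mem_even {a : ℝ} (ha : 0 < a) (t : ℝ) {u : SigmaSpace} (hu : u ∈ EvenSigma) :
    oscFlow ha t u ∈ EvenSigma :=
  mem_even_of_inner_odd ha fun n => by
    rw [inner_hermiteFn_oscFlow, inner_hermiteFn_odd ha n hu, mul_zero]

theorem norm_weightedEmbedding_oscFlow {a : ℝ} (ha : 0 < a) (t : ℝ) (u : SigmaSpace) :
    ‖weightedEmbedding a (oscFlow ha t u)‖ = ‖weightedEmbedding a u‖ := by
  rw [← norm_hermiteCoords ha, ← norm_hermiteCoords ha, hermiteCoords_oscFlow,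
    LinearIsometry.norm_map]

/-- The flow is isometric for the weighted norm; the constant only compares this norm with that of
`Σ`. Its independence of `t` is the source of stability. -/
theorem norm_oscFlow_le {a : ℝ} (ha : 0 < a) (t : ℝ) (u : SigmaSpace) :
    ‖oscFlow ha t u‖ ≤ (1 + a⁻¹) * (1 + a) * ‖u‖ := by
  refine (norm_le_weightedEmbedding ha _).trans ?_
  rw [norm_weightedEmbedding_oscFlow, mul_assoc]
  gcongr
  exact weightedEmbedding_norm_le ha u

theorem norm_oscFlow_fn {a : ℝ} (ha : 0 < a) (t : ℝ) (u : SigmaSpace) :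
    ‖(oscFlow ha t u).fn‖ = ‖u.fn‖ := by
  have h1 := hasSum_hermite ha u.fn u.fn
  have h2 := hasSum_hermite ha (oscFlow ha t u).fn (oscFlow ha t u).fn
  have e : ∀ (w : SigmaSpace) j, inner ℂ w.fn (hermiteFn a j).fn * inner ℂ (hermiteFn a j).fn w.fn
      = (‖inner ℂ (hermiteFn a j).fn w.fn‖ : ℂ) ^ 2 := fun w j => by
    rw [← inner_conj_symm, Complex.conj_mul']
  simp_rw [e] at h1 h2
  simp_rw [inner_hermiteFn_oscFlow, norm_mul, Complex.norm_exp_ofReal_mul_I, one_mul] at h2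
  have h3 := h2.unique h1
  rw [← sq_eq_sq₀ (norm_nonneg _) (norm_nonneg _), ← inner_self_eq_norm_sq (𝕜 := ℂ),
    ← inner_self_eq_norm_sq (𝕜 := ℂ), h3]

theorem oscFlow_eigen {a : ℝ} (ha : 0 < a) (t : ℝ) (n : ℕ) (c : ℝ) :
    oscFlow ha t (c • hermiteFn a n)
      = Complex.exp ((-(a * (2 * n + 1)) * t / 2 : ℝ) * Complex.I) • c • hermiteFn a n := by
  refine SigmaSpace.ext_fn (sub_eq_zero.1 (hermiteFn_total ha fun j => ?_))
  have e : (c • hermiteFn a n).fn = c • (hermiteFn a n).fn := rfl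
  rw [inner_sub_right, inner_hermiteFn_oscFlow, SigmaSpace.fn_smul, inner_smul_right, e,
    inner_smul_right_eq_smul, inner_hermiteFn ha]
  by_cases h : j = n
  · subst h; simp
  · simp [h]

/-- The group `oscFlow` solves its equation weakly. -/
theorem hasDerivAt_oscFlow {a : ℝ} (ha : 0 < a) (u h : SigmaSpace) (t : ℝ) :
    HasDerivAt (fun τ => 2 * Complex.I * inner ℂ h.fn (oscFlow ha τ u).fn)
      (oscForm a h (oscFlow ha t u)) t := by
  set c : ℕ → ℂ := fun j => inner ℂ h.fn (hermiteFn a j).fn * inner ℂ (hermiteFn a j).fn u.fn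
    with hc
  set E : ℕ → ℝ := fun j => a * (2 * j + 1) with hE
  have hval : ∀ τ, inner ℂ h.fn (oscFlow ha τ u).fn
      = ∑' j, Complex.exp ((-E j * τ / 2 : ℝ) * Complex.I) * c j := fun τ => by
    rw [← (hasSum_hermite ha h.fn (oscFlow ha τ u).fn).tsum_eq]
    congr 1
    ext j
    rw [inner_hermiteFn_oscFlow, mul_left_comm]
  -- Both functions lie in `Σ`, so the coefficients weighted by the levels are absolutely summable.
  -- They dominate the series differentiated term by term.
  have hs : Summable fun j => ‖(E j : ℂ) * c j‖ := (hasSum_oscForm ha h u).summable.norm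
  have hD := hasDerivAt_tsum (𝕜 := ℝ) (u := fun j => ‖(E j : ℂ) * c j‖)
    (g := fun j τ => Complex.exp ((-E j * τ / 2 : ℝ) * Complex.I) * c j)
    (g' := fun j τ => Complex.exp ((-E j * τ / 2 : ℝ) * Complex.I)
      * ((-E j / 2 : ℝ) * Complex.I) * c j) (y₀ := 0) hs
    (fun j τ => by
      have h1 : HasDerivAt (fun τ : ℝ => -E j * τ / 2) (-E j / 2) τ := by
        have := ((hasDerivAt_id τ).const_mul (-E j)).div_const 2
        simpa using this
      exact (((h1.ofReal_comp).mul_const Complex.I).cexp).mul_const (c j))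
    (fun j τ => by
      rw [norm_mul, norm_mul, Complex.norm_exp_ofReal_mul_I, one_mul, norm_mul _ Complex.I, Complex.norm_I,
        mul_one, norm_mul (E j : ℂ), Complex.norm_real, Complex.norm_real, norm_div, norm_neg]
      gcongr
      exact div_le_self (norm_nonneg _) (by norm_num))
    (by simpa using (hasSum_hermite ha h.fn u.fn).summable) t
  have hD' := hD.const_mul (2 * Complex.I)
  simp_rw [← hval] at hD'
  refine hD'.congr_deriv ?_
  rw [← tsum_mul_left, ← (hasSum_oscForm ha h (oscFlow ha t u)).tsum_eq]
  congr 1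
  ext j
  rw [inner_hermiteFn_oscFlow]
  simp only [hc, hE]
  push_cast
  linear_combination (-(a * (2 * j + 1)) * (inner ℂ h.fn (hermiteFn a j).fn
    * inner ℂ (hermiteFn a j).fn u.fn)
    * Complex.exp (-(a * (2 * j + 1)) * t / 2 * Complex.I)) * Complex.I_sq

/-! ### Even solutions: conservation of charge, explicit formula, uniqueness -/

/-- The right-hand side of the equation for an even function `u`, paired with `h`. -/
def evenForm (lam eta : ℝ) (h u : SigmaSpace) : ℂ :=
  inner ℂ h.der u.der + (lam : ℂ) * inner ℂ h.mulX u.mulX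
    + (eta : ℂ) * ((‖u.fn‖ : ℂ) ^ 2 * inner ℂ h.mulX u.mulX
      + (‖u.mulX‖ : ℂ) ^ 2 * inner ℂ h.fn u.fn)

/-- Once the charge is fixed, the quadratic part of the potential joins the trap. What remains is a
real multiple of `u`, which a change of phase removes. -/
theorem evenForm_eq_oscForm {lam eta a : ℝ} {u : SigmaSpace}
    (ha : a ^ 2 = lam + eta * ‖u.fn‖ ^ 2) (h : SigmaSpace) : evenForm lam eta h u
      = oscForm a h u + (eta * ‖u.mulX‖ ^ 2 : ℝ) * inner ℂ h.fn u.fn := by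
  rw [evenForm, oscForm, ← Complex.ofReal_pow a, ha]
  push_cast
  ring

theorem isSolution_iff {lam eta : ℝ} {u : ℝ → SigmaSpace} (hu : ∀ t, u t ∈ EvenSigma) :
    IsSolution lam eta u ↔ Continuous u ∧ ∀ (h : SigmaSpace) (t : ℝ),
      HasDerivAt (fun τ : ℝ => 2 * Complex.I * inner ℂ h.fn (u τ).fn)
        (evenForm lam eta h (u t)) t := by
  refine and_congr_right fun _ => forall₂_congr fun h t => ?_
  rw [SigmaSpace.integral_potential (hu t) h, evenForm]

theorem continuous_evenForm (lam eta : ℝ) :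
    Continuous fun p : SigmaSpace × SigmaSpace => evenForm lam eta p.1 p.2 := by
  have h0 := SigmaSpace.continuous_fn
  have h1 := SigmaSpace.continuous_der
  have h2 := SigmaSpace.continuous_mulX
  unfold evenForm
  fun_prop

theorem evenForm_add_self_im (lam eta : ℝ) (u : SigmaSpace) :
    (evenForm lam eta (u + u) u).im = 0 := by
  have e : evenForm lam eta (u + u) u = ((2 * (‖u.der‖ ^ 2 + lam * ‖u.mulX‖ ^ 2
      + eta * (2 * ‖u.fn‖ ^ 2 * ‖u.mulX‖ ^ 2)) : ℝ) : ℂ) := by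
    rw [evenForm, SigmaSpace.fn_add, SigmaSpace.der_add, SigmaSpace.mulX_add]
    simp only [inner_add_left, inner_self_eq_norm_sq_to_K]
    push_cast
    simp only [Complex.coe_algebraMap]
    ring
  rw [e, Complex.ofReal_im]

/-- A solution is differentiable only after pairing with a fixed `h`. With `h = u s + u t`, the
increment of `Re (h, u τ)` between `τ = t` and `τ = s` is exactly `‖u s‖² - ‖u t‖²`. Its rate of
change is governed by the imaginary part of `evenForm`, which is small for `s` and `τ` near `t`
since it vanishes at `s = τ = t`. The mean value inequality then shows that the charge has
derivative zero. -/
theorem norm_fn_const_of_isSolution {lam eta : ℝ} {u : ℝ → SigmaSpace}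
    (hs : IsSolution lam eta u) (hu : ∀ t, u t ∈ EvenSigma) (t : ℝ) :
    ‖(u t).fn‖ = ‖(u 0).fn‖ := by
  obtain ⟨hc, hd⟩ := (isSolution_iff hu).1 hs
  have key : ∀ t, HasDerivAt (fun s => ‖(u s).fn‖ ^ 2) 0 t := by
    intro t
    rw [hasDerivAt_iff_isLittleO, Asymptotics.isLittleO_iff]
    intro ε hε
    have hcont : Continuous fun p : ℝ × ℝ => (evenForm lam eta (u p.1 + u t) (u p.2)).im :=
      Complex.continuous_im.comp ((continuous_evenForm lam eta).comp
        (((hc.comp continuous_fst).add continuous_const).prodMk (hc.comp continuous_snd)))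
    have h0 := (Metric.continuous_iff.1 hcont) (t, t) ε hε
    obtain ⟨δ, hδ, hball⟩ := h0
    rw [evenForm_add_self_im] at hball
    filter_upwards [Metric.ball_mem_nhds t hδ] with s hs'
    have hder : ∀ τ ∈ Metric.ball t δ,
        HasDerivWithinAt (fun τ => (2 * Complex.I * inner ℂ (u s + u t).fn (u τ).fn).im)
          (evenForm lam eta (u s + u t) (u τ)).im (Metric.ball t δ) τ := fun τ _ =>
      ((Complex.imCLM.hasFDerivAt.comp_hasDerivAt τ (hd (u s + u t) τ))).hasDerivWithinAt
    have hb : ∀ τ ∈ Metric.ball t δ, ‖(evenForm lam eta (u s + u t) (u τ)).im‖ ≤ ε := by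
      intro τ hτ
      have := hball (s, τ) (by
        rw [Prod.dist_eq]
        exact max_lt hs' hτ)
      rw [Real.dist_eq, sub_zero] at this
      exact this.le
    have hmv := (convex_ball t δ).norm_image_sub_le_of_norm_hasDerivWithin_le hder hb
      (Metric.mem_ball_self hδ) hs'
    have e : ∀ τ, (2 * Complex.I * inner ℂ (u s + u t).fn (u τ).fn).im
        = 2 * (inner ℂ (u s).fn (u τ).fn).re + 2 * (inner ℂ (u t).fn (u τ).fn).re := by
      intro τ
      rw [SigmaSpace.fn_add, inner_add_left]
      simp [Complex.mul_im]
      ring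
    rw [e, e] at hmv
    have h1 : ∀ w : L2, (inner ℂ w w).re = ‖w‖ ^ 2 := fun w => inner_self_eq_norm_sq (𝕜 := ℂ) w
    have h2 : (inner ℂ (u t).fn (u s).fn).re = (inner ℂ (u s).fn (u t).fn).re :=
      inner_re_symm (𝕜 := ℂ) _ _
    rw [h1, h1, h2] at hmv
    rw [smul_zero, sub_zero]
    have e3 : 2 * ‖(u s).fn‖ ^ 2 + 2 * (inner ℂ (u s).fn (u t).fn).re
        - (2 * (inner ℂ (u s).fn (u t).fn).re + 2 * ‖(u t).fn‖ ^ 2)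
        = 2 * (‖(u s).fn‖ ^ 2 - ‖(u t).fn‖ ^ 2) := by ring
    rw [e3, norm_mul, Real.norm_two] at hmv
    nlinarith [norm_nonneg (‖(u s).fn‖ ^ 2 - ‖(u t).fn‖ ^ 2)]
  have hconst := is_const_of_deriv_eq_zero (fun t => (key t).differentiableAt)
    (fun t => (key t).deriv) t 0
  exact (sq_eq_sq₀ (norm_nonneg _) (norm_nonneg _)).1 hconst

/-- The phase generated by the term `eta ‖x u‖² u`. -/
def gaugePhase (eta : ℝ) (u : ℝ → SigmaSpace) (t : ℝ) : ℝ :=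
  ∫ s in (0 : ℝ)..t, eta / 2 * ‖(u s).mulX‖ ^ 2

theorem hasDerivAt_gaugePhase (eta : ℝ) {u : ℝ → SigmaSpace} (hu : Continuous u) (t : ℝ) :
    HasDerivAt (gaugePhase eta u) (eta / 2 * ‖(u t).mulX‖ ^ 2) t := by
  have hc : Continuous fun s => eta / 2 * ‖(u s).mulX‖ ^ 2 := by
    have := SigmaSpace.continuous_mulX.comp hu
    simp only [Function.comp_def] at this
    fun_prop
  exact intervalIntegral.integral_hasDerivAt_right (hc.intervalIntegrable _ _)
    (hc.stronglyMeasurableAtFilter _ _) hc.continuousAt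

theorem gaugePhase_zero (eta : ℝ) (u : ℝ → SigmaSpace) : gaugePhase eta u 0 = 0 :=
  intervalIntegral.integral_same

theorem norm_exp_smul (s : ℝ) {E : Type*} [NormedAddCommGroup E] [NormedSpace ℂ E] (w : E) :
    ‖Complex.exp (Complex.I * s) • w‖ = ‖w‖ := by
  rw [norm_smul, mul_comm Complex.I, Complex.norm_exp_ofReal_mul_I, one_mul]

/-- The solution of the Cauchy problem for even data `u₀` if `a² = lam + eta ‖u₀‖²`. -/
def evenSolution (eta : ℝ) {a : ℝ} (ha : 0 < a) (u₀ : SigmaSpace) (t : ℝ) : SigmaSpace :=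
  Complex.exp (Complex.I * (-gaugePhase eta (fun s => oscFlow ha s u₀) t : ℝ)) • oscFlow ha t u₀

theorem evenSolution_even (eta : ℝ) {a : ℝ} (ha : 0 < a) {u₀ : SigmaSpace} (h : u₀ ∈ EvenSigma)
    (t : ℝ) : evenSolution eta ha u₀ t ∈ EvenSigma :=
  EvenSigma.smul_mem _ (oscFlow_mem_even ha t h)

theorem evenSolution_zero (eta : ℝ) {a : ℝ} (ha : 0 < a) (u₀ : SigmaSpace) :
    evenSolution eta ha u₀ 0 = u₀ := by
  simp [evenSolution, gaugePhase_zero, oscFlow_zero]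

theorem isSolution_evenSolution {lam eta a : ℝ} (ha : 0 < a) {u₀ : SigmaSpace}
    (h : u₀ ∈ EvenSigma) (hM : a ^ 2 = lam + eta * ‖u₀.fn‖ ^ 2) :
    IsSolution lam eta (evenSolution eta ha u₀) := by
  rw [isSolution_iff (evenSolution_even eta ha h)]
  have hV := continuous_oscFlow ha u₀
  have hg := hasDerivAt_gaugePhase eta hV
  have hgc : Continuous (gaugePhase eta fun s => oscFlow ha s u₀) :=
    continuous_iff_continuousAt.2 fun t => (hg t).continuousAt
  refine ⟨by unfold evenSolution; fun_prop, fun w t => ?_⟩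
  set g := gaugePhase eta fun s => oscFlow ha s u₀ with hgdef
  have hfn : (evenSolution eta ha u₀ t).fn
      = Complex.exp (Complex.I * (-g t : ℝ)) • (oscFlow ha t u₀).fn := rfl
  have hmx : (evenSolution eta ha u₀ t).mulX
      = Complex.exp (Complex.I * (-g t : ℝ)) • (oscFlow ha t u₀).mulX := rfl
  -- Flow and phase both preserve the `L²` norm, so the frequency fixed by the datum is the right
  -- one at all times.
  have hM' : a ^ 2 = lam + eta * ‖(evenSolution eta ha u₀ t).fn‖ ^ 2 := by
    rw [hfn, norm_exp_smul, norm_oscFlow_fn, hM]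
  rw [evenForm_eq_oscForm hM']
  have e : (fun τ => 2 * Complex.I * inner ℂ w.fn (evenSolution eta ha u₀ τ).fn)
      = fun τ => Complex.exp (Complex.I * (-g τ : ℝ))
        * (2 * Complex.I * inner ℂ w.fn (oscFlow ha τ u₀).fn) := by
    ext τ
    have : (evenSolution eta ha u₀ τ).fn
      = Complex.exp (Complex.I * (-g τ : ℝ)) • (oscFlow ha τ u₀).fn := rfl
    rw [this, inner_smul_right]
    ring
  rw [e]
  have h1 : HasDerivAt (fun τ => Complex.exp (Complex.I * (-g τ : ℝ)))
      (Complex.exp (Complex.I * (-g t : ℝ))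
        * (Complex.I * (-(eta / 2 * ‖(oscFlow ha t u₀).mulX‖ ^ 2) : ℝ))) t :=
    (((hg t).neg.ofReal_comp).const_mul Complex.I).cexp
  refine (h1.mul (hasDerivAt_oscFlow ha u₀ w t)).congr_deriv ?_
  rw [hmx, norm_exp_smul, hfn, inner_smul_right, evenSolution, oscForm_smul_right]
  push_cast
  linear_combination (-(Complex.exp (Complex.I * -(g t : ℂ))) * eta
    * (‖(oscFlow ha t u₀).mulX‖ : ℂ) ^ 2 * inner ℂ w.fn (oscFlow ha t u₀).fn) * Complex.I_sq

/-- Conservation of charge turns the equation into one with a constant frequency `a`. Each Hermite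
coefficient then solves a scalar linear equation, integrated by an explicit factor. -/
theorem eq_evenSolution {lam eta a : ℝ} (ha : 0 < a) {v : ℝ → SigmaSpace}
    (hs : IsSolution lam eta v) (hv : ∀ t, v t ∈ EvenSigma)
    (hM : a ^ 2 = lam + eta * ‖(v 0).fn‖ ^ 2) : v = evenSolution eta ha (v 0) := by
  obtain ⟨hc, hd⟩ := (isSolution_iff hv).1 hs
  have hM' : ∀ t, a ^ 2 = lam + eta * ‖(v t).fn‖ ^ 2 := fun t => by
    rw [norm_fn_const_of_isSolution hs hv, hM]
  have hg := hasDerivAt_gaugePhase eta hc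
  set g := gaugePhase eta v with hgdef
  have hco : ∀ (j : ℕ) (t : ℝ), inner ℂ (hermiteFn a j).fn (v t).fn
      = Complex.exp (Complex.I * (-g t : ℝ)) * (Complex.exp ((-(a * (2 * j + 1)) * t / 2 : ℝ)
        * Complex.I) * inner ℂ (hermiteFn a j).fn (v 0).fn) := by
    intro j t
    set E : ℝ := a * (2 * j + 1) with hE
    set c : ℝ → ℂ := fun t => inner ℂ (hermiteFn a j).fn (v t).fn with hcdef
    have h1 : ∀ t, HasDerivAt (fun τ => 2 * Complex.I * c τ)
        ((E + eta * ‖(v t).mulX‖ ^ 2 : ℝ) * c t) t := fun t => by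
      refine (hd (hermiteFn a j) t).congr_deriv ?_
      rw [evenForm_eq_oscForm (hM' t), oscForm_hermiteFn ha]
      simp only [hcdef, hE]
      push_cast
      ring
    have h2 : ∀ t, HasDerivAt (fun τ : ℝ => Complex.exp (Complex.I * (E * τ / 2 + g τ : ℝ)))
        (Complex.exp (Complex.I * (E * t / 2 + g t : ℝ))
          * (Complex.I * (E / 2 + eta / 2 * ‖(v t).mulX‖ ^ 2 : ℝ))) t := fun t => by
      have h3 : HasDerivAt (fun τ : ℝ => E * τ / 2) (E / 2) t := by
        simpa using ((hasDerivAt_id t).const_mul E).div_const 2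
      exact ((((h3.add (hg t)).ofReal_comp).const_mul Complex.I).cexp)
    have h4 : ∀ t, HasDerivAt (fun τ : ℝ => Complex.exp (Complex.I * (E * τ / 2 + g τ : ℝ))
        * (2 * Complex.I * c τ)) 0 t := fun t => by
      refine ((h2 t).mul (h1 t)).congr_deriv ?_
      push_cast
      linear_combination (Complex.exp (Complex.I * (E * t / 2 + g t)) * c t
        * (E + eta * (‖(v t).mulX‖ : ℂ) ^ 2)) * Complex.I_sq
    have h5 := is_const_of_deriv_eq_zero (fun t => (h4 t).differentiableAt)
      (fun t => (h4 t).deriv) t 0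
    have h6 : g 0 = 0 := gaugePhase_zero _ _
    simp only [h6, mul_zero, zero_div, add_zero, Complex.ofReal_zero, Complex.exp_zero,
      one_mul] at h5
    have h7 : Complex.exp (Complex.I * (E * t / 2 + g t : ℝ)) * c t = c 0 := by
      refine mul_left_cancel₀ (mul_ne_zero two_ne_zero Complex.I_ne_zero) ?_
      rw [← h5]
      ring
    change c t = _ * (_ * c 0)
    rw [← h7, ← mul_assoc, ← mul_assoc, ← Complex.exp_add, ← Complex.exp_add]
    have h8 : Complex.I * (-g t : ℝ) + (-E * t / 2 : ℝ) * Complex.I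
        + Complex.I * (E * t / 2 + g t : ℝ) = 0 := by
      push_cast
      ring
    rw [h8, Complex.exp_zero, one_mul]
  have heq : ∀ t, v t = Complex.exp (Complex.I * (-g t : ℝ)) • oscFlow ha t (v 0) := by
    intro t
    refine SigmaSpace.ext_fn (sub_eq_zero.1 (hermiteFn_total ha fun j => ?_))
    rw [inner_sub_right, SigmaSpace.fn_smul, inner_smul_right, inner_hermiteFn_oscFlow, hco,
      sub_self]
  -- The phase was defined through `v` itself, but `v s` and the linear flow differ by a unimodular
  -- factor. Hence `‖x v‖`, and with it the phase, depends on the datum only.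
  have hgg : g = gaugePhase eta fun s => oscFlow ha s (v 0) := by
    ext t
    simp only [hgdef, gaugePhase]
    congr 1
    ext s
    have : ‖(v s).mulX‖ = ‖(oscFlow ha s (v 0)).mulX‖ := by
      conv_lhs => rw [heq s]
      rw [SigmaSpace.mulX_smul, norm_exp_smul]
    rw [this]
  ext t : 1
  rw [heq t, hgg]
  rfl

/-! ### Orbital stability -/

/-- A smooth enough family of bound states, one for each frequency `a`, consists of stable standing
waves. -/
theorem isStable_of_continuousAt {lam eta ω a : ℝ} (ha : 0 < a) {n : ℕ} {amp : ℝ → ℝ}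
    (hn : ∀ b, hermiteFn b n ∈ EvenSigma)
    (hc : ContinuousAt (fun b => amp b • hermiteFn b n) a)
    (hM : a ^ 2 = lam + eta * ‖(amp a • hermiteFn a n).fn‖ ^ 2)
    (hω : ω = a * (2 * n + 1) + eta * ‖(amp a • hermiteFn a n).mulX‖ ^ 2) :
    IsStable lam eta ω (amp a • hermiteFn a n) := by
  set ψ : ℝ → SigmaSpace := fun b => amp b • hermiteFn b n with hψ
  set φ := ψ a with hφdef
  have hφe : φ ∈ EvenSigma := EvenSigma.real_smul_mem _ (hn a)
  have hform : ∀ h, evenForm lam eta h φ = ω * inner ℂ h.fn φ.fn := by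
    intro h
    have h1 : oscForm a φ h = (a * (2 * n + 1) : ℝ) * inner ℂ φ.fn h.fn := by
      have e : φ = (amp a : ℂ) • hermiteFn a n := (Complex.coe_smul _ _).symm
      rw [e, oscForm_smul_left, oscForm_hermiteFn ha, SigmaSpace.fn_smul, inner_smul_left]
      ring
    have h2 : oscForm a h φ = starRingEnd ℂ (oscForm a φ h) := by
      simp [oscForm, inner_conj_symm]
    rw [evenForm_eq_oscForm hM, h2, h1, map_mul, Complex.conj_ofReal, inner_conj_symm, hω]
    push_cast
    ring
  refine ⟨hφe, ?_, ?_⟩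
  · have hee : ∀ t, standingWave ω φ t ∈ EvenSigma := fun t => EvenSigma.smul_mem _ hφe
    rw [isSolution_iff hee]
    refine ⟨by unfold standingWave; fun_prop, fun h t => ?_⟩
    have hsw : ∀ τ : ℝ, standingWave ω φ τ
        = Complex.exp (Complex.I * (-(ω * τ / 2) : ℝ)) • φ := fun τ => by
      rw [standingWave]
      congr 2
      push_cast
      ring
    have h1 : HasDerivAt (fun τ : ℝ => Complex.exp (Complex.I * (-(ω * τ / 2) : ℝ)))
        (Complex.exp (Complex.I * (-(ω * t / 2) : ℝ)) * (Complex.I * (-(ω / 2) : ℝ))) t := by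
      have h3 : HasDerivAt (fun τ : ℝ => ω * τ / 2) (ω / 2) t := by
        simpa using ((hasDerivAt_id t).const_mul ω).div_const 2
      exact ((h3.neg.ofReal_comp).const_mul Complex.I).cexp
    have hf : evenForm lam eta h (standingWave ω φ t)
        = Complex.exp (Complex.I * (-(ω * t / 2) : ℝ)) * evenForm lam eta h φ := by
      rw [hsw]
      simp only [evenForm, SigmaSpace.fn_smul, SigmaSpace.der_smul, SigmaSpace.mulX_smul,
        norm_exp_smul, inner_smul_right]
      ring
    rw [hf, hform]
    have e : (fun τ => 2 * Complex.I * inner ℂ h.fn (standingWave ω φ τ).fn)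
        = fun τ : ℝ => Complex.exp (Complex.I * (-(ω * τ / 2) : ℝ))
          * (2 * Complex.I * inner ℂ h.fn φ.fn) := by
      ext τ
      rw [hsw, SigmaSpace.fn_smul, inner_smul_right]
      ring
    rw [e]
    refine (h1.mul_const _).congr_deriv ?_
    push_cast
    linear_combination (-(Complex.exp (Complex.I * -(ω * t / 2 : ℂ))) * ω
      * inner ℂ h.fn φ.fn) * Complex.I_sq
  · intro ε hε
    -- The oscillator frequency attached to a datum; by conservation of charge it does not change in
    -- time.
    set A : SigmaSpace → ℝ := fun u => √(lam + eta * ‖u.fn‖ ^ 2) with hA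
    have hAc : Continuous A := by
      have := SigmaSpace.continuous_fn
      simp only [hA]
      fun_prop
    have hAφ : A φ = a := by
      simp only [hA]
      rw [← hM, Real.sqrt_sq ha.le]
    have hψA : ContinuousAt (fun u => ψ (A u)) φ :=
      ContinuousAt.comp (f := A) (g := ψ) (by rw [hAφ]; exact hc) hAc.continuousAt
    -- A bound, valid at all times, for the distance to the orbit: the uniform flow bound applied to
    -- the deviation from the profile of the same frequency, plus the displacement of that profile
    -- from `φ`.
    set F : SigmaSpace → ℝ := fun u =>
      (1 + (A u)⁻¹) * (1 + A u) * ‖u - ψ (A u)‖ + ‖φ - ψ (A u)‖ with hF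
    have hFc : ContinuousAt F φ := by
      have h1 : ContinuousAt (fun u => (A u)⁻¹) φ :=
        hAc.continuousAt.inv₀ (by rw [hAφ]; exact ha.ne')
      exact (((continuousAt_const.add h1).mul (continuousAt_const.add hAc.continuousAt)).mul
        (continuousAt_id.sub hψA).norm).add (continuousAt_const.sub hψA).norm
    have hF0 : F φ = 0 := by
      simp only [hF]
      rw [hAφ, ← hφdef]
      simp
    have hev : ∀ᶠ u in 𝓝 φ, F u < ε ∧ 0 < A u :=
      (hFc.eventually (gt_mem_nhds (by rw [hF0]; exact hε))).and
        (hAc.continuousAt.eventually (lt_mem_nhds (by rw [hAφ]; exact ha)))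
    obtain ⟨δ, hδ, hball⟩ := Metric.eventually_nhds_iff.1 hev
    refine ⟨δ, hδ, fun u₀ hu₀ hdist => ?_⟩
    obtain ⟨hFlt, hA0⟩ := hball (by rwa [dist_eq_norm])
    have hM0 : (A u₀) ^ 2 = lam + eta * ‖u₀.fn‖ ^ 2 := Real.sq_sqrt (Real.sqrt_pos.1 hA0).le
    refine ⟨evenSolution eta hA0 u₀, ⟨isSolution_evenSolution hA0 hu₀ hM0,
      evenSolution_even eta hA0 hu₀, evenSolution_zero eta hA0 u₀⟩, fun v hv hve hv0 => ?_,
      fun t _ => ?_⟩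
    · have := eq_evenSolution hA0 hv hve (by rw [hv0]; exact hM0)
      rwa [hv0] at this
    · set b := A u₀ with hb
      set g := gaugePhase eta (fun s => oscFlow hA0 s u₀) t with hg
      -- This phase undoes the gauge phase of the solution and the rotation of the profile `ψ b`
      -- under the oscillator group of frequency `b`.
      refine ⟨g + b * (2 * n + 1) * t / 2, ?_⟩
      have e1 : Complex.exp (Complex.I * (g + b * (2 * n + 1) * t / 2 : ℝ))
            • evenSolution eta hA0 u₀ t
          = Complex.exp (Complex.I * (b * (2 * n + 1) * t / 2 : ℝ)) • oscFlow hA0 t u₀ := by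
        rw [evenSolution, smul_smul, ← Complex.exp_add]
        congr 2
        push_cast
        ring
      have e2 : ψ b = Complex.exp (Complex.I * (b * (2 * n + 1) * t / 2 : ℝ))
          • oscFlow hA0 t (ψ b) := by
        have : oscFlow hA0 t (ψ b) = _ := oscFlow_eigen hA0 t n (amp b)
        rw [this, smul_smul, ← Complex.exp_add]
        have h0 : Complex.I * (b * (2 * n + 1) * t / 2 : ℝ)
            + (-(b * (2 * n + 1)) * t / 2 : ℝ) * Complex.I = 0 := by
          push_cast
          ring
        rw [h0, Complex.exp_zero, one_smul]
      have e3 : φ - Complex.exp (Complex.I * (g + b * (2 * n + 1) * t / 2 : ℝ))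
            • evenSolution eta hA0 u₀ t
          = (φ - ψ b) - Complex.exp (Complex.I * (b * (2 * n + 1) * t / 2 : ℝ))
            • oscFlow hA0 t (u₀ - ψ b) := by
        rw [e1, oscFlow_sub, smul_sub, ← e2]
        abel
      rw [e3]
      calc _ ≤ ‖φ - ψ b‖ + ‖Complex.exp (Complex.I * (b * (2 * n + 1) * t / 2 : ℝ))
            • oscFlow hA0 t (u₀ - ψ b)‖ := norm_sub_le _ _
        _ ≤ ‖φ - ψ b‖ + (1 + b⁻¹) * (1 + b) * ‖u₀ - ψ b‖ := by
          refine add_le_add le_rfl ?_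
          exact (norm_exp_smul _ _).le.trans (norm_oscFlow_le hA0 t _)
        _ = F u₀ := add_comm _ _
        _ < ε := hFlt

/-! ### First and second derivatives of the action -/

/-- The real inner product `Re (f, g)` of `L²`. -/
def reInner : L2 →L[ℝ] L2 →L[ℝ] ℝ :=
  LinearMap.mkContinuous₂ (LinearMap.mk₂ ℝ (fun f g : L2 => (inner ℂ f g).re)
    (fun f g h => by rw [inner_add_left, Complex.add_re])
    (fun c f g => by rw [inner_smul_left_eq_smul, Complex.smul_re])
    (fun f g h => by rw [inner_add_right, Complex.add_re])
    (fun c f g => by rw [inner_smul_right_eq_smul, Complex.smul_re])) 1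
    (fun f g => by
      rw [one_mul]
      exact (Complex.abs_re_le_norm _).trans (norm_inner_le_norm f g))

theorem reInner_comm (f g : L2) : reInner f g = reInner g f := inner_re_symm (𝕜 := ℂ) f g

theorem reInner_self (f : L2) : reInner f f = ‖f‖ ^ 2 := inner_self_eq_norm_sq (𝕜 := ℂ) f

/-- `Re (u, v)` as a continuous bilinear form on `Σ`. -/
def formFn : SigmaSpace →L[ℝ] SigmaSpace →L[ℝ] ℝ :=
  reInner.bilinearComp (SigmaSpace.fnL.restrictScalars ℝ) (SigmaSpace.fnL.restrictScalars ℝ)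

/-- `Re (u', v')` as a continuous bilinear form on `Σ`. -/
def formDer : SigmaSpace →L[ℝ] SigmaSpace →L[ℝ] ℝ :=
  reInner.bilinearComp (SigmaSpace.derL.restrictScalars ℝ) (SigmaSpace.derL.restrictScalars ℝ)

/-- `Re (x u, x v)` as a continuous bilinear form on `Σ`. -/
def formMulX : SigmaSpace →L[ℝ] SigmaSpace →L[ℝ] ℝ :=
  reInner.bilinearComp (SigmaSpace.mulXL.restrictScalars ℝ) (SigmaSpace.mulXL.restrictScalars ℝ)

/-- `Re (u, x v)` as a continuous bilinear form on `Σ`. -/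
def formMoment : SigmaSpace →L[ℝ] SigmaSpace →L[ℝ] ℝ :=
  reInner.bilinearComp (SigmaSpace.fnL.restrictScalars ℝ) (SigmaSpace.mulXL.restrictScalars ℝ)

theorem formFn_apply (u v : SigmaSpace) : formFn u v = (inner ℂ u.fn v.fn).re := rfl
theorem formMoment_apply (u v : SigmaSpace) : formMoment u v = (inner ℂ u.fn v.mulX).re := rfl

theorem formFn_comm (u v : SigmaSpace) : formFn u v = formFn v u := reInner_comm _ _
theorem formDer_comm (u v : SigmaSpace) : formDer u v = formDer v u := reInner_comm _ _
theorem formMulX_comm (u v : SigmaSpace) : formMulX u v = formMulX v u := reInner_comm _ _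

theorem formMoment_comm (u v : SigmaSpace) : formMoment u v = formMoment v u := by
  rw [formMoment_apply, ← SigmaSpace.inner_mulX_comm]
  exact inner_re_symm (𝕜 := ℂ) _ _

theorem formMoment_even {u v : SigmaSpace} (hu : u ∈ EvenSigma) (hv : v ∈ EvenSigma) :
    formMoment u v = 0 := by
  rw [formMoment_apply, SigmaSpace.inner_fn_mulX_even hu hv, Complex.zero_re]

section Quartic

variable {E : Type*} [NormedAddCommGroup E] [NormedSpace ℝ E]

theorem ContinuousLinearMap.hasFDerivAt_quadratic (b : E →L[ℝ] E →L[ℝ] ℝ)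
    (hb : ∀ u v, b u v = b v u) (u : E) : HasFDerivAt (fun u => b u u) ((2 : ℝ) • b u) u := by
  refine (b.hasFDerivAt.clm_apply (hasFDerivAt_id u)).congr_fderiv ?_
  ext v
  simp [hb v u, two_mul]

variable (L A B C : E →L[ℝ] E →L[ℝ] ℝ) (eta : ℝ)

/-- The derivative of `u ↦ L u u / 2 + eta / 2 * (A u u * B u u - (C u u) ^ 2)`. -/
def quarticDeriv (u : E) : E →L[ℝ] ℝ :=
  L u + eta • (A u u • B u + B u u • A u - (2 * C u u) • C u)

variable {L A B C}

theorem hasFDerivAt_quartic (hL : ∀ u v, L u v = L v u) (hA : ∀ u v, A u v = A v u)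
    (hB : ∀ u v, B u v = B v u) (hC : ∀ u v, C u v = C v u) (u : E) :
    HasFDerivAt (fun u => 1 / 2 * L u u + eta / 2 * (A u u * B u u - C u u ^ 2))
      (quarticDeriv L A B C eta u) u := by
  have h := ((L.hasFDerivAt_quadratic hL u).const_mul (1 / 2)).add
    ((((A.hasFDerivAt_quadratic hA u).mul (B.hasFDerivAt_quadratic hB u)).sub
      ((C.hasFDerivAt_quadratic hC u).pow 2)).const_mul (eta / 2))
  refine h.congr_fderiv ?_
  ext v
  simp [quarticDeriv]
  ring

theorem fderiv_quarticDeriv_apply (hA : ∀ u v, A u v = A v u) (hB : ∀ u v, B u v = B v u)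
    (hC : ∀ u v, C u v = C v u) (u w h : E) :
    fderiv ℝ (quarticDeriv L A B C eta) u w h = L w h
      + eta * (2 * A u w * B u h + A u u * B w h + 2 * B u w * A u h + B u u * A w h
        - 4 * C u w * C u h - 2 * C u u * C w h) := by
  have hq := ((((A.hasFDerivAt_quadratic hA u).smul B.hasFDerivAt).add
    ((B.hasFDerivAt_quadratic hB u).smul A.hasFDerivAt)).sub
    (((C.hasFDerivAt_quadratic hC u).const_mul 2).smul C.hasFDerivAt)).const_smul eta
  have hd := (L.hasFDerivAt.add hq).congr_of_eventuallyEq (f₁ := quarticDeriv L A B C eta)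
    (Eventually.of_forall fun v => rfl)
  rw [hd.fderiv]
  simp
  left
  ring

end Quartic

theorem action_eq (lam eta ω : ℝ) (u : SigmaSpace) : action lam eta ω u
    = 1 / 2 * (formDer + lam • formMulX - ω • formFn) u u
      + eta / 2 * (formFn u u * formMulX u u - formMoment u u ^ 2) := by
  have h1 : formFn u u = ‖u.fn‖ ^ 2 := reInner_self _
  have h2 : formDer u u = ‖u.der‖ ^ 2 := reInner_self _
  have h3 : formMulX u u = ‖u.mulX‖ ^ 2 := reInner_self _
  have h4 : formMoment u u = u.moment := rfl
  have h5 : (formDer + lam • formMulX - ω • formFn) u u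
      = formDer u u + lam * formMulX u u - ω * formFn u u := rfl
  rw [action, SigmaSpace.energy_eq, charge, h5, h1, h2, h3, h4]
  ring

/-- The derivative of the action. -/
def actionDeriv (lam eta ω : ℝ) : SigmaSpace → SigmaSpace →L[ℝ] ℝ :=
  quarticDeriv (formDer + lam • formMulX - ω • formFn) formFn formMulX formMoment eta

theorem actionDeriv_apply (lam eta ω : ℝ) (u h : SigmaSpace) : actionDeriv lam eta ω u h
    = formDer u h + lam * formMulX u h - ω * formFn u h
      + eta * (formFn u u * formMulX u h + formMulX u u * formFn u h
        - 2 * formMoment u u * formMoment u h) := rfl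

theorem hasFDerivAt_action (lam eta ω : ℝ) (u : SigmaSpace) :
    HasFDerivAt (action lam eta ω) (actionDeriv lam eta ω u) u := by
  have hL : ∀ u v, (formDer + lam • formMulX - ω • formFn) u v
      = (formDer + lam • formMulX - ω • formFn) v u := fun u v => by
    have h5 : ∀ u v, (formDer + lam • formMulX - ω • formFn) u v
      = formDer u v + lam * formMulX u v - ω * formFn u v := fun _ _ => rfl
    rw [h5, h5, formDer_comm, formMulX_comm, formFn_comm]
  have h := hasFDerivAt_quartic eta hL formFn_comm formMulX_comm formMoment_comm u
  exact h.congr_of_eventuallyEq (Eventually.of_forall fun u => action_eq lam eta ω u)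

/-- The second derivative of the action. -/
theorem actionHess_apply (lam eta ω : ℝ) (u w h : SigmaSpace) : actionHess lam eta ω u w h
    = formDer w h + lam * formMulX w h - ω * formFn w h
      + eta * (2 * formFn u w * formMulX u h + formFn u u * formMulX w h
        + 2 * formMulX u w * formFn u h + formMulX u u * formFn w h
        - 4 * formMoment u w * formMoment u h - 2 * formMoment u u * formMoment w h) := by
  have e : fderiv ℝ (action lam eta ω) = actionDeriv lam eta ω :=
    funext fun v => (hasFDerivAt_action lam eta ω v).fderiv
  rw [actionHess, e]
  exact fderiv_quarticDeriv_apply eta formFn_comm formMulX_comm formMoment_comm u w h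

/-- The second derivative of the action at an even function, on even functions. -/
theorem actionHess_even {lam eta ω : ℝ} {u w h : SigmaSpace} (hu : u ∈ EvenSigma)
    (hw : w ∈ EvenSigma) : actionHess lam eta ω u w h
    = formDer w h + lam * formMulX w h - ω * formFn w h
      + eta * (2 * formFn u w * formMulX u h + formFn u u * formMulX w h
        + 2 * formMulX u w * formFn u h + formMulX u u * formFn w h) := by
  rw [actionHess_apply, formMoment_even hu hw, formMoment_even hu hu]
  ring

/-! ### Inertia of a symmetric map in finite dimension -/

section MorseIndex

variable {F : Type*} [NormedAddCommGroup F] [InnerProductSpace ℝ F] [FiniteDimensional ℝ F]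

theorem LinearMap.IsSymmetric.inner_eigenvectorBasis_eq_zero {T : F →ₗ[ℝ] F} (hT : T.IsSymmetric)
    (i : Fin (Module.finrank ℝ F)) {S : Set ℝ} (hS : hT.eigenvalues rfl i ∉ S) {w : F}
    (hw : w ∈ ⨆ μ : S, Module.End.eigenspace T (μ : ℝ)) :
    inner ℝ (hT.eigenvectorBasis rfl i) w = 0 := by
  have hle : ⨆ μ : S, Module.End.eigenspace T (μ : ℝ)
      ≤ LinearMap.ker (innerₛₗ ℝ (hT.eigenvectorBasis rfl i)) := by
    refine iSup_le fun μ v hv => ?_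
    rw [LinearMap.mem_ker, innerₛₗ_apply_apply]
    have h1 := hT (hT.eigenvectorBasis rfl i) v
    rw [Module.End.mem_eigenspace_iff.1 hv, hT.apply_eigenvectorBasis, inner_smul_left,
      inner_smul_right] at h1
    have h2 : hT.eigenvalues rfl i ≠ μ := fun h => hS (h ▸ μ.2)
    simp only [RCLike.ofReal_real_eq_id, id_eq, conj_trivial] at h1
    have h3 : (hT.eigenvalues rfl i - μ) * inner ℝ (hT.eigenvectorBasis rfl i) v = 0 := by
      rw [sub_mul, h1, sub_self]
    exact (mul_eq_zero.1 h3).resolve_left (sub_ne_zero.2 h2)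
  exact hle hw

theorem LinearMap.IsSymmetric.inner_apply_self_eq_sum {T : F →ₗ[ℝ] F} (hT : T.IsSymmetric)
    (w : F) : inner ℝ (T w) w
      = ∑ i, hT.eigenvalues rfl i * inner ℝ (hT.eigenvectorBasis rfl i) w ^ 2 := by
  rw [← (hT.eigenvectorBasis rfl).sum_inner_mul_inner]
  refine Finset.sum_congr rfl fun i _ => ?_
  rw [hT, hT.apply_eigenvectorBasis, inner_smul_right, real_inner_comm]
  simp only [RCLike.ofReal_real_eq_id, id_eq]
  ring

/-- The number of negative eigenvalues of a symmetric map is determined by two subspaces, one where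
its quadratic form is negative definite and one where it is nonnegative, of complementary
dimensions. -/
theorem LinearMap.IsSymmetric.finrank_iSup_eigenspace_neg {T : F →ₗ[ℝ] F} (hT : T.IsSymmetric)
    {G₁ G₂ : Type*} [AddCommGroup G₁] [Module ℝ G₁] [FiniteDimensional ℝ G₁]
    [AddCommGroup G₂] [Module ℝ G₂] [FiniteDimensional ℝ G₂]
    (L₁ : F →ₗ[ℝ] G₁) (L₂ : F →ₗ[ℝ] G₂)
    (hd : Module.finrank ℝ F = Module.finrank ℝ G₁ + Module.finrank ℝ G₂)
    (h₁ : ∀ w, L₁ w = 0 → w ≠ 0 → inner ℝ (T w) w < 0)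
    (h₂ : ∀ w, L₂ w = 0 → 0 ≤ inner ℝ (T w) w) :
    Module.finrank ℝ ↥(⨆ μ : Iio (0 : ℝ), Module.End.eigenspace T (μ : ℝ))
      = Module.finrank ℝ G₂ := by
  set N := ⨆ μ : Iio (0 : ℝ), Module.End.eigenspace T (μ : ℝ) with hN
  set P := ⨆ μ : Ici (0 : ℝ), Module.End.eigenspace T (μ : ℝ) with hP
  have hNneg : ∀ w ∈ N, w ≠ 0 → inner ℝ (T w) w < 0 := by
    intro w hw hw0
    rw [hT.inner_apply_self_eq_sum]
    have hle : ∀ i ∈ Finset.univ, hT.eigenvalues rfl i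
        * inner ℝ (hT.eigenvectorBasis rfl i) w ^ 2 ≤ 0 := by
      intro i _
      by_cases hi : hT.eigenvalues rfl i < 0
      · exact mul_nonpos_of_nonpos_of_nonneg hi.le (sq_nonneg _)
      · rw [hT.inner_eigenvectorBasis_eq_zero i hi hw]
        simp
    refine lt_of_le_of_ne (Finset.sum_nonpos hle) fun h0 => hw0 ?_
    have h := (Finset.sum_eq_zero_iff_of_nonpos hle).1 h0
    refine (hT.eigenvectorBasis rfl).repr.injective ?_
    rw [map_zero]
    ext i
    rw [OrthonormalBasis.repr_apply_apply, PiLp.zero_apply]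
    by_cases hi : hT.eigenvalues rfl i < 0
    · exact (pow_eq_zero_iff two_ne_zero).1
        ((mul_eq_zero.1 (h i (Finset.mem_univ i))).resolve_left hi.ne)
    · exact hT.inner_eigenvectorBasis_eq_zero i hi hw
  have hPpos : ∀ w ∈ P, 0 ≤ inner ℝ (T w) w := by
    intro w hw
    rw [hT.inner_apply_self_eq_sum]
    refine Finset.sum_nonneg fun i _ => ?_
    by_cases hi : 0 ≤ hT.eigenvalues rfl i
    · positivity
    · rw [hT.inner_eigenvectorBasis_eq_zero i hi hw]
      simp
  have htop : N ⊔ P = ⊤ := by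
    rw [eq_top_iff, ← (hT.eigenvectorBasis rfl).toBasis.span_eq, Submodule.span_le]
    rintro _ ⟨i, rfl⟩
    rw [OrthonormalBasis.coe_toBasis]
    have hmem : hT.eigenvectorBasis rfl i ∈ Module.End.eigenspace T (hT.eigenvalues rfl i) := by
      rw [Module.End.mem_eigenspace_iff, hT.apply_eigenvectorBasis]
      simp
    rcases lt_or_ge (hT.eigenvalues rfl i) 0 with hi | hi
    · exact Submodule.mem_sup_left (Submodule.mem_iSup_of_mem ⟨_, hi⟩ hmem)
    · exact Submodule.mem_sup_right (Submodule.mem_iSup_of_mem ⟨_, hi⟩ hmem)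
  -- On `N` the form is negative and on the kernel of `L₂` it is nonnegative, so `L₂` is injective
  -- on `N`. In the same way `L₁` is injective on `P`. As `N` and `P` span everything, `hd` forces
  -- equality in both bounds.
  have hNle : Module.finrank ℝ N ≤ Module.finrank ℝ G₂ := by
    refine LinearMap.finrank_le_finrank_of_injective (f := L₂.comp N.subtype) ?_
    rw [← LinearMap.ker_eq_bot, LinearMap.ker_eq_bot']
    intro w hw
    by_contra hne
    exact absurd (h₂ w hw) (not_le.2 (hNneg w w.2 fun h => hne (Subtype.ext h)))
  have hPle : Module.finrank ℝ P ≤ Module.finrank ℝ G₁ := by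
    refine LinearMap.finrank_le_finrank_of_injective (f := L₁.comp P.subtype) ?_
    rw [← LinearMap.ker_eq_bot, LinearMap.ker_eq_bot']
    intro w hw
    by_contra hne
    exact absurd (h₁ w hw fun h => hne (Subtype.ext h)) (not_lt.2 (hPpos w w.2))
  have := Submodule.finrank_add_le_finrank_add_finrank N P
  rw [htop, finrank_top] at this
  omega

end MorseIndex

/-! ### The second derivative at a bound state in Hermite coordinates -/

/-- The coefficient of the `2 j`-th Hermite function in `x²` times the `2 k`-th one. -/
def xSqCoeff (a : ℝ) (k j : ℕ) : ℝ :=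
  if j = k + 1 then stepCoeff a (2 * k + 1) * stepCoeff a (2 * k + 2)
  else if j = k then (4 * k + 1) / (2 * a)
  else if j + 1 = k then stepCoeff a (2 * k) * stepCoeff a (2 * k - 1)
  else 0

theorem xSqCoeff_succ (a : ℝ) (k : ℕ) : xSqCoeff a k (k + 1)
    = stepCoeff a (2 * k + 1) * stepCoeff a (2 * k + 2) := if_pos rfl

theorem xSqCoeff_self (a : ℝ) (k : ℕ) : xSqCoeff a k k = (4 * k + 1) / (2 * a) := by
  simp [xSqCoeff]

theorem xSqCoeff_of_lt (a : ℝ) {k j : ℕ} (h : j < k) : xSqCoeff a k j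
    = if j + 1 = k then stepCoeff a (2 * k) * stepCoeff a (2 * k - 1) else 0 := by
  rw [xSqCoeff, if_neg (by omega), if_neg (by omega)]

/-- Below the diagonal only `j = k - 1` contributes. For `k = 0` the sum is empty, and the right
side vanishes because `stepCoeff a 0 = 0`. -/
theorem sum_xSqCoeff_lt (a : ℝ) (k : ℕ) (f : ℝ → ℝ) (hf : f 0 = 0) (g : ℕ → ℝ) :
    ∑ j ∈ Finset.range k, f (xSqCoeff a k j) * g j
      = f (stepCoeff a (2 * k) * stepCoeff a (2 * k - 1)) * g (k - 1) := by
  cases k with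
  | zero => simp [stepCoeff_zero, hf]
  | succ k =>
    rw [Finset.sum_range_succ, Finset.sum_eq_zero, zero_add, xSqCoeff_of_lt a k.lt_succ_self,
      if_pos rfl, Nat.add_sub_cancel]
    intro j hj
    have := Finset.mem_range.1 hj
    rw [xSqCoeff_of_lt a (by omega), if_neg (by omega), hf, zero_mul]

theorem inner_hermiteFn_mulX_even {a : ℝ} (ha : 0 < a) (k : ℕ) (v : SigmaSpace) :
    (inner ℂ (hermiteFn a (2 * k)).mulX v.mulX).re
      = ∑ j : Fin (k + 2), xSqCoeff a k j * (inner ℂ (hermiteFn a (2 * j)).fn v.fn).re := by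
  rw [Fin.sum_univ_eq_sum_range
    (fun j => xSqCoeff a k j * (inner ℂ (hermiteFn a (2 * j)).fn v.fn).re) (k + 2),
    Finset.sum_range_succ, Finset.sum_range_succ, xSqCoeff_succ, xSqCoeff_self]
  have h := sum_xSqCoeff_lt a k id rfl fun j => (inner ℂ (hermiteFn a (2 * j)).fn v.fn).re
  simp only [id_eq] at h
  rw [h, inner_hermiteFn_mulX ha]
  simp only [Complex.add_re, Complex.re_ofReal_mul]
  have e1 : 2 * (k + 1) = 2 * k + 2 := by ring
  have e2 : 2 * (k - 1) = 2 * k - 2 := by omega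
  rw [e1, e2]
  push_cast
  ring

/-- The bound state with amplitude `c` in the `2 k`-th Hermite function of frequency `a`. -/
def boundState (a c : ℝ) (k : ℕ) : SigmaSpace := c • hermiteFn a (2 * k)

theorem boundState_even (a c : ℝ) (k : ℕ) : boundState a c k ∈ EvenSigma :=
  EvenSigma.real_smul_mem _ (hermiteFn_even a k)

theorem formFn_boundState (a c : ℝ) (k : ℕ) (v : SigmaSpace) :
    formFn (boundState a c k) v = c * (inner ℂ (hermiteFn a (2 * k)).fn v.fn).re := by
  rw [boundState, map_smul]
  rfl

theorem formMulX_boundState {a : ℝ} (ha : 0 < a) (c : ℝ) (k : ℕ) (v : SigmaSpace) :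
    formMulX (boundState a c k) v
      = c * ∑ j : Fin (k + 2), xSqCoeff a k j * (inner ℂ (hermiteFn a (2 * j)).fn v.fn).re := by
  rw [boundState, map_smul, ← inner_hermiteFn_mulX_even ha]
  rfl

theorem formFn_boundState_self {a : ℝ} (ha : 0 < a) (c : ℝ) (k : ℕ) :
    formFn (boundState a c k) (boundState a c k) = c ^ 2 := by
  rw [formFn_boundState, boundState]
  have : (c • hermiteFn a (2 * k)).fn = c • (hermiteFn a (2 * k)).fn := rfl
  rw [this, inner_smul_right_eq_smul, inner_hermiteFn ha]
  simp
  ring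

theorem re_oscForm (a : ℝ) (u v : SigmaSpace) :
    (oscForm a u v).re = formDer u v + a ^ 2 * formMulX u v := by
  rw [oscForm, Complex.add_re, ← Complex.ofReal_pow, Complex.re_ofReal_mul]
  rfl

theorem re_oscForm_comm (a : ℝ) (u v : SigmaSpace) : (oscForm a u v).re = (oscForm a v u).re := by
  rw [re_oscForm, re_oscForm, formDer_comm, formMulX_comm]

theorem re_oscForm_smul_hermiteFn {a : ℝ} (ha : 0 < a) (z : ℂ) (n : ℕ) (v : SigmaSpace) :
    (oscForm a (z • hermiteFn a n) v).re = a * (2 * n + 1) * formFn (z • hermiteFn a n) v := by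
  rw [oscForm_smul_left, oscForm_hermiteFn ha, mul_left_comm, Complex.re_ofReal_mul,
    formFn_apply, SigmaSpace.fn_smul, inner_smul_left]

section Hessian

variable {lam eta ω a c : ℝ} {k : ℕ} (ha : 0 < a) (hM : a ^ 2 = lam + eta * c ^ 2)
  (hω : ω = a * (4 * k + 1) + eta * formMulX (boundState a c k) (boundState a c k))

include ha hM hω

theorem actionDeriv_boundState : actionDeriv lam eta ω (boundState a c k) = 0 := by
  ext h
  have h1 := re_oscForm_smul_hermiteFn ha c (2 * k) h
  have e : (c : ℂ) • hermiteFn a (2 * k) = boundState a c k := Complex.coe_smul _ _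
  rw [e, re_oscForm, hM] at h1
  rw [actionDeriv_apply, formMoment_even (boundState_even a c k) (boundState_even a c k),
    formFn_boundState_self ha]
  simp only [zero_apply]
  push_cast at h1
  rw [hω]
  linear_combination h1

/-- The terms proportional to `Re (x w, x h)` and `Re (w, h)` combine into the oscillator minus its
level. The rest is the symmetric rank-two coupling of `φ` and `x² φ`. -/
theorem actionHess_boundState {w : SigmaSpace} (hw : w ∈ EvenSigma) (h : SigmaSpace) :
    actionHess lam eta ω (boundState a c k) w h
      = (oscForm a w h).re - a * (4 * k + 1) * formFn w h
        + 2 * eta * (formFn (boundState a c k) w * formMulX (boundState a c k) h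
          + formMulX (boundState a c k) w * formFn (boundState a c k) h) := by
  rw [actionHess_even (boundState_even a c k) hw, formFn_boundState_self ha, re_oscForm, hM, hω]
  ring

end Hessian

/-- The space of the coordinates (real parts, imaginary parts) with respect to the Hermite functions
of index `0, 2, …, 2 k + 2`. -/
abbrev CoordSpace (k : ℕ) : Type := EuclideanSpace ℝ (Fin (k + 2) ⊕ Fin (k + 2))

/-- The index of the bound state. -/
def midIdx (k : ℕ) : Fin (k + 2) := (Fin.last k).castSucc

theorem midIdx_val (k : ℕ) : (midIdx k : ℕ) = k := rfl

/-- The pairing with `x² φ` in coordinates. -/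
def xSqFunctional (a : ℝ) (k : ℕ) (f : CoordSpace k) : ℝ :=
  ∑ j : Fin (k + 2), xSqCoeff a k j * f (Sum.inl j)

theorem xSqFunctional_add (a : ℝ) (k : ℕ) (f g : CoordSpace k) :
    xSqFunctional a k (f + g) = xSqFunctional a k f + xSqFunctional a k g := by
  simp [xSqFunctional, mul_add, Finset.sum_add_distrib]

theorem xSqFunctional_smul (a : ℝ) (k : ℕ) (r : ℝ) (f : CoordSpace k) :
    xSqFunctional a k (r • f) = r * xSqFunctional a k f := by
  simp only [xSqFunctional, Finset.mul_sum, PiLp.smul_apply, smul_eq_mul]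
  exact Finset.sum_congr rfl fun j _ => by ring

/-- The second derivative of the action in coordinates. -/
def hessOp (a κ : ℝ) (k : ℕ) : CoordSpace k →ₗ[ℝ] CoordSpace k where
  toFun f := WithLp.toLp 2 (Sum.elim
    -- The levels of index `2 j` and `2 k` differ by `4 a (j - k)`, and `κ` stands for `eta c²`. The
    -- coupling acts on real parts only, since `φ` is real.
    (fun j => 4 * a * ((j : ℝ) - k) * f (Sum.inl j)
      + 2 * κ * ((if j = midIdx k then xSqFunctional a k f else 0)
        + xSqCoeff a k j * f (Sum.inl (midIdx k))))
    (fun j => 4 * a * ((j : ℝ) - k) * f (Sum.inr j)))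
  map_add' f g := by
    ext i
    rcases i with j | j
    · simp only [PiLp.add_apply, Sum.elim_inl, xSqFunctional_add]
      split_ifs <;> ring
    · simp only [PiLp.add_apply, Sum.elim_inr]
      ring
  map_smul' r f := by
    ext i
    rcases i with j | j
    · simp only [PiLp.smul_apply, Sum.elim_inl, xSqFunctional_smul, smul_eq_mul, RingHom.id_apply]
      split_ifs <;> ring
    · simp only [PiLp.smul_apply, Sum.elim_inr, smul_eq_mul, RingHom.id_apply]
      ring

theorem hessOp_inl (a κ : ℝ) (k : ℕ) (f : CoordSpace k) (j : Fin (k + 2)) :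
    hessOp a κ k f (Sum.inl j) = 4 * a * ((j : ℝ) - k) * f (Sum.inl j)
      + 2 * κ * ((if j = midIdx k then xSqFunctional a k f else 0)
        + xSqCoeff a k j * f (Sum.inl (midIdx k))) := rfl

theorem hessOp_inr (a κ : ℝ) (k : ℕ) (f : CoordSpace k) (j : Fin (k + 2)) :
    hessOp a κ k f (Sum.inr j) = 4 * a * ((j : ℝ) - k) * f (Sum.inr j) := rfl

theorem inner_coordSpace {k : ℕ} (f g : CoordSpace k) : inner ℝ f g
    = ∑ j, (f (Sum.inl j) * g (Sum.inl j) + f (Sum.inr j) * g (Sum.inr j)) := by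
  rw [PiLp.inner_apply, Fintype.sum_sum_type, ← Finset.sum_add_distrib]
  refine Finset.sum_congr rfl fun j _ => ?_
  simp [mul_comm]

theorem inner_hessOp (a κ : ℝ) (k : ℕ) (f g : CoordSpace k) : inner ℝ (hessOp a κ k f) g
    = ∑ j : Fin (k + 2), 4 * a * ((j : ℝ) - k)
        * (f (Sum.inl j) * g (Sum.inl j) + f (Sum.inr j) * g (Sum.inr j))
      + 2 * κ * (xSqFunctional a k f * g (Sum.inl (midIdx k))
        + f (Sum.inl (midIdx k)) * xSqFunctional a k g) := by
  rw [inner_coordSpace]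
  have e : ∀ j, hessOp a κ k f (Sum.inl j) * g (Sum.inl j) + hessOp a κ k f (Sum.inr j) * g (Sum.inr j)
      = 4 * a * ((j : ℝ) - k) * (f (Sum.inl j) * g (Sum.inl j) + f (Sum.inr j) * g (Sum.inr j))
        + ((if j = midIdx k then 2 * κ * xSqFunctional a k f * g (Sum.inl (midIdx k)) else 0)
          + 2 * κ * f (Sum.inl (midIdx k)) * (xSqCoeff a k j * g (Sum.inl j))) := by
    intro j
    rw [hessOp_inl, hessOp_inr]
    split_ifs with h
    · rw [h]; ring
    · ring
  simp_rw [e]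
  rw [Finset.sum_add_distrib, Finset.sum_add_distrib, ← Finset.mul_sum]
  simp only [Finset.sum_ite_eq', Finset.mem_univ, if_true]
  rw [← xSqFunctional]
  ring

theorem isSymmetric_hessOp (a κ : ℝ) (k : ℕ) : (hessOp a κ k).IsSymmetric := by
  intro f g
  rw [← real_inner_comm f, inner_hessOp, inner_hessOp]
  congr 1
  · exact Finset.sum_congr rfl fun j _ => by ring
  · ring

/-- The coordinates of an element of `Σ`. -/
def toCoord (a : ℝ) (k : ℕ) (h : SigmaSpace) : CoordSpace k := WithLp.toLp 2 (Sum.elim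
  (fun j => (inner ℂ (hermiteFn a (2 * j)).fn h.fn).re)
  (fun j => (inner ℂ (hermiteFn a (2 * j)).fn h.fn).im))

theorem toCoord_inl (a : ℝ) (k : ℕ) (h : SigmaSpace) (j : Fin (k + 2)) :
    toCoord a k h (Sum.inl j) = (inner ℂ (hermiteFn a (2 * j)).fn h.fn).re := rfl

theorem toCoord_inr (a : ℝ) (k : ℕ) (h : SigmaSpace) (j : Fin (k + 2)) :
    toCoord a k h (Sum.inr j) = (inner ℂ (hermiteFn a (2 * j)).fn h.fn).im := rfl

/-- The `j`-th complex coordinate. -/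
def complexCoord {k : ℕ} (f : CoordSpace k) (j : Fin (k + 2)) : ℂ := ⟨f (Sum.inl j), f (Sum.inr j)⟩

/-- The element of `Σ` with the given coordinates. -/
def ofCoord (a : ℝ) (k : ℕ) : CoordSpace k →ₗ[ℝ] SigmaSpace where
  toFun f := ∑ j, complexCoord f j • hermiteFn a (2 * j)
  map_add' f g := by
    rw [← Finset.sum_add_distrib]
    refine Finset.sum_congr rfl fun j _ => ?_
    rw [← add_smul]
    rfl
  map_smul' r f := by
    rw [RingHom.id_apply, Finset.smul_sum]
    refine Finset.sum_congr rfl fun j _ => ?_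
    have : complexCoord (r • f) j = (r : ℂ) * complexCoord f j := by
      apply Complex.ext <;> simp [complexCoord]
    rw [this, mul_smul]
    exact Complex.coe_smul _ _

theorem ofCoord_apply (a : ℝ) (k : ℕ) (f : CoordSpace k) :
    ofCoord a k f = ∑ j, complexCoord f j • hermiteFn a (2 * j) := rfl

theorem ofCoord_even (a : ℝ) (k : ℕ) (f : CoordSpace k) : ofCoord a k f ∈ EvenSigma :=
  EvenSigma.sum_mem fun j _ => EvenSigma.smul_mem _ (hermiteFn_even a j)

theorem inner_hermiteFn_ofCoord {a : ℝ} (ha : 0 < a) (k : ℕ) (f : CoordSpace k) (n : ℕ) :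
    inner ℂ (hermiteFn a n).fn (ofCoord a k f).fn
      = ∑ j : Fin (k + 2), if n = 2 * j then complexCoord f j else 0 := by
  have e : (ofCoord a k f).fn = ∑ j : Fin (k + 2), complexCoord f j • (hermiteFn a (2 * j)).fn := by
    rw [ofCoord_apply, ← SigmaSpace.fnL_apply, map_sum]
    rfl
  rw [e, inner_sum]
  refine Finset.sum_congr rfl fun j _ => ?_
  rw [inner_smul_right, inner_hermiteFn ha]
  simp

theorem inner_hermiteFn_ofCoord_even {a : ℝ} (ha : 0 < a) (k : ℕ) (f : CoordSpace k)
    (j : Fin (k + 2)) :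
    inner ℂ (hermiteFn a (2 * j)).fn (ofCoord a k f).fn = complexCoord f j := by
  rw [inner_hermiteFn_ofCoord ha, Finset.sum_eq_single j]
  · simp
  · intro i _ hi
    rw [if_neg]
    intro h
    exact hi (Fin.ext (by omega))
  · simp

theorem toCoord_ofCoord {a : ℝ} (ha : 0 < a) (k : ℕ) (f : CoordSpace k) :
    toCoord a k (ofCoord a k f) = f := by
  ext i
  rcases i with j | j
  · rw [toCoord_inl, inner_hermiteFn_ofCoord_even ha]
    rfl
  · rw [toCoord_inr, inner_hermiteFn_ofCoord_even ha]
    rfl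

theorem formFn_smul_hermiteFn (a : ℝ) (z : ℂ) (n : ℕ) (h : SigmaSpace) :
    formFn (z • hermiteFn a n) h = z.re * (inner ℂ (hermiteFn a n).fn h.fn).re
      + z.im * (inner ℂ (hermiteFn a n).fn h.fn).im := by
  rw [formFn_apply, SigmaSpace.fn_smul, inner_smul_left, Complex.mul_re]
  simp

theorem formFn_ofCoord (a : ℝ) (k : ℕ) (f : CoordSpace k) (h : SigmaSpace) :
    formFn (ofCoord a k f) h = inner ℝ f (toCoord a k h) := by
  rw [ofCoord_apply, map_sum, sum_apply, inner_coordSpace]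
  refine Finset.sum_congr rfl fun j _ => ?_
  rw [formFn_smul_hermiteFn]
  rfl

theorem re_oscForm_ofCoord {a : ℝ} (ha : 0 < a) (k : ℕ) (f : CoordSpace k) (h : SigmaSpace) :
    (oscForm a (ofCoord a k f) h).re = ∑ j : Fin (k + 2), a * (4 * j + 1)
      * (f (Sum.inl j) * toCoord a k h (Sum.inl j) + f (Sum.inr j) * toCoord a k h (Sum.inr j)) := by
  have e : ∀ w, (oscForm a w h).re = (formDer + (a ^ 2) • formMulX) w h := fun w => re_oscForm a w h
  rw [e, ofCoord_apply, map_sum, sum_apply]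
  refine Finset.sum_congr rfl fun j _ => ?_
  rw [← e, re_oscForm_smul_hermiteFn ha, formFn_smul_hermiteFn]
  push_cast
  simp only [toCoord_inl, toCoord_inr, complexCoord]
  ring

section Eigenspace

variable {lam eta ω a c : ℝ} {k : ℕ} (ha : 0 < a) (hM : a ^ 2 = lam + eta * c ^ 2)
  (hω : ω = a * (4 * k + 1) + eta * formMulX (boundState a c k) (boundState a c k))

include ha hM hω

theorem actionHess_ofCoord (f : CoordSpace k) (h : SigmaSpace) :
    actionHess lam eta ω (boundState a c k) (ofCoord a k f) h
      = inner ℝ (hessOp a (eta * c ^ 2) k f) (toCoord a k h) := by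
  rw [actionHess_boundState ha hM hω (ofCoord_even a k f), re_oscForm_ofCoord ha, formFn_ofCoord,
    inner_hessOp, inner_coordSpace, Finset.mul_sum, ← Finset.sum_sub_distrib]
  have h1 : ∀ v, formFn (boundState a c k) v = c * toCoord a k v (Sum.inl (midIdx k)) := fun v =>
    formFn_boundState a c k v
  have h2 : ∀ v, formMulX (boundState a c k) v = c * xSqFunctional a k (toCoord a k v) := fun v =>
    formMulX_boundState ha c k v
  rw [h1, h1, h2, h2, toCoord_ofCoord ha]
  congr 1
  · exact Finset.sum_congr rfl fun j _ => by ring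
  · ring

/-- Let `j ≥ k + 2`. Multiples of the Hermite function of index `2 j` are orthogonal to `φ` and `x²
φ`, so testing with them gives `4 a (j - k) - μ` times the coefficient of `w` equal to zero. The
factor is positive for `μ ≤ 0`. -/
theorem ofCoord_toCoord_of_mem {μ : ℝ} (hμ : μ ≤ 0) {w : SigmaSpace}
    (hw : w ∈ hessEigenspace lam eta ω (boundState a c k) μ) :
    ofCoord a k (toCoord a k w) = w := by
  obtain ⟨hwe, hwh⟩ := hw
  refine SigmaSpace.ext_fn (sub_eq_zero.1 (hermiteFn_total ha fun n => ?_))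
  rw [inner_sub_right, sub_eq_zero]
  rcases Nat.even_or_odd' n with ⟨j, rfl | rfl⟩
  · by_cases hj : j < k + 2
    · exact (inner_hermiteFn_ofCoord_even ha k (toCoord a k w) ⟨j, hj⟩).trans
        (Complex.ext rfl rfl)
    · have hz : ∀ z : ℂ, formFn (z • hermiteFn a (2 * j)) w = 0 := by
        intro z
        have hh : z • hermiteFn a (2 * j) ∈ EvenSigma := EvenSigma.smul_mem _ (hermiteFn_even a j)
        have h0 : ∀ i : ℕ, i < k + 2 →
            inner ℂ (hermiteFn a (2 * i)).fn (z • hermiteFn a (2 * j)).fn = 0 := by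
          intro i hi
          rw [SigmaSpace.fn_smul, inner_smul_right, inner_hermiteFn ha, if_neg (by omega), mul_zero]
        have h1 := hwh _ hh
        rw [actionHess_boundState ha hM hω hwe, re_oscForm_comm, re_oscForm_smul_hermiteFn ha,
          formFn_boundState, formFn_boundState, formMulX_boundState ha, formMulX_boundState ha,
          h0 k (by omega), Finset.sum_eq_zero (s := Finset.univ)
            (f := fun i : Fin (k + 2) => xSqCoeff a k i
              * (inner ℂ (hermiteFn a (2 * i)).fn (z • hermiteFn a (2 * j)).fn).re)
            (fun i _ => by rw [h0 i i.2, Complex.zero_re, mul_zero]), ← formFn_apply,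
          formFn_comm w] at h1
        have hjk : (k : ℝ) + 2 ≤ j := by exact_mod_cast not_lt.1 hj
        have h2 : (a * (4 * (j - k)) - μ) * formFn (z • hermiteFn a (2 * j)) w = 0 := by
          have h3 : (inner ℂ w.fn (z • hermiteFn a (2 * j)).fn).re
            = formFn (z • hermiteFn a (2 * j)) w :=
            (formFn_apply w _).symm.trans (formFn_comm w _)
          push_cast at h1
          simp only [Complex.zero_re, mul_zero, add_zero] at h1
          linear_combination h1 + μ * h3
        refine (mul_eq_zero.1 h2).resolve_left (ne_of_gt ?_)
        nlinarith
      have hre := hz 1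
      have him := hz Complex.I
      rw [formFn_smul_hermiteFn] at hre him
      simp only [Complex.one_re, Complex.one_im, Complex.I_re, Complex.I_im, one_mul, zero_mul,
        add_zero, zero_add] at hre him
      rw [inner_hermiteFn_ofCoord ha, Finset.sum_eq_zero]
      · exact (Complex.ext hre him).symm
      · intro i _
        rw [if_neg]
        have := i.2
        omega
  · rw [inner_hermiteFn_odd ha j hwe, inner_hermiteFn_odd ha j (ofCoord_even a k _)]

/-- The eigenspaces of the second derivative for eigenvalues `≤ 0` are those of `hessOp`. -/
theorem hessEigenspace_eq_map {μ : ℝ} (hμ : μ ≤ 0) :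
    hessEigenspace lam eta ω (boundState a c k) μ
      = (Module.End.eigenspace (hessOp a (eta * c ^ 2) k) μ).map (ofCoord a k) := by
  refine le_antisymm (fun w hw => ?_) ?_
  · have hw' := ofCoord_toCoord_of_mem ha hM hω hμ hw
    refine ⟨toCoord a k w, ?_, hw'⟩
    rw [SetLike.mem_coe, Module.End.mem_eigenspace_iff]
    refine ext_inner_right ℝ fun g => ?_
    rw [inner_smul_left, ← toCoord_ofCoord ha k g, ← actionHess_ofCoord ha hM hω,
      ← formFn_ofCoord, hw']
    exact hw.2 _ (ofCoord_even a k g)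
  · rintro _ ⟨f, hf, rfl⟩
    refine ⟨ofCoord_even a k f, fun h _ => ?_⟩
    rw [actionHess_ofCoord ha hM hω, Module.End.mem_eigenspace_iff.1 hf, inner_smul_left,
      ← formFn_ofCoord]
    rfl

theorem hasMorseIndex_boundState {n : ℕ}
    (hn : Module.finrank ℝ ↥(⨆ μ : Iio (0 : ℝ),
      Module.End.eigenspace (hessOp a (eta * c ^ 2) k) (μ : ℝ)) = n) :
    HasMorseIndex lam eta ω (boundState a c k) n := by
  have hinj : Function.Injective (ofCoord a k) :=
    Function.LeftInverse.injective (g := toCoord a k) (toCoord_ofCoord ha k)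
  have e : (⨆ μ : Iio (0 : ℝ), hessEigenspace lam eta ω (boundState a c k) μ)
      = (⨆ μ : Iio (0 : ℝ), Module.End.eigenspace (hessOp a (eta * c ^ 2) k) (μ : ℝ)).map
        (ofCoord a k) := by
    rw [Submodule.map_iSup]
    exact iSup_congr fun μ => hessEigenspace_eq_map ha hM hω (le_of_lt μ.2)
  rw [HasMorseIndex, e, ← hn, Module.finrank_eq_rank]
  exact ((Submodule.equivMapOfInjective _ hinj _).rank_eq).symm

end Eigenspace

/-! ### Negative directions and kernel of the finite matrix -/

theorem stepCoeff_mul_sq {a : ℝ} (ha : 0 < a) (m n : ℕ) :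
    (stepCoeff a m * stepCoeff a n) ^ 2 = m * n / (4 * a ^ 2) := by
  rw [mul_pow, stepCoeff_sq ha, stepCoeff_sq ha]
  field_simp
  ring

theorem sum_xSqCoeff_sq {a : ℝ} (ha : 0 < a) (k : ℕ) :
    ∑ j : Fin k, xSqCoeff a k j ^ 2 = 2 * k * (2 * k - 1) / (4 * a ^ 2) := by
  have h := sum_xSqCoeff_lt a k (· ^ 2) (by norm_num) fun _ => 1
  simp only [mul_one] at h
  rw [Fin.sum_univ_eq_sum_range (fun j => xSqCoeff a k j ^ 2) k, h, stepCoeff_mul_sq ha]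
  cases k with
  | zero => simp
  | succ k =>
    have : 2 * (k + 1) - 1 = 2 * k + 1 := by omega
    rw [this]
    push_cast
    ring

theorem xSqCoeff_succ_sq {a : ℝ} (ha : 0 < a) (k : ℕ) :
    xSqCoeff a k (k + 1) ^ 2 = (2 * k + 1) * (2 * k + 2) / (4 * a ^ 2) := by
  rw [xSqCoeff_succ, stepCoeff_mul_sq ha]
  push_cast
  ring

/-- The embedding of the indices below that of the bound state. -/
def lowIdx {k : ℕ} (j : Fin k) : Fin (k + 2) := j.castSucc.castSucc

theorem sum_fin_split {k : ℕ} (f : Fin (k + 2) → ℝ) :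
    ∑ j, f j = ∑ j : Fin k, f (lowIdx j) + f (midIdx k) + f (Fin.last (k + 1)) := by
  rw [Fin.sum_univ_castSucc, Fin.sum_univ_castSucc]
  rfl

theorem xSqFunctional_eq (a : ℝ) (k : ℕ) (f : CoordSpace k) : xSqFunctional a k f
    = ∑ j : Fin k, xSqCoeff a k j * f (Sum.inl (lowIdx j))
      + (4 * k + 1) / (2 * a) * f (Sum.inl (midIdx k))
      + xSqCoeff a k (k + 1) * f (Sum.inl (Fin.last (k + 1))) := by
  rw [xSqFunctional, sum_fin_split, ← xSqCoeff_self]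
  rfl

/-- The form is split into the coordinates below, at and above the bound state. The imaginary middle
coordinate does not occur: it is the phase direction. -/
theorem inner_hessOp_self (a κ : ℝ) (k : ℕ) (f : CoordSpace k) : inner ℝ (hessOp a κ k f) f
    = ∑ j : Fin k, (4 * κ * xSqCoeff a k j * f (Sum.inl (lowIdx j)) * f (Sum.inl (midIdx k))
        - 4 * a * ((k : ℝ) - j) * (f (Sum.inl (lowIdx j)) ^ 2 + f (Sum.inr (lowIdx j)) ^ 2))
      + 4 * κ * ((4 * k + 1) / (2 * a) * f (Sum.inl (midIdx k)) ^ 2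
        + xSqCoeff a k (k + 1) * f (Sum.inl (midIdx k)) * f (Sum.inl (Fin.last (k + 1))))
      + 4 * a * (f (Sum.inl (Fin.last (k + 1))) ^ 2 + f (Sum.inr (Fin.last (k + 1))) ^ 2) := by
  rw [inner_hessOp, sum_fin_split, xSqFunctional_eq, Finset.sum_sub_distrib]
  have h1 : ∑ j : Fin k, 4 * κ * xSqCoeff a k j * f (Sum.inl (lowIdx j)) * f (Sum.inl (midIdx k))
      = 4 * κ * f (Sum.inl (midIdx k)) * ∑ j : Fin k, xSqCoeff a k j * f (Sum.inl (lowIdx j)) := by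
    rw [Finset.mul_sum]
    exact Finset.sum_congr rfl fun j _ => by ring
  have h2 : ∑ j : Fin k, 4 * a * (((lowIdx j : Fin (k + 2)) : ℝ) - k)
      * (f (Sum.inl (lowIdx j)) * f (Sum.inl (lowIdx j))
        + f (Sum.inr (lowIdx j)) * f (Sum.inr (lowIdx j)))
      = - ∑ j : Fin k, 4 * a * ((k : ℝ) - j)
        * (f (Sum.inl (lowIdx j)) ^ 2 + f (Sum.inr (lowIdx j)) ^ 2) := by
    rw [← Finset.sum_neg_distrib]
    refine Finset.sum_congr rfl fun j _ => ?_
    have : ((lowIdx j : Fin (k + 2)) : ℕ) = j := rfl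
    rw [this]
    ring
  rw [h1, h2, midIdx_val, Fin.val_last]
  push_cast
  ring

/-- The low part of the form is at most what completing the squares gives. -/
theorem low_part_le {a : ℝ} (ha : 0 < a) (κ : ℝ) {k j : ℕ} (hj : j < k) (b x y z : ℝ) :
    4 * κ * b * x * z - 4 * a * ((k : ℝ) - j) * (x ^ 2 + y ^ 2) ≤ κ ^ 2 * b ^ 2 * z ^ 2 / a := by
  have hjk : (1 : ℝ) ≤ k - j := by
    have : (j : ℝ) + 1 ≤ k := by exact_mod_cast hj
    linarith
  rw [le_div_iff₀ ha]
  nlinarith [sq_nonneg (2 * a * x - κ * b * z), mul_nonneg (sub_nonneg.2 hjk) (sq_nonneg (a * x)),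
    mul_nonneg (sub_nonneg.2 hjk) (sq_nonneg (a * y)), sq_nonneg (a * y)]

theorem low_part_lt {a : ℝ} (ha : 0 < a) {k j : ℕ} (hj : j < k) {x y : ℝ}
    (h : x ≠ 0 ∨ y ≠ 0) : 0 < 4 * a * ((k : ℝ) - j) * (x ^ 2 + y ^ 2) := by
  have hjk : (0 : ℝ) < k - j := by
    have : (j : ℝ) + 1 ≤ k := by exact_mod_cast hj
    linarith
  have : 0 < x ^ 2 + y ^ 2 := by
    rcases h with h | h <;> positivity
  positivity

theorem coordSpace_ext_zero {k : ℕ} {f : CoordSpace k}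
    (hl : ∀ j : Fin k, f (Sum.inl (lowIdx j)) = 0 ∧ f (Sum.inr (lowIdx j)) = 0)
    (hm : f (Sum.inl (midIdx k)) = 0 ∧ f (Sum.inr (midIdx k)) = 0)
    (ht : f (Sum.inl (Fin.last (k + 1))) = 0 ∧ f (Sum.inr (Fin.last (k + 1))) = 0) : f = 0 := by
  have key : ∀ j : Fin (k + 2), f (Sum.inl j) = 0 ∧ f (Sum.inr j) = 0 := by
    intro j
    refine Fin.lastCases ht (fun i => ?_) j
    exact Fin.lastCases hm hl i
  ext i
  rcases i with j | j
  · exact (key j).1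
  · exact (key j).2

theorem low_part_sum_neg {a : ℝ} (ha : 0 < a) {k : ℕ} {f : CoordSpace k}
    (h : ∃ j : Fin k, f (Sum.inl (lowIdx j)) ≠ 0 ∨ f (Sum.inr (lowIdx j)) ≠ 0) :
    0 < ∑ j : Fin k, 4 * a * ((k : ℝ) - j)
      * (f (Sum.inl (lowIdx j)) ^ 2 + f (Sum.inr (lowIdx j)) ^ 2) := by
  obtain ⟨j, hj⟩ := h
  refine Finset.sum_pos' (fun i _ => ?_) ⟨j, Finset.mem_univ _, low_part_lt ha j.2 hj⟩
  have : (i : ℝ) + 1 ≤ k := by exact_mod_cast i.2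
  have : (0 : ℝ) ≤ k - i := by linarith
  positivity

/-- A coordinate functional. -/
def coordL {k : ℕ} (i : Fin (k + 2) ⊕ Fin (k + 2)) : CoordSpace k →ₗ[ℝ] ℝ where
  toFun f := f i
  map_add' _ _ := rfl
  map_smul' _ _ := rfl

theorem finrank_coordSpace (k : ℕ) : Module.finrank ℝ (CoordSpace k) = 2 * k + 4 := by
  rw [finrank_euclideanSpace, Fintype.card_sum, Fintype.card_fin]
  ring

/-- The form is negative on the `2 k` low coordinates. It is nonnegative on a complement of
dimension four, where the low real coordinates are those maximizing the form for a given middle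
coordinate. -/
theorem hessOp_morse_self {a : ℝ} (ha : 0 < a) (k : ℕ) :
    Module.finrank ℝ ↥(⨆ μ : Iio (0 : ℝ),
      Module.End.eigenspace (hessOp a (a ^ 2) k) (μ : ℝ)) = 2 * k := by
  have h := (isSymmetric_hessOp a (a ^ 2) k).finrank_iSup_eigenspace_neg
    (LinearMap.pi ![coordL (Sum.inl (midIdx k)), coordL (Sum.inl (Fin.last (k + 1))),
      coordL (Sum.inr (midIdx k)), coordL (Sum.inr (Fin.last (k + 1)))])
    (LinearMap.pi (Sum.elim
      -- For `j = k - 1` and `b = xSqCoeff a k j`, the maximum of `4 a² b x z - 4 a x²` over `x` is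
      -- at `x = a b z / 2`. For smaller `j` the coefficient `b` vanishes.
      (fun j : Fin k => coordL (Sum.inl (lowIdx j))
        - (a / 2 * xSqCoeff a k j) • coordL (Sum.inl (midIdx k)))
      (fun j : Fin k => coordL (Sum.inr (lowIdx j))))) ?_ ?_ ?_
  · rw [h, Module.finrank_fintype_fun_eq_card, Fintype.card_sum, Fintype.card_fin]
    ring
  · rw [finrank_coordSpace, Module.finrank_fintype_fun_eq_card, Module.finrank_fintype_fun_eq_card,
      Fintype.card_sum, Fintype.card_fin, Fintype.card_fin]
    ring
  · intro f hf hf0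
    have h0 : f (Sum.inl (midIdx k)) = 0 := congrFun hf 0
    have h1 : f (Sum.inl (Fin.last (k + 1))) = 0 := congrFun hf 1
    have h2 : f (Sum.inr (midIdx k)) = 0 := congrFun hf 2
    have h3 : f (Sum.inr (Fin.last (k + 1))) = 0 := congrFun hf 3
    have hex : ∃ j : Fin k, f (Sum.inl (lowIdx j)) ≠ 0 ∨ f (Sum.inr (lowIdx j)) ≠ 0 := by
      by_contra! hcon
      exact hf0 (coordSpace_ext_zero hcon ⟨h0, h2⟩ ⟨h1, h3⟩)
    rw [inner_hessOp_self, h0, h1, h3]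
    have := low_part_sum_neg ha hex
    simp only [mul_zero, zero_sub, Finset.sum_neg_distrib]
    linarith
  · intro f hf
    have h1 : ∀ j : Fin k, f (Sum.inl (lowIdx j))
        = a / 2 * xSqCoeff a k j * f (Sum.inl (midIdx k)) := fun j =>
      sub_eq_zero.1 (congrFun hf (Sum.inl j))
    have h2 : ∀ j : Fin k, f (Sum.inr (lowIdx j)) = 0 := fun j => congrFun hf (Sum.inr j)
    rw [inner_hessOp_self]
    have h3 : ∑ j : Fin k, (4 * a ^ 2 * xSqCoeff a k j * f (Sum.inl (lowIdx j))
          * f (Sum.inl (midIdx k))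
        - 4 * a * ((k : ℝ) - j) * (f (Sum.inl (lowIdx j)) ^ 2 + f (Sum.inr (lowIdx j)) ^ 2))
        = ∑ j : Fin k, a ^ 3 * f (Sum.inl (midIdx k)) ^ 2 * xSqCoeff a k j ^ 2 := by
      refine Finset.sum_congr rfl fun j _ => ?_
      by_cases hj : (j : ℕ) + 1 = k
      · have hk : (k : ℝ) = j + 1 := by exact_mod_cast hj.symm
        rw [h1, h2, hk]
        ring
      · rw [h1, h2, xSqCoeff_of_lt a j.2, if_neg hj]
        ring
    rw [h3, ← Finset.mul_sum, sum_xSqCoeff_sq ha]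
    have h4 := xSqCoeff_succ_sq ha k
    set b := xSqCoeff a k (k + 1)
    set x := f (Sum.inl (midIdx k))
    set t := f (Sum.inl (Fin.last (k + 1)))
    set y := f (Sum.inr (Fin.last (k + 1)))
    -- After completing the square in `t`, the coefficient of `a x²` is `k (2 k - 1) / 2 + 2 (4 k +
    -- 1) - (2 k + 1) (2 k + 2) / 4`, which equals `3 (4 k + 1) / 2`.
    have h5 : a ^ 3 * x ^ 2 * (2 * k * (2 * k - 1) / (4 * a ^ 2))
        + 4 * a ^ 2 * ((4 * k + 1) / (2 * a) * x ^ 2 + b * x * t) + 4 * a * (t ^ 2 + y ^ 2)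
        = a * ((2 * t + a * b * x) ^ 2 + 4 * y ^ 2 + (3 / 2 + 6 * k) * x ^ 2) := by
      have : a ^ 2 * b ^ 2 = (2 * k + 1) * (2 * k + 2) / 4 := by
        rw [h4]; field_simp
      have e1 : a ^ 3 * x ^ 2 * (2 * k * (2 * k - 1) / (4 * a ^ 2))
          = a * x ^ 2 * (k * (2 * k - 1) / 2) := by field_simp; ring
      have e2 : 4 * a ^ 2 * ((4 * k + 1) / (2 * a) * x ^ 2 + b * x * t)
          = 2 * a * (4 * k + 1) * x ^ 2 + 4 * a ^ 2 * b * x * t := by field_simp; ring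
      linear_combination e1 + e2 - a * x ^ 2 * this
    rw [h5]
    positivity

/-- With `κ = -1` the real middle direction becomes negative: for the top coordinate minimizing the
form, the middle coordinate contributes at most `-5 (4 k + 1) / 2` times its square, even after the
low coordinates are optimized. This adds one to the `2 k` low directions. -/
theorem hessOp_morse_neg (k : ℕ) :
    Module.finrank ℝ ↥(⨆ μ : Iio (0 : ℝ),
      Module.End.eigenspace (hessOp 1 (-1) k) (μ : ℝ)) = 2 * k + 1 := by
  have h := (isSymmetric_hessOp 1 (-1) k).finrank_iSup_eigenspace_neg
    (LinearMap.pi ![coordL (Sum.inr (midIdx k)), coordL (Sum.inr (Fin.last (k + 1))),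
      -- With `b = xSqCoeff 1 k (k + 1)`, the minimum of `4 t² - 4 b z t` over `t` is at `t = b z /
      -- 2`.
      coordL (Sum.inl (Fin.last (k + 1)))
        - (xSqCoeff 1 k (k + 1) / 2) • coordL (Sum.inl (midIdx k))])
    (LinearMap.pi (Sum.elim
      (fun j : Fin (k + 1) => coordL (Sum.inl j.castSucc))
      (fun j : Fin k => coordL (Sum.inr (lowIdx j))))) ?_ ?_ ?_
  · rw [h, Module.finrank_fintype_fun_eq_card, Fintype.card_sum, Fintype.card_fin, Fintype.card_fin]
    ring
  · rw [finrank_coordSpace, Module.finrank_fintype_fun_eq_card, Module.finrank_fintype_fun_eq_card,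
      Fintype.card_sum, Fintype.card_fin, Fintype.card_fin, Fintype.card_fin]
    ring
  · intro f hf hf0
    have h1 : f (Sum.inr (midIdx k)) = 0 := congrFun hf 0
    have h2 : f (Sum.inr (Fin.last (k + 1))) = 0 := congrFun hf 1
    have h3 : f (Sum.inl (Fin.last (k + 1)))
      = xSqCoeff 1 k (k + 1) / 2 * f (Sum.inl (midIdx k)) := sub_eq_zero.1 (congrFun hf 2)
    rw [inner_hessOp_self, h2, h3]
    rcases eq_or_ne (f (Sum.inl (midIdx k))) 0 with h0 | h0
    · have hex : ∃ j : Fin k, f (Sum.inl (lowIdx j)) ≠ 0 ∨ f (Sum.inr (lowIdx j)) ≠ 0 := by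
        by_contra! hcon
        refine hf0 (coordSpace_ext_zero hcon ⟨h0, h1⟩ ⟨?_, h2⟩)
        rw [h3, h0, mul_zero]
      have := low_part_sum_neg one_pos hex
      rw [h0]
      simp only [mul_zero, zero_sub, Finset.sum_neg_distrib, ne_eq, OfNat.ofNat_ne_zero,
        not_false_eq_true, zero_pow, add_zero]
      linarith
    · have hle := Finset.sum_le_sum fun (j : Fin k) (_ : j ∈ Finset.univ) =>
        low_part_le one_pos (-1) j.2 (xSqCoeff 1 k j) (f (Sum.inl (lowIdx j)))
          (f (Sum.inr (lowIdx j))) (f (Sum.inl (midIdx k)))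
      have hS : ∑ j : Fin k, (-1 : ℝ) ^ 2 * xSqCoeff 1 k j ^ 2 * f (Sum.inl (midIdx k)) ^ 2 / 1
          = 2 * k * (2 * k - 1) / 4 * f (Sum.inl (midIdx k)) ^ 2 := by
        have := sum_xSqCoeff_sq one_pos k
        rw [one_pow, mul_one] at this
        rw [← this, Finset.sum_mul]
        exact Finset.sum_congr rfl fun j _ => by ring
      rw [hS] at hle
      have hb := xSqCoeff_succ_sq one_pos k
      have hz := sq_pos_of_ne_zero h0
      have hk : (0 : ℝ) ≤ k := k.cast_nonneg
      have hkz := mul_nonneg hk hz.le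
      have e : xSqCoeff 1 k (k + 1) ^ 2 * f (Sum.inl (midIdx k)) ^ 2
          = (2 * k + 1) * (2 * k + 2) / 4 * f (Sum.inl (midIdx k)) ^ 2 := by
        rw [hb]; ring
      linarith
  · intro f hf
    have h1 : ∀ j : Fin (k + 1), f (Sum.inl j.castSucc) = 0 := fun j => congrFun hf (Sum.inl j)
    have h2 : ∀ j : Fin k, f (Sum.inr (lowIdx j)) = 0 := fun j => congrFun hf (Sum.inr j)
    have h3 : ∀ j : Fin k, f (Sum.inl (lowIdx j)) = 0 := fun j => h1 j.castSucc
    have h4 : f (Sum.inl (midIdx k)) = 0 := h1 (Fin.last k)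
    rw [inner_hessOp_self, h4]
    simp only [h2, h3]
    simp only [mul_zero, zero_mul, ne_eq, OfNat.ofNat_ne_zero, not_false_eq_true, zero_pow,
      add_zero, sub_zero, Finset.sum_const_zero, zero_add, mul_one]
    positivity

/-- The neighbouring rows express their coordinates through the real middle one. Inserted into the
middle row they leave `κ (4 k + 1) (4 a² - κ)` times it. Only the imaginary middle coordinate stays
free. -/
theorem hessOp_apply_eq_zero {a κ : ℝ} (ha : 0 < a) (hκ : κ ≠ 0) (hκa : κ ≠ 4 * a ^ 2) {k : ℕ}
    {f : CoordSpace k} (hf : hessOp a κ k f = 0) :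
    (∀ j, f (Sum.inl j) = 0) ∧ ∀ j, j ≠ midIdx k → f (Sum.inr j) = 0 := by
  have hl : ∀ j, hessOp a κ k f (Sum.inl j) = 0 := fun j => by rw [hf]; rfl
  have hr : ∀ j, hessOp a κ k f (Sum.inr j) = 0 := fun j => by rw [hf]; rfl
  have hne : ∀ j : Fin (k + 2), j ≠ midIdx k → 4 * a * ((j : ℝ) - k) ≠ 0 := by
    intro j hj
    refine mul_ne_zero (by positivity) (sub_ne_zero.2 fun h => hj (Fin.ext ?_))
    exact_mod_cast h
  have hlow : ∀ j : Fin k, xSqCoeff a k j * f (Sum.inl (lowIdx j))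
      = κ / (2 * a) * f (Sum.inl (midIdx k)) * xSqCoeff a k j ^ 2 := by
    intro j
    by_cases hj : (j : ℕ) + 1 = k
    · have hk : (k : ℝ) = j + 1 := by exact_mod_cast hj.symm
      have h := hl (lowIdx j)
      have hv : ((lowIdx j : Fin (k + 2)) : ℕ) = j := rfl
      have hm : lowIdx j ≠ midIdx k := fun h => by
        have := congrArg Fin.val h
        rw [hv, midIdx_val] at this
        omega
      rw [hessOp_inl, if_neg hm, hv, hk] at h
      field_simp
      linear_combination (-xSqCoeff a k j / 2) * h
    · rw [xSqCoeff_of_lt a j.2, if_neg hj]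
      ring
  have htop : 2 * a * f (Sum.inl (Fin.last (k + 1)))
      = -(κ * xSqCoeff a k (k + 1) * f (Sum.inl (midIdx k))) := by
    have h := hl (Fin.last (k + 1))
    have hm : Fin.last (k + 1) ≠ midIdx k := fun h => by
      have := congrArg Fin.val h
      rw [Fin.val_last, midIdx_val] at this
      omega
    rw [hessOp_inl, if_neg hm, Fin.val_last] at h
    push_cast at h
    linear_combination h / 2
  have hmid : f (Sum.inl (midIdx k)) = 0 := by
    have h := hl (midIdx k)
    rw [hessOp_inl, if_pos rfl, xSqFunctional_eq, midIdx_val, xSqCoeff_self,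
      Finset.sum_congr rfl fun j _ => hlow j, ← Finset.mul_sum, sum_xSqCoeff_sq ha] at h
    have hb : a ^ 2 * xSqCoeff a k (k + 1) ^ 2 = (2 * k + 1) * (2 * k + 2) / 4 := by
      rw [xSqCoeff_succ_sq ha]
      field_simp
    have hk : (0 : ℝ) < 4 * k + 1 := by positivity
    have key : κ * (4 * k + 1) * (4 * a ^ 2 - κ) * f (Sum.inl (midIdx k)) = 0 := by
      have e : 2 * a ^ 3 * (4 * a * ((k : ℝ) - k) * f (Sum.inl (midIdx k))
          + 2 * κ * (κ / (2 * a) * f (Sum.inl (midIdx k)) * (2 * k * (2 * k - 1) / (4 * a ^ 2))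
            + (4 * k + 1) / (2 * a) * f (Sum.inl (midIdx k))
            + xSqCoeff a k (k + 1) * f (Sum.inl (Fin.last (k + 1)))
            + (4 * k + 1) / (2 * a) * f (Sum.inl (midIdx k))))
          = κ ^ 2 * f (Sum.inl (midIdx k)) * (k * (2 * k - 1))
            + 4 * κ * a ^ 2 * (4 * k + 1) * f (Sum.inl (midIdx k))
            + 4 * a ^ 3 * κ * xSqCoeff a k (k + 1) * f (Sum.inl (Fin.last (k + 1))) := by
        field_simp
        ring
      rw [h, mul_zero] at e
      linear_combination -e + (-(2 * a ^ 2 * κ * xSqCoeff a k (k + 1))) * htop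
        + 2 * κ ^ 2 * f (Sum.inl (midIdx k)) * hb
    refine (mul_eq_zero.1 key).resolve_left (mul_ne_zero (mul_ne_zero hκ hk.ne') ?_)
    exact sub_ne_zero.2 hκa.symm
  refine ⟨fun j => ?_, fun j hj => ?_⟩
  · by_cases hj : j = midIdx k
    · rw [hj, hmid]
    · have h := hl j
      rw [hessOp_inl, if_neg hj, hmid] at h
      refine (mul_eq_zero.1 ?_).resolve_left (hne j hj)
      linear_combination h
  · have h := hr j
    rw [hessOp_inr] at h
    exact (mul_eq_zero.1 h).resolve_left (hne j hj)

theorem hessEigenspace_zero_boundState {lam eta ω a c : ℝ} {k : ℕ} (ha : 0 < a)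
    (hM : a ^ 2 = lam + eta * c ^ 2)
    (hω : ω = a * (4 * k + 1) + eta * formMulX (boundState a c k) (boundState a c k))
    (hc : c ≠ 0) (heta : eta ≠ 0) (hne : eta * c ^ 2 ≠ 4 * a ^ 2) :
    hessEigenspace lam eta ω (boundState a c k) 0
      = Submodule.span ℝ {Complex.I • boundState a c k} := by
  have hg : ofCoord a k (EuclideanSpace.single (Sum.inr (midIdx k)) c)
      = Complex.I • boundState a c k := by
    rw [ofCoord_apply, Finset.sum_eq_single (midIdx k)]
    · have : complexCoord (EuclideanSpace.single (Sum.inr (midIdx k)) c) (midIdx k)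
          = Complex.I * c := by
        apply Complex.ext <;> simp [complexCoord]
      rw [this, mul_smul, midIdx_val]
      rfl
    · intro j _ hj
      have : complexCoord (EuclideanSpace.single (Sum.inr (midIdx k)) c) j = 0 := by
        apply Complex.ext <;> simp [complexCoord, hj]
      rw [this, zero_smul]
    · simp
  rw [hessEigenspace_eq_map ha hM hω le_rfl, ← hg, ← Set.image_singleton, ← Submodule.map_span]
  congr 1
  refine le_antisymm (fun f hf => ?_) ?_
  · have h0 : hessOp a (eta * c ^ 2) k f = 0 := by
      rw [Module.End.mem_eigenspace_iff.1 hf, zero_smul]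
    obtain ⟨h1, h2⟩ := hessOp_apply_eq_zero ha (mul_ne_zero heta (pow_ne_zero 2 hc)) hne h0
    refine Submodule.mem_span_singleton.2 ⟨f (Sum.inr (midIdx k)) / c, ?_⟩
    ext i
    rcases i with j | j
    · simp [h1 j]
    · by_cases hj : j = midIdx k
      · simp [hj, hc]
      · simp [hj, h2 j hj]
  · rw [Submodule.span_singleton_le_iff_mem, Module.End.mem_eigenspace_iff, zero_smul]
    ext i
    rcases i with j | j
    · rw [hessOp_inl]
      simp [xSqFunctional]
    · rw [hessOp_inr]
      by_cases hj : j = midIdx k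
      · simp [hj, midIdx_val]
      · simp [hj]

/-! ### The family of bound states as a function of the frequency -/

section

open Polynomial

theorem contDiffOn_gaussSigma (p : ℝ[X]) : ContDiffOn ℝ 1 (fun a => gaussSigma a p) (Ioi 0) := by
  have hd : ∀ q : ℝ[X], DifferentiableOn ℝ (fun a => gaussSigma a q) (Ioi 0) := fun q a ha =>
    (hasDerivAt_gaussSigma ha q).differentiableAt.differentiableWithinAt
  rw [contDiffOn_one_iff_derivWithin isOpen_Ioi.uniqueDiffOn]
  refine ⟨hd p, ((hd (X ^ 2 * p)).continuousOn.const_smul (-(1 / 2 : ℝ))).congr fun a ha => ?_⟩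
  rw [derivWithin_of_isOpen isOpen_Ioi ha, (hasDerivAt_gaussSigma ha p).deriv, Pi.smul_apply]

/-- The Hermite polynomial depends on `a` too. The induction therefore treats it together with its
derivative, and the free factor `q` absorbs the `X` of the recursion. -/
theorem contDiffOn_gaussSigma_hermitePoly (n : ℕ) : ∀ q : ℝ[X],
    ContDiffOn ℝ 1 (fun a => gaussSigma a (q * hermitePoly a n)) (Ioi 0) := by
  have key : ∀ n, (∀ q : ℝ[X],
      ContDiffOn ℝ 1 (fun a => gaussSigma a (q * hermitePoly a n)) (Ioi 0)) ∧
      ∀ q : ℝ[X],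
        ContDiffOn ℝ 1 (fun a => gaussSigma a (q * derivative (hermitePoly a n))) (Ioi 0) := by
    intro n
    induction n with
    | zero =>
      refine ⟨fun q => contDiffOn_gaussSigma _, fun q => ?_⟩
      simpa only [hermitePoly, derivative_one, mul_zero] using contDiffOn_gaussSigma 0
    | succ n ih =>
      refine ⟨fun q => ?_, fun q => ?_⟩
      · have h : ContDiffOn ℝ 1 (fun a : ℝ => (2 * a) • gaussSigma a (q * X * hermitePoly a n)
            - gaussSigma a (q * derivative (hermitePoly a n))) (Ioi 0) :=
          ((contDiffOn_const.mul contDiffOn_id).smul (ih.1 (q * X))).sub (ih.2 q)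
        refine h.congr fun a _ => ?_
        rw [← map_smul, ← map_sub, hermitePoly_succ, smul_eq_C_mul]
        congr 1
        ring
      · have h : ContDiffOn ℝ 1 (fun a : ℝ => (2 * a * (n + 1)) • gaussSigma a (q * hermitePoly a n))
            (Ioi 0) :=
          ((contDiffOn_const.mul contDiffOn_id).mul contDiffOn_const).smul (ih.1 q)
        refine h.congr fun a _ => ?_
        rw [← map_smul, derivative_hermitePoly_succ, smul_eq_C_mul]
        congr 1
        ring
  exact (key n).1

theorem contDiffOn_hermiteFn (n : ℕ) : ContDiffOn ℝ 1 (fun a => hermiteFn a n) (Ioi 0) := by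
  have h1 : ContDiffOn ℝ 1 (fun a => hermiteNormSq a n) (Ioi 0) := by
    unfold hermiteNormSq
    refine (((contDiffOn_const.mul contDiffOn_id).pow n).mul contDiffOn_const).mul
      (ContDiffOn.sqrt (contDiffOn_const.div contDiffOn_id fun a ha => ne_of_gt ha) fun a ha => ?_)
    exact (div_pos Real.pi_pos ha).ne'
  have h2 := (h1.sqrt fun a ha => (hermiteNormSq_pos ha n).ne').inv
    fun a ha => (Real.sqrt_pos.2 (hermiteNormSq_pos ha n)).ne'
  refine (h2.smul (contDiffOn_gaussSigma_hermitePoly n 1)).congr fun a _ => ?_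
  simp only [one_mul, Pi.smul_apply', Pi.inv_apply]
  rfl

theorem formMulX_boundState_self {a : ℝ} (ha : 0 < a) (c : ℝ) (k : ℕ) :
    formMulX (boundState a c k) (boundState a c k) = c ^ 2 * (4 * k + 1) / (2 * a) := by
  have e : ∀ j : Fin (k + 2), xSqCoeff a k j
      * (inner ℂ (hermiteFn a (2 * j)).fn (boundState a c k).fn).re
      = if j = midIdx k then xSqCoeff a k k * c else 0 := by
    intro j
    have : (boundState a c k).fn = c • (hermiteFn a (2 * k)).fn := rfl
    rw [this, inner_smul_right_eq_smul, inner_hermiteFn ha, Complex.smul_re]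
    split_ifs with h1 h2 h2
    · rw [h2, midIdx_val]
      simp
    · exact absurd (Fin.ext (by rw [midIdx_val]; omega)) h2
    · exact absurd (by rw [h2, midIdx_val]) h1
    · simp
  rw [formMulX_boundState ha, Finset.sum_congr rfl fun j _ => e j, Finset.sum_ite_eq',
    if_pos (Finset.mem_univ _), xSqCoeff_self]
  ring

theorem norm_fn_boundState_sq {a : ℝ} (ha : 0 < a) (c : ℝ) (k : ℕ) :
    ‖(boundState a c k).fn‖ ^ 2 = c ^ 2 := by
  rw [← formFn_boundState_self ha c k]
  exact (reInner_self _).symm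

theorem norm_mulX_boundState_sq {a : ℝ} (ha : 0 < a) (c : ℝ) (k : ℕ) :
    ‖(boundState a c k).mulX‖ ^ 2 = c ^ 2 * (4 * k + 1) / (2 * a) := by
  rw [← formMulX_boundState_self ha c k]
  exact (reInner_self _).symm

/-- The eigenvalue relation tested on the state itself: kinetic and `a²`-weighted potential parts
each take half of `a (4 k + 1) c²`. -/
theorem norm_der_boundState_sq {a : ℝ} (ha : 0 < a) (c : ℝ) (k : ℕ) :
    ‖(boundState a c k).der‖ ^ 2 = a * c ^ 2 * (4 * k + 1) / 2 := by
  have h := re_oscForm_smul_hermiteFn ha c (2 * k) (boundState a c k)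
  have e : (c : ℂ) • hermiteFn a (2 * k) = boundState a c k := Complex.coe_smul _ _
  have e' : formDer (boundState a c k) (boundState a c k) = ‖(boundState a c k).der‖ ^ 2 :=
    reInner_self _
  rw [e, re_oscForm, formFn_boundState_self ha, formMulX_boundState_self ha, e'] at h
  push_cast at h
  have e2 : a ^ 2 * (c ^ 2 * (4 * k + 1) / (2 * a)) = a * c ^ 2 * (4 * k + 1) / 2 := by field_simp
  rw [e2] at h
  linear_combination h

theorem energy_boundState {lam eta a c : ℝ} (ha : 0 < a) (hM : a ^ 2 = lam + eta * c ^ 2) (k : ℕ) :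
    energy lam eta (boundState a c k) = a * c ^ 2 * (4 * k + 1) / 2 := by
  rw [SigmaSpace.energy_eq, SigmaSpace.moment_even (boundState_even a c k),
    norm_fn_boundState_sq ha, norm_der_boundState_sq ha, norm_mulX_boundState_sq ha]
  have e : a ^ 2 * (c ^ 2 * (4 * k + 1) / (2 * a)) = a * c ^ 2 * (4 * k + 1) / 2 := by field_simp
  rw [hM] at e
  linear_combination e / 2

theorem action_boundState {lam eta a c : ℝ} (ha : 0 < a) (hM : a ^ 2 = lam + eta * c ^ 2) (σ : ℝ)
    (k : ℕ) : action lam eta σ (boundState a c k) = c ^ 2 / 2 * (a * (4 * k + 1) - σ) := by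
  rw [action, energy_boundState ha hM, charge, norm_fn_boundState_sq ha]
  ring

/-- The Gaussian with the same `a` and `c` has the same charge and satisfies the same relation `hM`,
while the energy is proportional to `4 k + 1`. -/
theorem isExcited_boundState {lam eta a c : ℝ} (ha : 0 < a) (hc : c ≠ 0)
    (hM : a ^ 2 = lam + eta * c ^ 2) {k : ℕ} (hk : 1 ≤ k) :
    IsExcited lam eta (boundState a c k) := by
  refine ⟨boundState a c 0, ?_, ?_⟩
  · rw [charge, charge, norm_fn_boundState_sq ha, norm_fn_boundState_sq ha]
  · rw [energy_boundState ha hM, energy_boundState ha hM]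
    have hk' : (0 : ℝ) < k := by exact_mod_cast hk
    have : 0 < a * c ^ 2 * k := by positivity
    push_cast
    linarith

/-- The amplitude of the bound states of oscillator frequency `a`, for `eta = 1` or `eta = -1`. -/
def boundAmp (lam eta a : ℝ) : ℝ := √(eta * (a ^ 2 - lam))

/-- The oscillator frequency of the bound state of frequency `σ`, that is, the positive root `a` of
`3 a² - 2 r a - lam = 0` with `r = σ / (4 k + 1)`. -/
def oscFreq (lam : ℝ) (k : ℕ) (σ : ℝ) : ℝ :=
  (σ / (4 * k + 1) + √((σ / (4 * k + 1)) ^ 2 + 3 * lam)) / 3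

/-- The bound states as functions of their frequency. -/
def boundFamily (lam eta : ℝ) (k : ℕ) (σ : ℝ) : SigmaSpace :=
  boundState (oscFreq lam k σ) (boundAmp lam eta (oscFreq lam k σ)) k

/-- The frequency at which the oscillator frequency is `1`. -/
def baseFreq (lam : ℝ) (k : ℕ) : ℝ := (4 * k + 1) * ((3 - lam) / 2)

theorem oscFreq_baseFreq {lam : ℝ} (hlam : 0 ≤ lam) (k : ℕ) : oscFreq lam k (baseFreq lam k) = 1 := by
  have h : (4 * k + 1 : ℝ) ≠ 0 := by positivity
  rw [oscFreq, baseFreq, mul_div_cancel_left₀ _ h]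
  have e : ((3 - lam) / 2) ^ 2 + 3 * lam = ((3 + lam) / 2) ^ 2 := by ring
  rw [e, Real.sqrt_sq (by positivity)]
  ring

theorem boundFamily_baseFreq {lam : ℝ} (hlam : 0 ≤ lam) (eta : ℝ) (k : ℕ) :
    boundFamily lam eta k (baseFreq lam k) = boundState 1 (boundAmp lam eta 1) k := by
  rw [boundFamily, oscFreq_baseFreq hlam]

/-- The conditions on a frequency `σ` under which the bound state of frequency `σ` is regular. -/
structure IsRegularFreq (lam eta : ℝ) (k : ℕ) (σ : ℝ) : Prop where
  contDiffAt : ContDiffAt ℝ 1 (oscFreq lam k) σ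
  pos : 0 < oscFreq lam k σ
  amp_pos : 0 < eta * (oscFreq lam k σ ^ 2 - lam)
  -- This is `σ = a (4 k + 1) + eta ‖x φ‖²` with `‖x φ‖² = c² (4 k + 1) / (2 a)` and `eta c² = a² -
  -- lam`, cleared of denominators.
  eq : 2 * oscFreq lam k σ * σ = (4 * k + 1) * (3 * oscFreq lam k σ ^ 2 - lam)

/-- The normalization `eta (1 - lam) = 1`, valid for both parameter pairs of the theorem, makes the
amplitude `1` at `a = 1`. The inequalities persist nearby by continuity. -/
theorem eventually_isRegularFreq {lam eta : ℝ} (hlam : 0 ≤ lam) (heta : eta * (1 - lam) = 1)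
    (k : ℕ) : ∀ᶠ σ in 𝓝 (baseFreq lam k), IsRegularFreq lam eta k σ := by
  have hk : (4 * k + 1 : ℝ) ≠ 0 := by positivity
  have hpos : 0 < (baseFreq lam k / (4 * k + 1)) ^ 2 + 3 * lam := by
    rw [baseFreq, mul_div_cancel_left₀ _ hk]
    have e : ((3 - lam) / 2) ^ 2 + 3 * lam = ((3 + lam) / 2) ^ 2 := by ring
    rw [e]
    positivity
  have hcd : ContDiffAt ℝ 1 (oscFreq lam k) (baseFreq lam k) := by
    have h : ContDiffAt ℝ 1 (fun σ : ℝ => σ / (4 * k + 1)) (baseFreq lam k) :=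
      contDiffAt_id.div_const _
    exact (h.add (((h.pow 2).add contDiffAt_const).sqrt hpos.ne')).div_const 3
  have hc := hcd.continuousAt
  have h1 : ∀ᶠ σ in 𝓝 (baseFreq lam k), 0 < oscFreq lam k σ :=
    hc.eventually (lt_mem_nhds (by rw [oscFreq_baseFreq hlam]; exact one_pos))
  have hc2 : ContinuousAt (fun σ => eta * (oscFreq lam k σ ^ 2 - lam)) (baseFreq lam k) :=
    continuousAt_const.mul ((hc.pow 2).sub continuousAt_const)
  have h2 : ∀ᶠ σ in 𝓝 (baseFreq lam k), 0 < eta * (oscFreq lam k σ ^ 2 - lam) := by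
    refine hc2.eventually (lt_mem_nhds ?_)
    beta_reduce
    rw [oscFreq_baseFreq hlam, one_pow, heta]
    exact one_pos
  filter_upwards [h1, h2, hcd.eventually (by simp)] with σ h1 h2 h3
  refine ⟨h3, h1, h2, ?_⟩
  have hs : 0 ≤ (σ / (4 * k + 1)) ^ 2 + 3 * lam := by positivity
  have hsq := Real.sq_sqrt hs
  have hr : σ = (4 * k + 1) * (σ / (4 * k + 1)) := by field_simp
  rw [oscFreq]
  set r := σ / (4 * k + 1)
  rw [hr]
  linear_combination (-(4 * k + 1 : ℝ) / 3) * hsq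

namespace IsRegularFreq

variable {lam eta : ℝ} {k : ℕ} {σ : ℝ}

theorem boundAmp_sq (h : IsRegularFreq lam eta k σ) :
    boundAmp lam eta (oscFreq lam k σ) ^ 2 = eta * (oscFreq lam k σ ^ 2 - lam) :=
  Real.sq_sqrt h.amp_pos.le

theorem boundAmp_ne_zero (h : IsRegularFreq lam eta k σ) :
    boundAmp lam eta (oscFreq lam k σ) ≠ 0 := (Real.sqrt_pos.2 h.amp_pos).ne'

theorem freq_sq (h : IsRegularFreq lam eta k σ) (heta : eta * eta = 1) : oscFreq lam k σ ^ 2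
    = lam + eta * boundAmp lam eta (oscFreq lam k σ) ^ 2 := by
  rw [h.boundAmp_sq]
  linear_combination (lam - oscFreq lam k σ ^ 2) * heta

theorem freq_eq (h : IsRegularFreq lam eta k σ) (heta : eta * eta = 1) :
    σ = oscFreq lam k σ * (4 * k + 1)
      + eta * formMulX (boundFamily lam eta k σ) (boundFamily lam eta k σ) := by
  rw [boundFamily, formMulX_boundState_self h.pos, h.boundAmp_sq]
  have h1 := h.pos.ne'
  have h2 := h.eq
  field_simp
  linear_combination h2 - (4 * k + 1) * (oscFreq lam k σ ^ 2 - lam) * heta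

theorem contDiffAt_boundFamily (h : IsRegularFreq lam eta k σ) :
    ContDiffAt ℝ 1 (boundFamily lam eta k) σ := by
  have h1 : ContDiffAt ℝ 1 (fun σ => boundAmp lam eta (oscFreq lam k σ)) σ :=
    (contDiffAt_const.mul ((h.contDiffAt.pow 2).sub contDiffAt_const)).sqrt h.amp_pos.ne'
  have h2 : ContDiffAt ℝ 1 (fun σ => hermiteFn (oscFreq lam k σ) (2 * k)) σ :=
    ((contDiffOn_hermiteFn (2 * k)).contDiffAt (Ioi_mem_nhds h.pos)).comp σ h.contDiffAt
  exact h1.smul h2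

theorem action_boundFamily (h : IsRegularFreq lam eta k σ) (heta : eta * eta = 1) :
    action lam eta σ (boundFamily lam eta k σ)
      = -(eta * (4 * k + 1) / 4) * ((oscFreq lam k σ ^ 2 - lam) ^ 2 / oscFreq lam k σ) := by
  rw [boundFamily, action_boundState h.pos (h.freq_sq heta), h.boundAmp_sq]
  have h1 := h.pos.ne'
  field_simp
  linear_combination (-(eta * (oscFreq lam k σ ^ 2 - lam)) * 2) * h.eq

/-- The relation `eq` is differentiated implicitly and multiplied by `a`; then `eq` itself
eliminates `σ`. -/
theorem hasDerivAt_oscFreq (h : IsRegularFreq lam eta k σ) (hlam : 0 ≤ lam)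
    (hev : ∀ᶠ τ in 𝓝 σ, IsRegularFreq lam eta k τ) : HasDerivAt (oscFreq lam k)
      (2 * oscFreq lam k σ ^ 2 / ((4 * k + 1) * (3 * oscFreq lam k σ ^ 2 + lam))) σ := by
  have hd := (h.contDiffAt.differentiableAt one_ne_zero).hasDerivAt
  have h1 := (hd.const_mul 2).mul (hasDerivAt_id σ)
  have h2 := (((hd.pow 2).const_mul 3).sub_const lam).const_mul (4 * k + 1 : ℝ)
  have h3 := h1.unique (h2.congr_of_eventuallyEq (hev.mono fun τ hτ => hτ.eq))
  refine hd.congr_deriv ?_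
  have hp := h.pos
  have h4 : 0 < 3 * oscFreq lam k σ ^ 2 + lam := by positivity
  rw [eq_div_iff (by positivity)]
  simp only [id_eq, Nat.cast_ofNat] at h3
  linear_combination (-oscFreq lam k σ) * h3 + deriv (oscFreq lam k) σ * h.eq

end IsRegularFreq

theorem isStandingWaveMap_boundFamily {lam eta : ℝ} (hlam : 0 ≤ lam) (heta : eta * (1 - lam) = 1)
    (heta' : eta * eta = 1) (k : ℕ) :
    IsStandingWaveMap lam eta (baseFreq lam k) (boundFamily lam eta k) := by
  obtain ⟨ε, hε, h⟩ := Metric.eventually_nhds_iff_ball.1 (eventually_isRegularFreq hlam heta k)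
  rw [Real.ball_eq_Ioo] at h
  refine ⟨ε, hε, fun σ hσ => (h σ hσ).contDiffAt_boundFamily.contDiffWithinAt, fun σ hσ => ?_⟩
  have hr := h σ hσ
  refine ⟨boundState_even _ _ _, ?_, ?_⟩
  · have := hasFDerivAt_action lam eta σ (boundFamily lam eta k σ)
    rwa [boundFamily, actionDeriv_boundState hr.pos (hr.freq_sq heta') (hr.freq_eq heta')] at this
  · refine hessEigenspace_zero_boundState hr.pos (hr.freq_sq heta') (hr.freq_eq heta')
      hr.boundAmp_ne_zero (left_ne_zero_of_mul_eq_one heta') fun h0 => ?_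
    -- The excluded value `eta c² = 4 a²` would give `3 a² + lam = 0`.
    have h1 := hr.freq_sq heta'
    have h2 := hr.pos
    rw [h0] at h1
    nlinarith

/-- The first derivative of `d` is minus the charge, `-(eta / 2) (a² - lam)`. The second follows
from the derivative of `a` in `σ`, which is positive. -/
theorem deriv_deriv_action_boundFamily {lam eta : ℝ} (hlam : 0 ≤ lam)
    (heta : eta * (1 - lam) = 1) (heta' : eta * eta = 1) (k : ℕ) :
    deriv (deriv fun σ => action lam eta σ (boundFamily lam eta k σ)) (baseFreq lam k)
      = -eta * (2 / ((4 * k + 1) * (3 + lam))) := by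
  have hev := (eventually_isRegularFreq hlam heta k).eventually_nhds
  have h1 : deriv (fun σ => action lam eta σ (boundFamily lam eta k σ))
      =ᶠ[𝓝 (baseFreq lam k)] fun σ => -(eta / 2) * (oscFreq lam k σ ^ 2 - lam) := by
    filter_upwards [hev] with σ hσ
    have hr := hσ.self_of_nhds
    have hp := hr.pos
    have hd := hr.hasDerivAt_oscFreq hlam hσ
    have hd' := ((((hd.pow 2).sub_const lam).pow 2).div hd hp.ne').const_mul
      (-(eta * (4 * k + 1) / 4))
    rw [(hd'.congr_of_eventuallyEq (hσ.mono fun τ hτ => hτ.action_boundFamily heta')).deriv]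
    have h4 : 0 < 3 * oscFreq lam k σ ^ 2 + lam := by positivity
    simp only [Pi.pow_apply]
    field_simp
    ring
  rw [h1.deriv_eq]
  have hr := hev.self_of_nhds
  have hd := hr.self_of_nhds.hasDerivAt_oscFreq hlam hr
  refine (((hd.pow 2).sub_const lam).const_mul (-(eta / 2))).deriv.trans ?_
  rw [oscFreq_baseFreq hlam]
  ring

theorem isStable_boundFamily {lam eta : ℝ} (hlam : 0 ≤ lam) (heta : eta * (1 - lam) = 1)
    (heta' : eta * eta = 1) (k : ℕ) :
    IsStable lam eta (baseFreq lam k) (boundFamily lam eta k (baseFreq lam k)) := by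
  have hr := (eventually_isRegularFreq hlam heta k).self_of_nhds
  have h1 := hr.freq_sq heta'
  have h2 := hr.freq_eq heta'
  rw [boundFamily_baseFreq hlam] at h2 ⊢
  rw [oscFreq_baseFreq hlam] at h1 h2
  refine isStable_of_continuousAt one_pos (fun b => hermiteFn_even b k) ?_ ?_ ?_
  · have hc : ContinuousAt (boundAmp lam eta) 1 := by
      unfold boundAmp
      fun_prop
    exact hc.smul ((contDiffOn_hermiteFn (2 * k)).continuousOn.continuousAt (Ioi_mem_nhds one_pos))
  · exact h1.trans (by rw [← norm_fn_boundState_sq one_pos _ k]; rfl)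
  · refine h2.trans ?_
    have e : formMulX (boundState 1 (boundAmp lam eta 1) k) (boundState 1 (boundAmp lam eta 1) k)
        = ‖(boundAmp lam eta 1 • hermiteFn 1 (2 * k)).mulX‖ ^ 2 := reInner_self _
    rw [e]
    push_cast
    ring

theorem isExcited_boundFamily {lam eta : ℝ} (hlam : 0 ≤ lam) (heta : eta * (1 - lam) = 1)
    (heta' : eta * eta = 1) {k : ℕ} (hk : 1 ≤ k) :
    IsExcited lam eta (boundFamily lam eta k (baseFreq lam k)) := by
  have hr := (eventually_isRegularFreq hlam heta k).self_of_nhds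
  exact isExcited_boundState hr.pos hr.boundAmp_ne_zero (hr.freq_sq heta') hk

theorem hasMorseIndex_boundFamily {lam eta : ℝ} (hlam : 0 ≤ lam) (heta : eta * (1 - lam) = 1)
    (heta' : eta * eta = 1) (k : ℕ) {n : ℕ}
    (hn : Module.finrank ℝ ↥(⨆ μ : Iio (0 : ℝ),
      Module.End.eigenspace (hessOp 1 eta k) (μ : ℝ)) = n) :
    HasMorseIndex lam eta (baseFreq lam k) (boundFamily lam eta k (baseFreq lam k)) n := by
  have hr := (eventually_isRegularFreq hlam heta k).self_of_nhds
  refine hasMorseIndex_boundState hr.pos (hr.freq_sq heta') (hr.freq_eq heta') ?_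
  -- At `a = 1` the coupling `eta c²` is `eta * (eta * (1 - lam)) = eta`.
  rw [hr.boundAmp_sq, oscFreq_baseFreq hlam, one_pow, heta, mul_one]
  exact hn

end

end

/-! ### Conclusion, with `k = m` and oscillator frequency `1` in both cases -/

theorem theorem4 :
    (∀ m : ℕ, ∃ (ω : ℝ) (φ : ℝ → SigmaSpace),
      IsStandingWaveMap 0 1 ω φ ∧
      IsStable 0 1 ω (φ ω) ∧
      deriv (deriv fun σ => action 0 1 σ (φ σ)) ω < 0 ∧
      HasMorseIndex 0 1 ω (φ ω) (2 * m) ∧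
      (1 ≤ m → IsExcited 0 1 (φ ω))) ∧
    (∀ m : ℕ, ∃ (ω : ℝ) (φ : ℝ → SigmaSpace),
      IsStandingWaveMap 2 (-1) ω φ ∧
      IsStable 2 (-1) ω (φ ω) ∧
      0 < deriv (deriv fun σ => action 2 (-1) σ (φ σ)) ω ∧
      HasMorseIndex 2 (-1) ω (φ ω) (2 * m + 1) ∧
      (1 ≤ m → IsExcited 2 (-1) (φ ω))) := by
  refine ⟨fun m => ⟨baseFreq 0 m, boundFamily 0 1 m, ?_, ?_, ?_, ?_, ?_⟩,
    fun m => ⟨baseFreq 2 m, boundFamily 2 (-1) m, ?_, ?_, ?_, ?_, ?_⟩⟩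
  · exact isStandingWaveMap_boundFamily le_rfl (by norm_num) (by norm_num) m
  · exact isStable_boundFamily le_rfl (by norm_num) (by norm_num) m
  · rw [deriv_deriv_action_boundFamily le_rfl (by norm_num) (by norm_num), neg_mul, neg_lt_zero]
    positivity
  · refine hasMorseIndex_boundFamily le_rfl (by norm_num) (by norm_num) m ?_
    have h := hessOp_morse_self one_pos m
    rwa [one_pow] at h
  · exact isExcited_boundFamily le_rfl (by norm_num) (by norm_num)
  · exact isStandingWaveMap_boundFamily zero_le_two (by norm_num) (by norm_num) m
  · exact isStable_boundFamily zero_le_two (by norm_num) (by norm_num) m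
  · rw [deriv_deriv_action_boundFamily zero_le_two (by norm_num) (by norm_num), neg_neg, one_mul]
    positivity
  · exact hasMorseIndex_boundFamily zero_le_two (by norm_num) (by norm_num) m (hessOp_morse_neg m)
  · exact isExcited_boundFamily zero_le_two (by norm_num) (by norm_num)
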